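/- Let $V_1,V_2$ be disjoint sets of $n$ vertices each, and let $G$ be the random graph on $V=V_1\cup V_2$ in which the pairs of distinct vertices are edges independently, with probability $a/n$ for two vertices of the same block and $b/n$ for two vertices of different blocks. A partition $(V_1',V_2')$ of $V$ is called $\gamma$-correct if, after possibly exchanging the names of $V_1'$ and $V_2'$, $|V_i\cap V_i'|\ge(1-\gamma)n$ for $i=1,2$. **Spectral Partition**, given a graph $H$ on $V$ and a number $d$: zero out, in the adjacency matrix of $H$, all rows and columns of vertices whose degree is greater than $20d$; let $W$ be the eigenspace of the two largest eigenvalues of the resulting matrix (counted with multiplicity), $v_1$ the orthogonal projection of the all-ones vector onto $W$, and $v_2$ a unit vector of $W$ perpendicular to $v_1$; output $(V_1',V_2')$, where $V_1'$ consists of the $n$ vertices with the largest values in $v_2$ and $V_2'$ of the remaining $n$ vertices. Choices that are left open (the sign of $v_2$, ties) are made by any fixed rule depending on $H$. **Correction**, given a partition $(V_1',V_2')$ and a graph $B$ on $V$: call $u\in V_i'$ bad if it has at least $\frac{a+b}{4}$ neighbours of $B$ in $V_{3-i}'$; move every bad vertex to the other part, all simultaneously. **Partition**, given $G$: colour each edge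 of $G$ Red or Blue independently with probability $1/2$ each; run Spectral Partition on the Red graph to obtain $(V_1',V_2')$; run Correction on $(V_1',V_2')$ and the Blue graph; output the result. **Theorem.** There are constants $C_0,C_1>0$ such that the following holds. Let $a>b>C_0$ and $\gamma>0$ be constants with $$\frac{(a-b)^2}{a+b}\ \ge\ C_1\log\frac1\gamma .$$ Then, for either of the choices $d=a+b$ and $d=\frac{a+b}{2}$ of the parameter of Spectral Partition, and for every rule for the choices left open in it, the probability (over $G$ and the colouring) that Partition outputs a $\gamma$-correct partition tends to $1$ as $n\to\infty$. -/

import Mathlib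

open MeasureTheory Filter Topology

noncomputable section

namespace BlockModel

/-! ### The two-block stochastic block model -/

/-- The `2n` vertices: two copies of `Fin n`, one for each hidden block. -/
abbrev Vtx (n : ℕ) : Type := Fin n ⊕ Fin n

/-- The first hidden block `V₁`. -/
def block₁ (n : ℕ) : Finset (Vtx n) := Finset.univ.map Function.Embedding.inl

/-- The second hidden block `V₂`. -/
def block₂ (n : ℕ) : Finset (Vtx n) := Finset.univ.map Function.Embedding.inr

/-- The law of a coin that shows `true` with probability `x` (with `x` clipped to `[0, 1]`, which
matters only for the finitely many `n` with `a / n > 1`). -/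
def coin (x : ℝ) : Measure Bool :=
  ProbabilityTheory.bernoulliMeasure true false (Set.projIcc 0 1 zero_le_one x)

instance (x : ℝ) : IsProbabilityMeasure (coin x) := by unfold coin; infer_instance

/-- The probability that a pair of vertices is an edge: `a / n` inside a block, `b / n` across. -/
def edgeProb (a b : ℝ) (n : ℕ) : Sym2 (Vtx n) → ℝ :=
  Sym2.lift ⟨fun u v => if u.isLeft = v.isLeft then a / n else b / n, fun u v => by
    simp only [eq_comm]⟩

/-- The graph whose edges are the (non-diagonal) pairs marked `true`. -/
def graphOf {V : Type} (ω : Sym2 V → Bool) : SimpleGraph V :=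
  SimpleGraph.fromEdgeSet {e | ω e = true}

/-- The law of the stochastic block model with two blocks of size `n`: the pairs of distinct
vertices are edges independently, with the probabilities `edgeProb a b n`. -/
def sbm (a b : ℝ) (n : ℕ) : Measure (SimpleGraph (Vtx n)) :=
  (Measure.pi fun e => coin (edgeProb a b n e)).map graphOf

instance (a b : ℝ) (n : ℕ) : IsProbabilityMeasure (sbm a b n) :=
  Measure.isProbabilityMeasure_map (Measurable.of_discrete).aemeasurable

/-! ### γ-correct partitions -/

/-- `(V₁', V₂')` is `γ`-correct for the hidden blocks, as labelled:
`|Vᵢ ∩ Vᵢ'| ≥ (1 - γ) n` for `i = 1, 2`. -/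
def IsCorrectLabelled {n : ℕ} (γ : ℝ) (P : Finset (Vtx n) × Finset (Vtx n)) : Prop :=
  (1 - γ) * n ≤ ((block₁ n ∩ P.1).card : ℝ) ∧ (1 - γ) * n ≤ ((block₂ n ∩ P.2).card : ℝ)

/-- `(V₁', V₂')` is `γ`-correct. The blocks are hidden and play symmetric roles, so the partition is
recovered up to the names of its two parts. -/
def IsCorrect {n : ℕ} (γ : ℝ) (P : Finset (Vtx n) × Finset (Vtx n)) : Prop :=
  IsCorrectLabelled γ P ∨ IsCorrectLabelled γ P.swap

/-! ### Spectral Partition -/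

open Classical in
/-- The adjacency matrix of `G` with the rows and columns of all vertices of degree greater than
`T` zeroed out. -/
def prunedAdj {V : Type} [Fintype V] (G : SimpleGraph V) (T : ℝ) : Matrix V V ℝ :=
  fun i j => if T < G.degree i ∨ T < G.degree j then 0 else G.adjMatrix ℝ i j

/-- `W` is an eigenspace of the symmetric matrix `A` for its top two eigenvalues, counted with
multiplicity: it is spanned by the first two vectors of an orthonormal eigenbasis whose eigenvalues
are in non-increasing order. It is unique unless the second and third eigenvalue coincide. -/
def IsTopTwoEigenspace {V : Type} [Fintype V] [DecidableEq V] (A : Matrix V V ℝ)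
    (W : Submodule ℝ (EuclideanSpace ℝ V)) : Prop :=
  ∃ (μ : Fin (Fintype.card V) → ℝ)
    (e : OrthonormalBasis (Fin (Fintype.card V)) ℝ (EuclideanSpace ℝ V)),
    Antitone μ ∧ (∀ i, Matrix.toEuclideanLin A (e i) = μ i • e i) ∧
      W = Submodule.span ℝ (e '' {i | (i : ℕ) < 2})

/-- `P = (V₁', V₂')` is a possible output of Spectral Partition on the graph `G` with degree
parameter `d`. Zero out the vertices of degree greater than `20 d`; take the eigenspace `W` of the
top two eigenvalues; let `v₁` be the projection of the all-ones vector to `W`, and `v₂` a unit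
vector of `W` perpendicular to `v₁`; let `V₁'` consist of the top `n` vertices with respect to
their values in `v₂`, and let `V₂'` be the remaining `n` vertices. Any choice that these steps
leave open (the sign of `v₂`, ties) is allowed. -/
def IsSpectralOutput {n : ℕ} (d : ℝ) (G : SimpleGraph (Vtx n))
    (P : Finset (Vtx n) × Finset (Vtx n)) : Prop :=
  ∃ (W : Submodule ℝ (EuclideanSpace ℝ (Vtx n))) (v₁ v₂ : EuclideanSpace ℝ (Vtx n)),
    IsTopTwoEigenspace (prunedAdj G (20 * d)) W ∧
    v₁ = W.starProjection (WithLp.toLp 2 fun _ => 1) ∧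
    v₂ ∈ W ∧ ‖v₂‖ = 1 ∧ inner ℝ v₁ v₂ = 0 ∧
    P.1.card = n ∧ P.2 = P.1ᶜ ∧ ∀ i ∈ P.1, ∀ j ∈ P.2, v₂ j ≤ v₂ i

/-- `S` is an implementation of Spectral Partition with degree parameter `d`: a rule that sends
every input graph to a possible output. -/
def IsSpectralPartition (d : ℝ)
    (S : (n : ℕ) → SimpleGraph (Vtx n) → Finset (Vtx n) × Finset (Vtx n)) : Prop :=
  ∀ n, 0 < n → ∀ G : SimpleGraph (Vtx n), IsSpectralOutput d G (S n G)

/-! ### Correction -/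

open Classical in
/-- The number of neighbours of `u` in the set `S`. -/
def nbrCount {V : Type} (G : SimpleGraph V) (u : V) (S : Finset V) : ℕ :=
  (S.filter fun w => G.Adj u w).card

open Classical in
/-- Given a partition `P = (V₁', V₂')` and a graph `B`, a vertex of `Vᵢ'` is bad if it has at least
`t` neighbours in the other part; each bad vertex is moved to the other part. -/
def correction {V : Type} (t : ℝ) (B : SimpleGraph V) (P : Finset V × Finset V) :
    Finset V × Finset V :=
  (P.1.filter (fun u => ¬ t ≤ nbrCount B u P.2) ∪ P.2.filter (fun u => t ≤ nbrCount B u P.1),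
   P.2.filter (fun u => ¬ t ≤ nbrCount B u P.1) ∪ P.1.filter (fun u => t ≤ nbrCount B u P.2))

/-! ### The two-step algorithm -/

/-- A colouring of all pairs; `true` is Red and `false` is Blue. Only the colours of the edges of
the input graph are used. -/
abbrev Colouring (n : ℕ) : Type := Sym2 (Vtx n) → Bool

/-- Each pair is Red or Blue with probability `1 / 2`, independently. -/
def colouringLaw (n : ℕ) : Measure (Colouring n) := Measure.pi fun _ => coin (1 / 2)

instance (n : ℕ) : IsProbabilityMeasure (colouringLaw n) := by
  unfold colouringLaw; infer_instance

/-- The subgraph of `G` formed by the edges of colour `c`. -/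
def colourClass {n : ℕ} (G : SimpleGraph (Vtx n)) (χ : Colouring n) (c : Bool) :
    SimpleGraph (Vtx n) :=
  SimpleGraph.fromEdgeSet {e | e ∈ G.edgeSet ∧ χ e = c}

/-- The algorithm Partition: run Spectral Partition (implemented by `S`) on the Red graph, then
Correction with threshold `(a + b) / 4` on the Blue graph. -/
def partitionAlg (a b : ℝ)
    (S : (n : ℕ) → SimpleGraph (Vtx n) → Finset (Vtx n) × Finset (Vtx n)) (n : ℕ)
    (G : SimpleGraph (Vtx n)) (χ : Colouring n) : Finset (Vtx n) × Finset (Vtx n) :=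
  correction ((a + b) / 4) (colourClass G χ false) (S n (colourClass G χ true))

/-! ### Implementations of Spectral Partition exist -/

lemma exists_top {V : Type} [Fintype V] [DecidableEq V] (f : V → ℝ) (k : ℕ)
    (hk : k ≤ Fintype.card V) :
    ∃ s : Finset V, s.card = k ∧ ∀ i ∈ s, ∀ j ∈ sᶜ, f j ≤ f i := by
  induction k with
  | zero => exact ⟨∅, by simp⟩
  | succ k ih =>
    obtain ⟨s, hs, h⟩ := ih (by omega)
    have hne : sᶜ.Nonempty := by
      rw [← Finset.card_pos, Finset.card_compl]; omega
    obtain ⟨m, hm, hmax⟩ := Finset.exists_max_image sᶜ f hne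
    have hms : m ∉ s := by simpa using hm
    refine ⟨insert m s, by rw [Finset.card_insert_of_notMem hms, hs], ?_⟩
    intro i hi j hj
    have hj' : j ∈ sᶜ := by
      simp only [Finset.mem_compl, Finset.mem_insert, not_or] at hj ⊢
      exact hj.2
    rcases Finset.mem_insert.1 hi with rfl | hi
    · exact hmax j hj'
    · exact h i hi j hj'

lemma exists_isTopTwoEigenspace {V : Type} [Fintype V] [DecidableEq V] (A : Matrix V V ℝ)
    (hA : A.IsHermitian) (hV : 2 ≤ Fintype.card V) :
    ∃ W, IsTopTwoEigenspace A W ∧ Module.finrank ℝ W = 2 := by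
  have hS := Matrix.isSymmetric_toEuclideanLin_iff.mpr hA
  set e := hS.eigenvectorBasis finrank_euclideanSpace with he
  refine ⟨_, ⟨hS.eigenvalues finrank_euclideanSpace, e, hS.eigenvalues_antitone _,
    fun i => hS.apply_eigenvectorBasis _ i, rfl⟩, ?_⟩
  have hli : LinearIndependent ℝ (fun i : {i : Fin (Fintype.card V) | (i : ℕ) < 2} => e i) :=
    e.orthonormal.linearIndependent.comp _ Subtype.val_injective
  rw [← Set.range_domRestrict e]
  refine (finrank_span_eq_card hli).trans ?_
  rw [Fintype.card_of_bijective
    (f := fun i : {i : Fin (Fintype.card V) | (i : ℕ) < 2} => (⟨i.1, i.2⟩ : Fin 2))]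
  · simp
  · refine ⟨fun x y h => ?_, fun y => ⟨⟨⟨y, by omega⟩, y.2⟩, rfl⟩⟩
    apply Subtype.ext; apply Fin.ext
    simpa using congrArg Fin.val h

/-- Spectral Partition can always be carried out. -/
theorem exists_isSpectralPartition (d : ℝ) : ∃ S, IsSpectralPartition d S := by
  have key : ∀ n, 0 < n → ∀ G : SimpleGraph (Vtx n), ∃ P, IsSpectralOutput d G P := by
    intro n hn G
    have hA : (prunedAdj G (20 * d)).IsHermitian := by
      ext i j
      have hij : G.Adj j i ↔ G.Adj i j := G.adj_comm j i
      by_cases h : G.Adj i j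
      · simp [prunedAdj, Matrix.conjTranspose_apply, or_comm, h, hij.2 h]
      · simp [prunedAdj, Matrix.conjTranspose_apply, h, mt hij.1 h]
    obtain ⟨W, hW, hfr⟩ := exists_isTopTwoEigenspace _ hA
      (by simp only [Fintype.card_sum, Fintype.card_fin]; omega)
    set v₁ := W.starProjection (WithLp.toLp 2 fun _ => (1 : ℝ)) with hv₁
    obtain ⟨w, hw0, hw⟩ : ∃ w : W, w ≠ 0 ∧ inner ℝ v₁ (w : EuclideanSpace ℝ (Vtx n)) = 0 := by
      let φ : W →ₗ[ℝ] ℝ := (innerₛₗ ℝ v₁).comp W.subtype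
      have : LinearMap.ker φ ≠ ⊥ := by
        apply LinearMap.ker_ne_bot_of_finrank_lt
        simp [hfr]
      obtain ⟨w, hw, h0⟩ := Submodule.exists_mem_ne_zero_of_ne_bot this
      exact ⟨w, h0, by simpa [φ] using hw⟩
    have hw0' : (w : EuclideanSpace ℝ (Vtx n)) ≠ 0 := by simpa using hw0
    set v₂ : EuclideanSpace ℝ (Vtx n) := (‖(w : EuclideanSpace ℝ (Vtx n))‖⁻¹ : ℝ) • w with hv₂
    obtain ⟨s, hs, h⟩ := exists_top (fun i => v₂ i) n (by simp)
    exact ⟨(s, sᶜ), W, v₁, v₂, hW, hv₁, W.smul_mem _ w.2, norm_smul_inv_norm hw0',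
      by simp [hv₂, inner_smul_right, hw], hs, rfl, h⟩
  choose! S hS using key
  exact ⟨S, hS⟩

end BlockModel

end

open MeasureTheory Filter Topology

noncomputable section

namespace BlockModel

set_option linter.unusedSectionVars false

/-! Given the red graph, the blue edges are still independent. So it suffices that Spectral
Partition places nine tenths of each block correctly from the red edges; one vote of each vertex,
decided by the fresh blue edges, then lowers the error to `γ`.

Spectral step. Up to its diagonal, the expected red adjacency matrix has the all-ones vector and the
vector `σ` of block signs as eigenvectors, with eigenvalues (a+b)/2 and (a-b)/2, and vanishes on
their complement. On the vertices of degree at most 20d the centred red matrix has norm O(√(a+b))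
(`abs_bilin_centredAdj_le`), which the hypothesis makes small against a-b. By Courant–Fischer
(`le_bilin_of_mem_topTwo`) the pruned form is therefore nearly (a-b)/2 or more on unit vectors of W.
Since v₂ lies in W and is orthogonal to the projection of the all-ones vector, it is orthogonal to
the all-ones vector itself; so its form is about (a-b)/2 times the squared cosine of its angle with
`σ`. Hence v₂ is close to ±σ/√(2n), and the n largest values miss at most n/10 vertices of a block
(`isCorrect_of_isSpectralOutput`).

Norm bound. This is the method of Kahn and Szemerédi. With D = a+b and N = 2n, the pairs with |x_i
x_j| ≤ √D/N (up to a constant) are light: Chernoff's bound beats a union bound over a lattice net of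
the unit ball (`measure_not_lightBound_le`). The heavy pairs are controlled by a bound on the number
of edges between any two vertex sets (`measure_not_discBound_le`), applied to the dyadic level sets
of x, and by the degree bound where x_i and x_j have very different sizes (`heavy_le`). Both events
concern all net vectors and all sets at once, so the dependence of the pruned set on the graph does
no harm.

Correction. A vertex outside a few of very large red degree has an expected number of blue
neighbours in the other part that is at least (a-b)/6 away from (a+b)/4, on the right side. It is
misjudged with probability at most exp(-(a-b)²/(72(a+b))) ≤ γ/4. The votes of two vertices share a
single pair, so their covariance is O(1/n) and Chebyshev's inequality suffices
(`star_concentration`, `correction_improves`).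

If 1-γ is at most a tiny constant, the hypothesis no longer bounds (a-b)²/(a+b) from below, and the
spectral step may be worthless. Any balanced partition is still half right after naming its parts
suitably, and by anticoncentration (`coins_anticoncentration`) Correction leaves each correctly
placed vertex where it is with probability bounded below (`correction_keeps_fraction`). That already
gives a positive fraction. -/

/-! ### Products of independent coins -/

/-- The real-valued indicator of a Boolean. -/
def bit (b : Bool) : ℝ := if b then 1 else 0

@[simp] lemma bit_true : bit true = 1 := rfl

@[simp] lemma bit_false : bit false = 0 := rfl

lemma bit_nonneg (b : Bool) : 0 ≤ bit b := by cases b <;> simp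

lemma integral_coin {x : ℝ} (h0 : 0 ≤ x) (h1 : x ≤ 1) (f : Bool → ℝ) :
    ∫ c, f c ∂coin x = x * f true + (1 - x) * f false := by
  unfold coin
  rw [ProbabilityTheory.integral_bernoulliMeasure]
  simp [Set.projIcc_of_mem zero_le_one (⟨h0, h1⟩ : x ∈ Set.Icc (0 : ℝ) 1)]

section Coins

variable {E : Type} [Fintype E] {q : E → ℝ}

/-- The law of independent coins, the coin `e` showing `true` with probability `q e`. -/
def coins (q : E → ℝ) : Measure (E → Bool) := Measure.pi fun e => coin (q e)

instance (q : E → ℝ) : IsProbabilityMeasure (coins q) := by unfold coins; infer_instance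

lemma integrable_coins (f : (E → Bool) → ℝ) : Integrable f (coins q) :=
  Integrable.of_finite

/-- By independence the integral factors, and each factor is handled by 1 + y ≤ exp y with y = q(exp
c - 1): the coins are dominated by Poisson variables. -/
lemma integral_exp_coins (h0 : ∀ e, 0 ≤ q e) (h1 : ∀ e, q e ≤ 1) (c : E → ℝ) :
    ∫ ω, Real.exp (∑ e, c e * (bit (ω e) - q e)) ∂coins q
      ≤ Real.exp (∑ e, q e * (Real.exp (c e) - 1 - c e)) := by
  simp_rw [Real.exp_sum]
  unfold coins
  rw [integral_fintype_prod_eq_prod (fun e b => Real.exp (c e * (bit b - q e)))]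
  refine Finset.prod_le_prod (fun e _ => integral_nonneg fun _ => (Real.exp_pos _).le)
    fun e _ => ?_
  rw [integral_coin (h0 e) (h1 e)]
  have h2 : Real.exp (c e * (1 - q e)) = Real.exp (c e) * Real.exp (-(c e * q e)) := by
    rw [← Real.exp_add]; ring_nf
  have h3 : Real.exp (q e * (Real.exp (c e) - 1 - c e))
      = Real.exp (q e * (Real.exp (c e) - 1)) * Real.exp (-(c e * q e)) := by
    rw [← Real.exp_add]; ring_nf
  have h4 := Real.add_one_le_exp (q e * (Real.exp (c e) - 1))
  have h5 := Real.exp_pos (-(c e * q e))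
  simp only [bit_true, bit_false, zero_sub, mul_neg]
  rw [h2, h3]
  nlinarith

/-- Chernoff's bound for a weighted sum of independent coins. -/
lemma coins_centered_tail (h0 : ∀ e, 0 ≤ q e) (h1 : ∀ e, q e ≤ 1) (c : E → ℝ) (s : ℝ) :
    (coins q).real {ω | s ≤ ∑ e, c e * (bit (ω e) - q e)}
      ≤ Real.exp (∑ e, q e * (Real.exp (c e) - 1 - c e) - s) := by
  have hm := mul_meas_ge_le_integral_of_nonneg (μ := coins q)
    (f := fun ω => Real.exp (∑ e, c e * (bit (ω e) - q e)))
    (Filter.Eventually.of_forall fun _ => (Real.exp_pos _).le) (integrable_coins _) (Real.exp s)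
  have h2 := hm.trans (integral_exp_coins h0 h1 c)
  simp only [Real.exp_le_exp] at h2
  rw [Real.exp_sub, le_div_iff₀ (Real.exp_pos _), mul_comm]
  exact h2

lemma coins_tail (h0 : ∀ e, 0 ≤ q e) (h1 : ∀ e, q e ≤ 1) (c : E → ℝ) (s : ℝ) :
    (coins q).real {ω | s ≤ ∑ e, c e * bit (ω e)}
      ≤ Real.exp (∑ e, q e * (Real.exp (c e) - 1) - s) := by
  have h := coins_centered_tail h0 h1 c (s - ∑ e, c e * q e)
  have e1 : {ω : E → Bool | s - ∑ e, c e * q e ≤ ∑ e, c e * (bit (ω e) - q e)}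
      = {ω | s ≤ ∑ e, c e * bit (ω e)} := by
    ext ω
    simp only [Set.mem_ofPred_eq, mul_sub, Finset.sum_sub_distrib, sub_le_sub_iff_right]
  rw [e1] at h
  refine h.trans_eq ?_
  congr 1
  have : ∑ e, q e * (Real.exp (c e) - 1 - c e)
      = ∑ e, q e * (Real.exp (c e) - 1) - ∑ e, c e * q e := by
    rw [← Finset.sum_sub_distrib]; exact Finset.sum_congr rfl fun e _ => by ring
  rw [this]; ring

end Coins

/-! ### Sums over ordered pairs of vertices -/

section Pairs

variable {V : Type} [Fintype V] [DecidableEq V]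

/-- Quadratic forms run over ordered pairs, but independence holds for unordered ones; the
coefficient of a coin is the sum of `w` over its orderings. -/
lemma sum_pairs_eq_sum_sym2 (w : V → V → ℝ) (f : Sym2 V → ℝ) :
    ∑ i, ∑ j, w i j * f s(i, j)
      = ∑ e, (∑ p : V × V with s(p.1, p.2) = e, w p.1 p.2) * f e := by
  rw [← Fintype.sum_prod_type' (f := fun i j => w i j * f s(i, j)),
    ← Finset.sum_fiberwise (s := Finset.univ) (g := fun p : V × V => s(p.1, p.2))]
  refine Finset.sum_congr rfl fun e _ => ?_
  rw [Finset.sum_mul]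
  refine Finset.sum_congr rfl fun p hp => ?_
  rw [(Finset.mem_filter.1 hp).2]

lemma sum_fiber_sym2 (w : V → V → ℝ) {i j : V} (h : i ≠ j) :
    ∑ p : V × V with s(p.1, p.2) = s(i, j), w p.1 p.2 = w i j + w j i := by
  have : (Finset.univ.filter fun p : V × V => s(p.1, p.2) = s(i, j)) = {(i, j), (j, i)} := by
    ext ⟨x, y⟩; simp
  rw [this, Finset.sum_pair (by simp [h])]

lemma sum_fiber_sym2_diag (w : V → V → ℝ) (i : V) :
    ∑ p : V × V with s(p.1, p.2) = s(i, i), w p.1 p.2 = w i i := by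
  have : (Finset.univ.filter fun p : V × V => s(p.1, p.2) = s(i, i)) = {(i, i)} := by
    ext ⟨x, y⟩; simp
  rw [this, Finset.sum_singleton]

/-- A function that is convex and vanishes at `0`, summed over the unordered pairs. -/
lemma sum_sym2_le_half_sum_pairs (w : V → V → ℝ) (hw : ∀ i, w i i = 0) (q : Sym2 V → ℝ)
    (hq : ∀ e, 0 ≤ q e) {φ : ℝ → ℝ} (hφ : φ 0 = 0)
    (hc : ∀ x y, φ (x + y) ≤ (φ (2 * x) + φ (2 * y)) / 2) :
    ∑ e, q e * φ (∑ p : V × V with s(p.1, p.2) = e, w p.1 p.2)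
      ≤ (1 / 2) * ∑ i, ∑ j, q s(i, j) * φ (2 * w i j) := by
  have h1 : ∑ i, ∑ j, q s(i, j) * φ (2 * w i j)
      = ∑ e, (∑ p : V × V with s(p.1, p.2) = e, φ (2 * w p.1 p.2)) * q e := by
    rw [← sum_pairs_eq_sum_sym2 (fun i j => φ (2 * w i j)) q]
    simp_rw [mul_comm]
  rw [h1, Finset.mul_sum]
  refine Finset.sum_le_sum fun e _ => ?_
  induction e with
  | _ i j =>
    by_cases h : i = j
    · subst h
      rw [sum_fiber_sym2_diag, sum_fiber_sym2_diag (fun i j => φ (2 * w i j))]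
      simp [hw, hφ]
    · rw [sum_fiber_sym2 _ h, sum_fiber_sym2 (fun i j => φ (2 * w i j)) h]
      nlinarith [mul_le_mul_of_nonneg_left (hc (w i j) (w j i)) (hq s(i, j))]

lemma exp_add_le_half (x y : ℝ) :
    Real.exp (x + y) ≤ (Real.exp (2 * x) + Real.exp (2 * y)) / 2 := by
  have h1 : Real.exp (2 * x) = Real.exp x ^ 2 := by rw [← Real.exp_nat_mul]; norm_num
  have h2 : Real.exp (2 * y) = Real.exp y ^ 2 := by rw [← Real.exp_nat_mul]; norm_num
  rw [Real.exp_add, h1, h2]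
  nlinarith [sq_nonneg (Real.exp x - Real.exp y)]

variable {q : Sym2 V → ℝ}

/-- The coin of {i, j} has coefficient w i j + w j i; convexity bounds its exponential by the
average of those of 2 w i j and 2 w j i. This is the origin of the 1/2 and the 2, and `w` need not
be symmetric. -/
lemma coins_pairs_tail (h0 : ∀ e, 0 ≤ q e) (h1 : ∀ e, q e ≤ 1) (w : V → V → ℝ)
    (hw : ∀ i, w i i = 0) (s : ℝ) :
    (coins q).real {ω | s ≤ ∑ i, ∑ j, w i j * bit (ω s(i, j))}
      ≤ Real.exp ((1 / 2) * (∑ i, ∑ j, q s(i, j) * (Real.exp (2 * w i j) - 1)) - s) := by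
  have h := coins_tail h0 h1 (fun e => ∑ p : V × V with s(p.1, p.2) = e, w p.1 p.2) s
  have e1 : ∀ ω : Sym2 V → Bool, ∑ i, ∑ j, w i j * bit (ω s(i, j)) =
      ∑ e, (∑ p : V × V with s(p.1, p.2) = e, w p.1 p.2) * bit (ω e) :=
    fun ω => sum_pairs_eq_sum_sym2 w fun e => bit (ω e)
  refine (le_of_eq (congrArg _ (Set.ext fun ω => ?_))).trans (h.trans (Real.exp_le_exp.2 (sub_le_sub_right ?_ _)))
  · rw [Set.mem_ofPred_eq, Set.mem_ofPred_eq, e1]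
  refine sum_sym2_le_half_sum_pairs w hw q h0 (φ := fun x => Real.exp x - 1) (by simp) ?_
  intro x y
  have := exp_add_le_half x y
  linarith

lemma coins_pairs_centered_tail (h0 : ∀ e, 0 ≤ q e) (h1 : ∀ e, q e ≤ 1) (w : V → V → ℝ)
    (hw : ∀ i, w i i = 0) (s : ℝ) :
    (coins q).real {ω | s ≤ ∑ i, ∑ j, w i j * (bit (ω s(i, j)) - q s(i, j))}
      ≤ Real.exp ((1 / 2) *
          (∑ i, ∑ j, q s(i, j) * (Real.exp (2 * w i j) - 1 - 2 * w i j)) - s) := by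
  have h := coins_centered_tail h0 h1
    (fun e => ∑ p : V × V with s(p.1, p.2) = e, w p.1 p.2) s
  have e1 : ∀ ω : Sym2 V → Bool, ∑ i, ∑ j, w i j * (bit (ω s(i, j)) - q s(i, j)) =
      ∑ e, (∑ p : V × V with s(p.1, p.2) = e, w p.1 p.2) * (bit (ω e) - q e) :=
    fun ω => sum_pairs_eq_sum_sym2 w fun e => bit (ω e) - q e
  refine (le_of_eq (congrArg _ (Set.ext fun ω => ?_))).trans (h.trans (Real.exp_le_exp.2 (sub_le_sub_right ?_ _)))
  · rw [Set.mem_ofPred_eq, Set.mem_ofPred_eq, e1]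
  refine sum_sym2_le_half_sum_pairs w hw q h0 (φ := fun x => Real.exp x - 1 - x) (by simp) ?_
  intro x y
  have := exp_add_le_half x y
  linarith

end Pairs

/-! ### Light pairs -/

lemma sum_sq_mul_sq {V : Type} [Fintype V] (x : V → ℝ) :
    ∑ i, ∑ j, (x i * x j) ^ 2 = (∑ i, x i ^ 2) ^ 2 := by
  rw [sq (∑ i, x i ^ 2), Finset.sum_mul_sum]
  simp_rw [mul_pow]

section Light

variable {V : Type} [Fintype V] [DecidableEq V]

lemma sum_inv_two_pow_natAbs_le (M : ℕ) :
    ∑ m ∈ Finset.Icc (-(M : ℤ)) M, ((1 : ℝ) / 2) ^ m.natAbs ≤ 3 - 2 * (1 / 2) ^ M := by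
  induction M with
  | zero => simp; norm_num
  | succ M ih =>
    have h : Finset.Icc (-((M + 1 : ℕ) : ℤ)) ((M + 1 : ℕ) : ℤ)
        = insert (-((M : ℤ) + 1)) (insert ((M : ℤ) + 1) (Finset.Icc (-(M : ℤ)) M)) := by
      ext x; simp only [Finset.mem_insert, Finset.mem_Icc]; push_cast; omega
    rw [h, Finset.sum_insert (by simp; omega), Finset.sum_insert (by simp)]
    have e1 : (-((M : ℤ) + 1)).natAbs = M + 1 := by omega
    have e2 : ((M : ℤ) + 1).natAbs = M + 1 := by omega
    rw [e1, e2, pow_succ]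
    linarith

lemma exp_neg_sq_le (m : ℤ) : Real.exp (-(m : ℝ) ^ 2) ≤ (1 / 2) ^ m.natAbs := by
  have h1 : ((m.natAbs : ℕ) : ℝ) ≤ (m : ℝ) ^ 2 := by
    have : ((m.natAbs : ℤ)) ≤ m ^ 2 := by
      rw [← Int.natAbs_sq, ← Nat.cast_pow]
      exact Int.ofNat_le.2 (Nat.le_self_pow two_ne_zero m.natAbs)
    have h3 := (Int.cast_le (R := ℝ)).2 this
    rwa [Int.cast_natCast, Int.cast_pow] at h3
  have h2 : Real.exp (-1) ≤ 1 / 2 := by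
    rw [Real.exp_neg, one_div]
    exact inv_anti₀ (by norm_num) (by linarith [Real.add_one_le_exp (1 : ℝ)])
  calc Real.exp (-(m : ℝ) ^ 2) ≤ Real.exp (m.natAbs * (-1)) := Real.exp_le_exp.2 (by linarith)
    _ = Real.exp (-1) ^ m.natAbs := Real.exp_nat_mul _ _
    _ ≤ _ := pow_le_pow_left₀ (Real.exp_pos _).le h2 _

/-! ### Lattice points in a ball -/

/-- The integer vectors of squared length at most `R`. -/
def latticeBall (V : Type) [Fintype V] [DecidableEq V] (R : ℕ) : Finset (V → ℤ) :=
  (Fintype.piFinset fun _ => Finset.Icc (-(R : ℤ)) R).filter fun k => ∑ i, k i ^ 2 ≤ R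

lemma mem_latticeBall {R : ℕ} {k : V → ℤ} : k ∈ latticeBall V R ↔ ∑ i, k i ^ 2 ≤ R := by
  simp only [latticeBall, Finset.mem_filter, Fintype.mem_piFinset, and_iff_right_iff_imp,
    Finset.mem_Icc]
  intro h i
  have h1 : k i ^ 2 ≤ R :=
    (Finset.single_le_sum (f := fun i => k i ^ 2) (fun i _ => sq_nonneg _)
      (Finset.mem_univ i)).trans h
  exact ⟨by nlinarith, by nlinarith⟩

/-- Every point k of the ball has exp(R - |k|²) ≥ 1. The sum of these weights over the surrounding
box factors over the coordinates, each factor being at most 3 ≤ exp 2. -/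
lemma card_latticeBall_le (R : ℕ) :
    ((latticeBall V R).card : ℝ) ≤ Real.exp (R + 2 * Fintype.card V) := by
  have h1 : ((latticeBall V R).card : ℝ)
      ≤ ∑ k ∈ Fintype.piFinset (fun _ : V => Finset.Icc (-(R : ℤ)) R),
          Real.exp R * ∏ i, Real.exp (-(k i : ℝ) ^ 2) := by
    rw [Finset.card_eq_sum_ones, Nat.cast_sum]
    refine (Finset.sum_le_sum fun k hk => ?_).trans
      (Finset.sum_le_sum_of_subset_of_nonneg (Finset.filter_subset _ _) fun k _ _ => by positivity)
    rw [← Real.exp_sum, ← Real.exp_add, Nat.cast_one]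
    refine Real.one_le_exp ?_
    have : ((∑ i, k i ^ 2 : ℤ) : ℝ) ≤ R := by exact_mod_cast (Finset.mem_filter.1 hk).2
    push_cast at this
    rw [Finset.sum_neg_distrib]
    linarith
  refine h1.trans ?_
  rw [← Finset.mul_sum, Finset.sum_prod_piFinset (Finset.Icc (-(R : ℤ)) R)
    (fun (_ : V) (m : ℤ) => Real.exp (-(m : ℝ) ^ 2)), Finset.prod_const, Finset.card_univ,
    Real.exp_add]
  refine mul_le_mul_of_nonneg_left ?_ (Real.exp_pos _).le
  rw [mul_comm, Real.exp_nat_mul]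
  refine pow_le_pow_left₀ (Finset.sum_nonneg fun _ _ => (Real.exp_pos _).le) ?_ _
  have h2 := (Finset.sum_le_sum fun m (_ : m ∈ Finset.Icc (-(R : ℤ)) R) =>
    exp_neg_sq_le m).trans (sum_inv_two_pow_natAbs_le R)
  have h3 : (0 : ℝ) ≤ (1 / 2) ^ R := by positivity
  linarith [Real.add_one_le_exp (2 : ℝ)]

/-! ### Deviations of the light part of the quadratic form -/

/-- The coefficients `x i * x j` of the off-diagonal pairs with `|x i * x j| ≤ τ`. -/
def lightCoeff (τ : ℝ) (x : V → ℝ) (i j : V) : ℝ :=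
  if i ≠ j ∧ |x i * x j| ≤ τ then x i * x j else 0

variable {q : Sym2 V → ℝ}

lemma light_tail [Nonempty V] (h0 : ∀ e, 0 ≤ q e) (h1 : ∀ e, q e ≤ 1) {D L : ℝ} (hL : 0 < L)
    (hDL : D ≤ L ^ 2) (hq : ∀ e, q e ≤ D / Fintype.card V) {x : V → ℝ}
    (hx : ∑ i, x i ^ 2 ≤ 1) {ε : ℝ} (hε : |ε| = 1) :
    (coins q).real {ω | 40 * L ≤ ε * ∑ i, ∑ j, lightCoeff (L / Fintype.card V) x i j *
        (bit (ω s(i, j)) - q s(i, j))} ≤ Real.exp (-(39 / 2) * Fintype.card V) := by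
  set N : ℝ := (Fintype.card V : ℝ) with hN
  have hN0 : 0 < N := by rw [hN]; exact_mod_cast Fintype.card_pos
  have hε2 : ε ^ 2 = 1 := by rw [← sq_abs, hε, one_pow]
  -- The largest tilt with |2 w i j| ≤ 1 on light pairs, so that exp y - 1 - y ≤ y² applies. It
  -- turns the level 40 L into 20 N, while the exponential moment costs at most N/2.
  set θ : ℝ := N / (2 * L) with hθ
  have hθ0 : 0 < θ := by positivity
  set w : V → V → ℝ := fun i j => ε * θ * lightCoeff (L / N) x i j with hw
  have key := coins_pairs_centered_tail h0 h1 w (by simp [hw, lightCoeff]) (20 * N)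
  have hset : {ω : Sym2 V → Bool | 40 * L ≤ ε * ∑ i, ∑ j, lightCoeff (L / N) x i j *
        (bit (ω s(i, j)) - q s(i, j))}
      = {ω | 20 * N ≤ ∑ i, ∑ j, w i j * (bit (ω s(i, j)) - q s(i, j))} := by
    ext ω
    simp only [Set.mem_ofPred_eq, hw, mul_assoc, ← Finset.mul_sum]
    rw [mul_left_comm, ← mul_le_mul_iff_right₀ hθ0]
    have : θ * (40 * L) = 20 * N := by rw [hθ]; field_simp; norm_num
    rw [this]
  rw [hset]
  refine key.trans (Real.exp_le_exp.2 ?_)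
  have hterm : ∀ i j, q s(i, j) * (Real.exp (2 * w i j) - 1 - 2 * w i j)
      ≤ D / N * (4 * θ ^ 2) * (x i * x j) ^ 2 := by
    intro i j
    have hw2 : (w i j) ^ 2 ≤ θ ^ 2 * (x i * x j) ^ 2 := by
      simp only [hw, lightCoeff]
      split_ifs
      · rw [mul_pow, mul_pow, hε2, one_mul]
      · simp; positivity
    have hwabs : |2 * w i j| ≤ 1 := by
      simp only [hw, lightCoeff]
      split_ifs with h
      · rw [abs_mul, abs_mul, abs_mul, hε, abs_two, abs_of_pos hθ0]
        calc 2 * (1 * θ * |x i * x j|) ≤ 2 * (1 * θ * (L / N)) := by gcongr; exact h.2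
          _ = 1 := by rw [hθ]; field_simp
      · simp
    have h2 : Real.exp (2 * w i j) - 1 - 2 * w i j ≤ (2 * w i j) ^ 2 :=
      (le_abs_self _).trans (Real.abs_exp_sub_one_sub_id_le hwabs)
    calc q s(i, j) * (Real.exp (2 * w i j) - 1 - 2 * w i j)
        ≤ q s(i, j) * (2 * w i j) ^ 2 := mul_le_mul_of_nonneg_left h2 (h0 _)
      _ ≤ D / N * (2 * w i j) ^ 2 := mul_le_mul_of_nonneg_right (hq _) (sq_nonneg _)
      _ = D / N * 4 * (w i j) ^ 2 := by ring
      _ ≤ D / N * 4 * (θ ^ 2 * (x i * x j) ^ 2) := by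
          refine mul_le_mul_of_nonneg_left hw2 ?_
          have := (h0 s(i, j)).trans (hq _)
          positivity
      _ = _ := by ring
  have hD0 : 0 ≤ D / N := by
    obtain ⟨v⟩ := ‹Nonempty V›
    exact (h0 s(v, v)).trans (hq _)
  have hsum : ∑ i, ∑ j, q s(i, j) * (Real.exp (2 * w i j) - 1 - 2 * w i j)
      ≤ D / N * (4 * θ ^ 2) := by
    refine (Finset.sum_le_sum fun i _ => Finset.sum_le_sum fun j _ => hterm i j).trans ?_
    simp_rw [← Finset.mul_sum]
    rw [sum_sq_mul_sq]
    have : (∑ i, x i ^ 2) ^ 2 ≤ 1 := pow_le_one₀ (Finset.sum_nonneg fun _ _ => sq_nonneg _) hx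
    nlinarith [mul_nonneg hD0 (by positivity : 0 ≤ 4 * θ ^ 2)]
  have hfin : D / N * (4 * θ ^ 2) ≤ N := by
    have : D / N * (4 * θ ^ 2) = D / L ^ 2 * N := by rw [hθ]; field_simp; norm_num
    rw [this]
    have : D / L ^ 2 ≤ 1 := by rw [div_le_one (by positivity)]; exact hDL
    nlinarith
  linarith

/-- The rescaled lattice vectors, a net of the unit ball. -/
def latticeVec (k : V → ℤ) (i : V) : ℝ := k i / (4 * √(Fintype.card V))

lemma sum_latticeVec_sq_le [Nonempty V] {k : V → ℤ}
    (hk : k ∈ latticeBall V (16 * Fintype.card V)) : ∑ i, latticeVec k i ^ 2 ≤ 1 := by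
  have hN0 : (0 : ℝ) < Fintype.card V := by exact_mod_cast Fintype.card_pos
  have h : ((∑ i, k i ^ 2 : ℤ) : ℝ) ≤ 16 * Fintype.card V := by
    exact_mod_cast mem_latticeBall.1 hk
  push_cast at h
  simp_rw [latticeVec, div_pow, mul_pow, Real.sq_sqrt hN0.le]
  rw [← Finset.sum_div, div_le_one (by positivity)]
  linarith

/-- The discrepancy of the light pairs is of order `L` on all the net vectors. -/
def LightBound (q : Sym2 V → ℝ) (L : ℝ) (ω : Sym2 V → Bool) : Prop :=
  ∀ k ∈ latticeBall V (16 * Fintype.card V),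
    |∑ i, ∑ j, lightCoeff (L / Fintype.card V) (latticeVec k) i j *
        (bit (ω s(i, j)) - q s(i, j))| ≤ 40 * L

lemma measure_not_lightBound_le [Nonempty V] (h0 : ∀ e, 0 ≤ q e) (h1 : ∀ e, q e ≤ 1) {D L : ℝ}
    (hL : 0 < L) (hDL : D ≤ L ^ 2) (hq : ∀ e, q e ≤ D / Fintype.card V) :
    (coins q).real {ω | ¬ LightBound q L ω} ≤ 2 * Real.exp (-(Fintype.card V)) := by
  set N : ℝ := (Fintype.card V : ℝ) with hN
  set B := latticeBall V (16 * Fintype.card V) with hB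
  set F : (V → ℤ) → ℝ → Set (Sym2 V → Bool) := fun k ε =>
    {ω | 40 * L ≤ ε * ∑ i, ∑ j, lightCoeff (L / N) (latticeVec k) i j *
      (bit (ω s(i, j)) - q s(i, j))} with hF
  have hsub : {ω | ¬ LightBound q L ω} ⊆ ⋃ k ∈ B, (F k 1 ∪ F k (-1)) := by
    intro ω hω
    simp only [Set.mem_ofPred_eq, LightBound, not_forall, not_le] at hω
    obtain ⟨k, hk, h⟩ := hω
    simp only [Set.mem_iUnion]
    refine ⟨k, hk, ?_⟩
    rcases lt_abs.1 h with h | h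
    · left; simp only [hF, Set.mem_ofPred_eq, one_mul]; exact h.le
    · right; simp only [hF, Set.mem_ofPred_eq, neg_mul, one_mul]; exact h.le
  refine (measureReal_mono hsub (measure_ne_top _ _)).trans ((measureReal_biUnion_finset_le _ _).trans ?_)
  have hb : ∀ k ∈ B, (coins q).real (F k 1 ∪ F k (-1)) ≤ 2 * Real.exp (-(39 / 2) * N) := by
    intro k hk
    refine (measureReal_union_le _ _).trans ?_
    have hk' := sum_latticeVec_sq_le hk
    have e1 := light_tail h0 h1 hL hDL hq hk' (ε := 1) (by simp)
    have e2 := light_tail h0 h1 hL hDL hq hk' (ε := -1) (by simp)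
    rw [two_mul]
    exact add_le_add e1 e2
  refine (Finset.sum_le_sum hb).trans ?_
  rw [Finset.sum_const, nsmul_eq_mul]
  -- The net has at most exp(18 N) vectors, against a failure probability of 2 exp(-39 N/2) for
  -- each.
  have hc := card_latticeBall_le (V := V) (16 * Fintype.card V)
  push_cast at hc
  rw [← hN] at hc
  have hN0 : 0 ≤ N := by positivity
  calc (B.card : ℝ) * (2 * Real.exp (-(39 / 2) * N))
      ≤ Real.exp (16 * N + 2 * N) * (2 * Real.exp (-(39 / 2) * N)) := by gcongr
    _ = 2 * Real.exp (-(3 / 2) * N) := by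
        rw [mul_left_comm, ← Real.exp_add]; ring_nf
    _ ≤ _ := by gcongr; linarith

end Light

/-! ### Discrepancy -/

/-- The weight of a set of vertices in the union bound for the level `t`. -/
def levelCost {V : Type} (N : ℝ) (t : ℕ) (I : Finset V) : ℝ :=
  3 * (t + 1) * I.card + N / 8 ^ t

/-- The tilting parameter for a pair of levels. -/
def tilt (l s t : ℕ) : ℝ := Real.exp 1 * 2 ^ (s + t + 1 - l)

lemma one_le_tilt (l s t : ℕ) : 1 ≤ tilt l s t := by
  have h1 : (1 : ℝ) ≤ Real.exp 1 := Real.one_le_exp zero_le_one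
  have h2 : (1 : ℝ) ≤ 2 ^ (s + t + 1 - l) := one_le_pow₀ (by norm_num)
  unfold tilt
  nlinarith

/-- The terms of the union bound for the discrepancy. -/
def unionTerm (N : ℝ) (t : ℕ) : ℝ := (1 / 2) ^ t * (N / 8 ^ t * Real.exp (-(N / 8 ^ t / 2)))

lemma mul_exp_neg_half_le_one (u : ℝ) : u * Real.exp (-(u / 2)) ≤ 1 := by
  have h1 : u ≤ Real.exp (u / 2) := by
    have h := Real.add_one_le_exp (u / 2 - 1)
    have h2 : Real.exp (u / 2) = Real.exp (u / 2 - 1) * Real.exp 1 := by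
      rw [← Real.exp_add]; ring_nf
    have h3 : 2 ≤ Real.exp 1 := by linarith [Real.add_one_le_exp (1 : ℝ)]
    rw [h2]
    nlinarith [Real.exp_pos (u / 2 - 1)]
  rw [Real.exp_neg, ← div_eq_mul_inv, div_le_one (Real.exp_pos _)]
  exact h1

lemma unionTerm_nonneg {N : ℝ} (hN : 0 ≤ N) (t : ℕ) : 0 ≤ unionTerm N t := by
  unfold unionTerm; positivity

lemma unionTerm_le (N : ℝ) (t : ℕ) : unionTerm N t ≤ (1 / 2) ^ t :=
  mul_le_of_le_one_right (by positivity) (mul_exp_neg_half_le_one _)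

lemma summable_unionTerm {N : ℝ} (hN : 0 ≤ N) : Summable (unionTerm N) :=
  Summable.of_nonneg_of_le (unionTerm_nonneg hN) (unionTerm_le N) summable_geometric_two

/-- Each term tends to 0, but the number of levels grows with n; the geometric factor in `unionTerm`
provides the domination. -/
lemma tendsto_tsum_unionTerm :
    Tendsto (fun n : ℕ => ∑' t, unionTerm (n : ℝ) t) atTop (𝓝 0) := by
  have h : Tendsto (fun n : ℕ => ∑' t, unionTerm (n : ℝ) t) atTop (𝓝 (∑' _ : ℕ, (0 : ℝ))) := by
    refine tendsto_tsum_of_dominated_convergence (bound := fun t : ℕ => ((1 : ℝ) / 2) ^ t)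
      summable_geometric_two (fun t => ?_) (Eventually.of_forall fun n t => ?_)
    · have h1 := (Real.tendsto_pow_mul_exp_neg_atTop_nhds_zero 1).comp
        ((tendsto_natCast_atTop_atTop (R := ℝ)).atTop_div_const
          (by positivity : (0 : ℝ) < 8 ^ t * 2))
      have h2 := h1.const_mul ((1 / 2 : ℝ) ^ t * 2)
      rw [mul_zero] at h2
      refine h2.congr fun n => ?_
      simp only [Function.comp, pow_one, unionTerm]
      rw [div_div]
      field_simp
    · rw [Real.norm_of_nonneg (unionTerm_nonneg (Nat.cast_nonneg n) t)]
      exact unionTerm_le _ _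
  simpa using h

lemma sum_ite_mem_univ {V : Type} [Fintype V] [DecidableEq V] (I : Finset V)
    (f : V → ℝ) : (∑ i, if i ∈ I then f i else 0) = ∑ i ∈ I, f i := by
  simp

section Disc

variable {V : Type} [Fintype V] [DecidableEq V]

/-- The sum over all sets is the binomial expansion of (1 + r)^N. Leaving out the empty set
subtracts 1, which matters: at high levels N/8^t is tiny, and the empty set alone would contribute
almost 1. -/
lemma sum_exp_neg_levelCost_le [Nonempty V] (t : ℕ) :
    ∑ I : Finset V with I.Nonempty, Real.exp (-levelCost (Fintype.card V) t I)
      ≤ unionTerm (Fintype.card V) t := by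
  set N : ℝ := (Fintype.card V : ℝ) with hN
  have hN0 : 0 < N := by rw [hN]; exact_mod_cast Fintype.card_pos
  set r : ℝ := Real.exp (-(3 * (t + 1))) with hr
  set u : ℝ := N / 8 ^ t with hu
  have hu0 : 0 < u := by positivity
  have hterm : ∀ I : Finset V, Real.exp (-levelCost N t I) = Real.exp (-u) * r ^ I.card := by
    intro I
    rw [hr, ← Real.exp_nat_mul, ← Real.exp_add, levelCost, ← hu]
    ring_nf
  simp_rw [hterm]
  rw [← Finset.mul_sum]
  have h1 : ∑ I : Finset V with I.Nonempty, r ^ I.card = (r + 1) ^ Fintype.card V - 1 := by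
    have h := Fintype.sum_pow_mul_eq_add_pow V r 1
    simp only [one_pow, mul_one] at h
    rw [← h, ← Finset.sum_filter_add_sum_filter_not Finset.univ (fun I : Finset V => I.Nonempty)]
    simp [Finset.not_nonempty_iff_eq_empty, Finset.filter_eq']
  rw [h1]
  -- The 3 in the cost is chosen for exp(-3) ≤ 1/16. Then N r is below N/8^t by a factor 2^(-t)/16,
  -- which both makes exp(N r) harmless and leaves a geometric series over the levels.
  have hr16 : r ≤ (1 / 16) ^ (t + 1) := by
    have e1 : r = Real.exp (-3) ^ (t + 1) := by
      rw [hr, ← Real.exp_nat_mul]; push_cast; ring_nf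
    rw [e1]
    refine pow_le_pow_left₀ (Real.exp_pos _).le ?_ _
    rw [Real.exp_neg, one_div]
    refine inv_anti₀ (by norm_num) ?_
    have h4 : Real.exp 3 = Real.exp 1 ^ 3 := by rw [← Real.exp_nat_mul]; norm_num
    rw [h4]
    have h5 : (2.7 : ℝ) ≤ Real.exp 1 := by linarith [Real.exp_one_gt_d9]
    calc (16 : ℝ) ≤ 2.7 ^ 3 := by norm_num
      _ ≤ _ := pow_le_pow_left₀ (by norm_num) h5 _
  have hr0 : 0 < r := Real.exp_pos _
  have h2 : (r + 1) ^ Fintype.card V ≤ Real.exp (N * r) := by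
    rw [hN, Real.exp_nat_mul]
    exact pow_le_pow_left₀ (by positivity) (Real.add_one_le_exp r) _
  set x := N * r with hx
  have hx0 : 0 < x := by positivity
  have hxu : x ≤ (1 / 2) ^ t * (u / 16) := by
    calc x ≤ N * (1 / 16) ^ (t + 1) := mul_le_mul_of_nonneg_left hr16 hN0.le
      _ = _ := by
        have e : (8 : ℝ) ^ t * 2 ^ t = 16 ^ t := by rw [← mul_pow]; norm_num
        rw [hu, pow_succ, div_pow, div_pow, one_pow, ← e]; field_simp
  have hxu2 : x ≤ u / 16 := by
    refine hxu.trans (mul_le_of_le_one_left (by positivity) (pow_le_one₀ (by norm_num) ?_))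
    norm_num
  have h3 : Real.exp x - 1 ≤ x * Real.exp x := by
    have h := Real.add_one_le_exp (-x)
    have h' : Real.exp (-x) * Real.exp x = 1 := by rw [← Real.exp_add]; simp
    nlinarith [Real.exp_pos x]
  calc Real.exp (-u) * ((r + 1) ^ Fintype.card V - 1)
      ≤ Real.exp (-u) * (x * Real.exp x) := by gcongr; linarith
    _ = x * Real.exp (-u + x) := by rw [Real.exp_add]; ring
    _ ≤ ((1 / 2) ^ t * (u / 16)) * Real.exp (-(u / 2)) := by
        gcongr; linarith
    _ ≤ unionTerm N t := by
        rw [unionTerm, ← hu, mul_assoc]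
        refine mul_le_mul_of_nonneg_left ?_ (by positivity)
        refine mul_le_mul_of_nonneg_right ?_ (Real.exp_pos _).le
        linarith

/-- The number of ordered pairs of distinct vertices in `I × J` that are marked `true`. -/
def pairCount (ω : Sym2 V → Bool) (I J : Finset V) : ℝ :=
  ∑ i ∈ I, ∑ j ∈ J, if i ≠ j then bit (ω s(i, j)) else 0

variable {q : Sym2 V → ℝ}

/-- Chernoff's bound with weight log x / 2 on I × J: doubling the weight for the unordered pairs
multiplies the odds by exactly x. The sets may overlap. -/
lemma pairCount_tail [Nonempty V] (h0 : ∀ e, 0 ≤ q e) (h1 : ∀ e, q e ≤ 1) {D : ℝ}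
    (hq : ∀ e, q e ≤ D / Fintype.card V) {x : ℝ} (hx : 1 ≤ x) (I J : Finset V) (c : ℝ) :
    (coins q).real {ω | x * (I.card * J.card * (D / Fintype.card V)) + c
      ≤ Real.log x / 2 * pairCount ω I J} ≤ Real.exp (-c) := by
  set N : ℝ := (Fintype.card V : ℝ) with hN
  have hD0 : 0 ≤ D / N := by
    obtain ⟨v⟩ := ‹Nonempty V›
    exact (h0 s(v, v)).trans (hq _)
  set w : V → V → ℝ := fun i j =>
    if i ∈ I then if j ∈ J then if i ≠ j then Real.log x / 2 else 0 else 0 else 0 with hw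
  set s := x * (I.card * J.card * (D / N)) + c with hs
  have key := coins_pairs_tail h0 h1 w (by simp [hw]) s
  have e1 : ∀ ω : Sym2 V → Bool, ∑ i, ∑ j, w i j * bit (ω s(i, j))
      = Real.log x / 2 * pairCount ω I J := by
    intro ω
    rw [pairCount, Finset.mul_sum, ← sum_ite_mem_univ I]
    refine Finset.sum_congr rfl fun i _ => ?_
    split_ifs with hi
    · rw [Finset.mul_sum, ← sum_ite_mem_univ J]
      refine Finset.sum_congr rfl fun j _ => ?_
      simp only [hw, hi, if_true, ite_mul, zero_mul, mul_ite, mul_zero]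
    · exact Finset.sum_eq_zero fun j _ => by simp [hw, hi]
  refine (le_of_eq (congrArg _ (Set.ext fun ω => ?_))).trans
    (key.trans (Real.exp_le_exp.2 ?_))
  · rw [Set.mem_ofPred_eq, Set.mem_ofPred_eq, e1]
  have h2 : ∑ i, ∑ j, q s(i, j) * (Real.exp (2 * w i j) - 1)
      ≤ ∑ i, ∑ j, if i ∈ I then if j ∈ J then D / N * x else 0 else 0 := by
    refine Finset.sum_le_sum fun i _ => Finset.sum_le_sum fun j _ => ?_
    have hlog : Real.exp (2 * (Real.log x / 2)) = x := by
      rw [mul_div_cancel₀ _ two_ne_zero, Real.exp_log (by linarith)]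
    simp only [hw]
    split_ifs
    · rw [hlog]
      exact (mul_le_mul_of_nonneg_left (by linarith) (h0 _)).trans
        (mul_le_mul_of_nonneg_right (hq _) (by linarith))
    · simp; exact mul_nonneg hD0 (by linarith)
    · simp
    · simp
  have h3 : (∑ i, ∑ j, if i ∈ I then if j ∈ J then D / N * x else 0 else 0)
      = x * (I.card * J.card * (D / N)) := by
    have e : ∀ i, (∑ j, if i ∈ I then if j ∈ J then D / N * x else 0 else 0)
        = if i ∈ I then J.card * (D / N * x) else 0 := by
      intro i
      split_ifs <;> simp
    simp_rw [e]
    rw [sum_ite_mem_univ, Finset.sum_const, nsmul_eq_mul]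
    ring
  have h4 : 0 ≤ x * (I.card * J.card * (D / N)) := by positivity
  linarith

/-- All pairs of sets satisfy the discrepancy bounds of the first `T` levels. -/
def DiscBound (D : ℝ) (l T : ℕ) (ω : Sym2 V → Bool) : Prop :=
  ∀ s < T, ∀ t < T, ∀ I J : Finset V, I.Nonempty → J.Nonempty →
    Real.log (tilt l s t) / 2 * pairCount ω I J
      ≤ tilt l s t * (I.card * J.card * (D / Fintype.card V))
        + (levelCost (Fintype.card V) s I + levelCost (Fintype.card V) t J)

/-- The failure probability for (s, I), (t, J) is exp(-cost) with a cost additive in the two halves,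
so the union bound is the square of a sum over one level and one set. -/
lemma measure_not_discBound_le [Nonempty V] (h0 : ∀ e, 0 ≤ q e) (h1 : ∀ e, q e ≤ 1) {D : ℝ}
    (hq : ∀ e, q e ≤ D / Fintype.card V) (l T : ℕ) :
    (coins q).real {ω | ¬ DiscBound D l T ω} ≤ (∑' t, unionTerm (Fintype.card V) t) ^ 2 := by
  set N : ℝ := (Fintype.card V : ℝ) with hN
  set P : Finset (Finset V) := Finset.univ.filter fun I => I.Nonempty with hP
  set F : ℕ → ℕ → Finset V → Finset V → Set (Sym2 V → Bool) := fun s t I J =>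
    {ω | tilt l s t * (I.card * J.card * (D / N)) + (levelCost N s I + levelCost N t J)
      ≤ Real.log (tilt l s t) / 2 * pairCount ω I J} with hF
  have hsub : {ω | ¬ DiscBound D l T ω} ⊆
      ⋃ p ∈ (Finset.range T ×ˢ Finset.range T) ×ˢ (P ×ˢ P), F p.1.1 p.1.2 p.2.1 p.2.2 := by
    intro ω hω
    simp only [Set.mem_ofPred_eq, DiscBound, not_forall, not_le] at hω
    obtain ⟨s, hs, t, ht, I, J, hI, hJ, h⟩ := hω
    simp only [Set.mem_iUnion]
    refine ⟨((s, t), (I, J)), ?_, h.le⟩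
    simp [hs, ht, hP, hI, hJ]
  refine (measureReal_mono hsub (measure_ne_top _ _)).trans
    ((measureReal_biUnion_finset_le _ _).trans ?_)
  refine (Finset.sum_le_sum (g := fun p => Real.exp (-levelCost N p.1.1 p.2.1) *
    Real.exp (-levelCost N p.1.2 p.2.2)) fun p _ => ?_).trans ?_
  · rw [← Real.exp_add, ← neg_add]
    exact pairCount_tail h0 h1 hq (one_le_tilt _ _ _) _ _ _
  have e1 : ∑ p ∈ (Finset.range T ×ˢ Finset.range T) ×ˢ (P ×ˢ P),
      Real.exp (-levelCost N p.1.1 p.2.1) * Real.exp (-levelCost N p.1.2 p.2.2)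
      = (∑ t ∈ Finset.range T, ∑ I ∈ P, Real.exp (-levelCost N t I)) ^ 2 := by
    rw [Finset.sum_product, Finset.sum_product, sq, Finset.sum_mul_sum]
    refine Finset.sum_congr rfl fun s _ => Finset.sum_congr rfl fun t _ => ?_
    rw [Finset.sum_product, Finset.sum_mul_sum]
  rw [e1]
  refine pow_le_pow_left₀ (Finset.sum_nonneg fun _ _ => Finset.sum_nonneg fun _ _ =>
    (Real.exp_pos _).le) ?_ 2
  exact (Finset.sum_le_sum fun t _ => sum_exp_neg_levelCost_le t).trans
    ((summable_unionTerm (Nat.cast_nonneg _)).sum_le_tsum _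
      fun t _ => unionTerm_nonneg (Nat.cast_nonneg _) t)

end Disc

/-! ### Heavy pairs -/

lemma sum_range_succ_div_two_pow_le (K : ℕ) :
    ∑ k ∈ Finset.range K, ((k : ℝ) + 1) / 2 ^ k ≤ 4 := by
  have h : ∑ k ∈ Finset.range K, ((k : ℝ) + 1) / 2 ^ k = 4 - (2 * K + 4) / 2 ^ K := by
    induction K with
    | zero => norm_num
    | succ K ih => rw [Finset.sum_range_succ, ih, pow_succ]; push_cast; field_simp; ring
  rw [h]
  have : (0 : ℝ) ≤ (2 * K + 4) / 2 ^ K := by positivity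
  linarith

lemma sum_reflected_le (T K : ℕ) :
    ∑ s ∈ Finset.range T, (if s ≤ K then (((K - s : ℕ) : ℝ) + 1) / 2 ^ (K - s) else 0) ≤ 4 := by
  rw [← Finset.sum_filter]
  refine le_trans (Finset.sum_le_sum_of_subset_of_nonneg (t := Finset.range (K + 1)) ?_ ?_) ?_
  · intro s hs; simp only [Finset.mem_filter, Finset.mem_range] at hs ⊢; omega
  · intro s _ _; positivity
  · have h := Finset.sum_range_reflect (fun k : ℕ => ((k : ℝ) + 1) / 2 ^ k) (K + 1)
    simp only [Nat.add_sub_cancel] at h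
    rw [h]
    exact sum_range_succ_div_two_pow_le _

section Heavy

variable {V : Type} [Fintype V] [DecidableEq V]

/-- The adjacency matrix of the graph marked by `ω`. -/
def adj (ω : Sym2 V → Bool) (i j : V) : ℝ := if i ≠ j then bit (ω s(i, j)) else 0

lemma adj_nonneg (ω : Sym2 V → Bool) (i j : V) : 0 ≤ adj ω i j := by
  unfold adj; split_ifs; exacts [bit_nonneg _, le_rfl]

lemma adj_comm (ω : Sym2 V → Bool) (i j : V) : adj ω i j = adj ω j i := by
  simp only [adj, ne_comm (a := i), Sym2.eq_swap (a := i)]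

lemma pairCount_eq (ω : Sym2 V → Bool) (I J : Finset V) :
    pairCount ω I J = ∑ i ∈ I, ∑ j ∈ J, adj ω i j := rfl

/-- The size of the coordinate `i` in units of `1 / √N`. -/
def height (x : V → ℝ) (i : V) : ℝ := √(Fintype.card V) * |x i|

/-- The dyadic level of the coordinate `i`. -/
def level (x : V → ℝ) (i : V) : ℕ := Nat.log 2 ⌊height x i⌋₊

/-- The set of coordinates at level `s`. -/
def levelSet (x : V → ℝ) (s : ℕ) : Finset V :=
  Finset.univ.filter fun i => 1 ≤ height x i ∧ level x i = s

/-- The share of the level `s` in the squared norm. -/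
def levelMass (x : V → ℝ) (s : ℕ) : ℝ := (levelSet x s).card * 4 ^ s / Fintype.card V

variable {x : V → ℝ}

lemma two_pow_level_le {i : V} (h : 1 ≤ height x i) : 2 ^ level x i ≤ height x i := by
  have h0 : ⌊height x i⌋₊ ≠ 0 := by
    have := Nat.floor_pos.2 h; omega
  have h1 : ((2 ^ level x i : ℕ) : ℝ) ≤ ⌊height x i⌋₊ := by
    exact_mod_cast Nat.pow_log_le_self 2 h0
  push_cast at h1
  exact h1.trans (Nat.floor_le (by linarith))

lemma height_lt_two_pow (i : V) : height x i < 2 ^ (level x i + 1) := by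
  have h1 : ⌊height x i⌋₊ + 1 ≤ 2 ^ (level x i + 1) :=
    Nat.lt_pow_succ_log_self (by norm_num) _
  have h2 : ((⌊height x i⌋₊ + 1 : ℕ) : ℝ) ≤ ((2 ^ (level x i + 1) : ℕ) : ℝ) := by
    exact_mod_cast h1
  push_cast at h2
  exact (Nat.lt_floor_add_one _).trans_le h2

lemma height_sq (i : V) : height x i ^ 2 = Fintype.card V * x i ^ 2 := by
  rw [height, mul_pow, Real.sq_sqrt (Nat.cast_nonneg _), sq_abs]

/-- Heights in the unit ball are at most N, so it is enough to have the discrepancy bound for the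
first N levels. -/
lemma level_lt [Nonempty V] (hx : ∑ i, x i ^ 2 ≤ 1) {i : V} (h : 1 ≤ height x i) :
    level x i < Fintype.card V := by
  have h1 : x i ^ 2 ≤ 1 :=
    (Finset.single_le_sum (f := fun i => x i ^ 2) (fun _ _ => sq_nonneg _)
      (Finset.mem_univ i)).trans hx
  have hN : (1 : ℝ) ≤ Fintype.card V := by exact_mod_cast Fintype.card_pos
  have h2 : height x i ^ 2 ≤ (Fintype.card V : ℝ) ^ 2 := by
    rw [height_sq]; nlinarith
  have h3 : height x i ≤ Fintype.card V := by
    exact (abs_le_of_sq_le_sq' h2 (by linarith)).2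
  have h4 : ((2 ^ level x i : ℕ) : ℝ) ≤ Fintype.card V := by
    push_cast; exact (two_pow_level_le h).trans h3
  exact (Nat.lt_two_pow_self).trans_le (by exact_mod_cast h4)

lemma sum_levelMass_le [Nonempty V] (hx : ∑ i, x i ^ 2 ≤ 1) (T : ℕ) :
    ∑ s ∈ Finset.range T, levelMass x s ≤ 1 := by
  have hN : (0 : ℝ) < Fintype.card V := by exact_mod_cast Fintype.card_pos
  have h1 : ∀ s ∈ Finset.range T, levelMass x s
      ≤ ∑ i ∈ Finset.univ.filter (fun i => level x i = s), x i ^ 2 := by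
    intro s _
    rw [levelMass, div_le_iff₀ hN, ← nsmul_eq_mul, ← Finset.sum_const]
    refine (Finset.sum_le_sum fun i hi => ?_).trans
      (le_trans (Finset.sum_le_sum_of_subset_of_nonneg
        (f := fun i => (Fintype.card V : ℝ) * x i ^ 2)
        (t := Finset.univ.filter (fun i => level x i = s)) ?_ ?_) (le_of_eq ?_))
    · simp only [levelSet, Finset.mem_filter, Finset.mem_univ, true_and] at hi
      rw [← height_sq, ← hi.2]
      calc (4 : ℝ) ^ level x i = (2 ^ level x i) ^ 2 := by
            rw [← pow_mul, mul_comm, pow_mul]; norm_num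
        _ ≤ _ := pow_le_pow_left₀ (by positivity) (two_pow_level_le hi.1) 2
    · intro i hi
      simp only [levelSet, Finset.mem_filter, Finset.mem_univ, true_and] at hi ⊢
      exact hi.2
    · intros; positivity
    · rw [← Finset.mul_sum, mul_comm]
  refine (Finset.sum_le_sum h1).trans (le_trans ?_ hx)
  rw [Finset.sum_fiberwise_eq_sum_filter]
  exact Finset.sum_le_sum_of_subset_of_nonneg (Finset.filter_subset _ _)
    fun _ _ _ => sq_nonneg _

/-- The pairs of levels of the heavy pairs whose entries are within a factor `2 ^ l`. -/
def Balanced (l s t : ℕ) : Prop := l ≤ s + t + 1 ∧ s ≤ t + l ∧ t ≤ s + l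

instance (l s t : ℕ) : Decidable (Balanced l s t) := by unfold Balanced; infer_instance

/-- In the first two cases |x_i x_j| is at most 2^(-l) times the larger square, and the degree bound
finishes. Otherwise heaviness, 2^l < height · height, together with a ratio below 2^l forces both
heights to be at least 1, so both vertices have a genuine level. -/
lemma heavy_cases [Nonempty V] {l : ℕ} {i j : V}
    (h : (2 : ℝ) ^ l / Fintype.card V < |x i * x j|) :
    2 ^ l * |x j| ≤ |x i| ∨ 2 ^ l * |x i| ≤ |x j| ∨
      (1 ≤ height x i ∧ 1 ≤ height x j ∧ Balanced l (level x i) (level x j) ∧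
        |x i * x j| ≤ 2 ^ (level x i + level x j + 2) / Fintype.card V) := by
  have hN : (0 : ℝ) < Fintype.card V := by exact_mod_cast Fintype.card_pos
  have hL : (0 : ℝ) < 2 ^ l := by positivity
  by_cases h1 : 2 ^ l * |x j| ≤ |x i|
  · exact Or.inl h1
  by_cases h2 : 2 ^ l * |x i| ≤ |x j|
  · exact Or.inr (Or.inl h2)
  refine Or.inr (Or.inr ?_)
  push Not at h1 h2
  set N : ℝ := (Fintype.card V : ℝ) with hNd
  have hs0 : 0 < √N := Real.sqrt_pos.2 hN
  have hprod : height x i * height x j = N * |x i * x j| := by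
    rw [height, height, abs_mul]
    calc _ = (√N * √N) * (|x i| * |x j|) := by ring
      _ = _ := by rw [Real.mul_self_sqrt hN.le]
  have h3 : 2 ^ l < height x i * height x j := by
    rw [hprod]; rwa [div_lt_iff₀ hN, mul_comm] at h
  have h1' : height x i < 2 ^ l * height x j := by
    unfold height; rw [mul_left_comm]; exact mul_lt_mul_of_pos_left h1 hs0
  have h2' : height x j < 2 ^ l * height x i := by
    unfold height; rw [mul_left_comm]; exact mul_lt_mul_of_pos_left h2 hs0
  have hi0 : 0 ≤ height x i := by unfold height; positivity
  have hj0 : 0 ≤ height x j := by unfold height; positivity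
  have hi : 1 ≤ height x i := by
    by_contra hc
    push Not at hc
    have : 2 ^ l < 2 ^ l * (height x i * height x i) := by nlinarith
    nlinarith
  have hj : 1 ≤ height x j := by
    by_contra hc
    push Not at hc
    have : 2 ^ l < 2 ^ l * (height x j * height x j) := by nlinarith
    nlinarith
  have ui := height_lt_two_pow (x := x) i
  have uj := height_lt_two_pow (x := x) j
  have li := two_pow_level_le hi
  have lj := two_pow_level_le hj
  have hlt : height x i * height x j < 2 ^ (level x i + level x j + 2) := by
    calc height x i * height x j < 2 ^ (level x i + 1) * 2 ^ (level x j + 1) :=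
          mul_lt_mul'' ui uj hi0 hj0
      _ = _ := by rw [← pow_add]; ring_nf
  refine ⟨hi, hj, ⟨?_, ?_, ?_⟩, ?_⟩
  · have := (pow_lt_pow_iff_right₀ (one_lt_two : (1 : ℝ) < 2)).1 (h3.trans hlt)
    omega
  · have h5 : (2 : ℝ) ^ level x i < 2 ^ (l + (level x j + 1)) := by
      rw [pow_add]
      exact (li.trans_lt h1').trans_le (mul_le_mul_of_nonneg_left uj.le hL.le)
    have := (pow_lt_pow_iff_right₀ (one_lt_two : (1 : ℝ) < 2)).1 h5
    omega
  · have h5 : (2 : ℝ) ^ level x j < 2 ^ (l + (level x i + 1)) := by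
      rw [pow_add]
      exact (lj.trans_lt h2').trans_le (mul_le_mul_of_nonneg_left ui.le hL.le)
    have := (pow_lt_pow_iff_right₀ (one_lt_two : (1 : ℝ) < 2)).1 h5
    omega
  · rw [le_div_iff₀ hN, mul_comm, ← hprod]
    exact hlt.le

/-- The cost is designed for this form: in units of N/4^t the size of the level set is its mass and
N/8^t is 2^(-t), and both have bounded sums over t. -/
lemma levelCost_levelSet_le [Nonempty V] (t : ℕ) :
    levelCost (Fintype.card V) t (levelSet x t)
      ≤ 3 * (t + 1) * (Fintype.card V / 4 ^ t) * (levelMass x t + (1 / 2) ^ t) := by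
  have hN : (0 : ℝ) < Fintype.card V := by exact_mod_cast Fintype.card_pos
  set N : ℝ := (Fintype.card V : ℝ) with hNd
  have e1 : (N / 4 ^ t) * levelMass x t = (levelSet x t).card := by
    rw [levelMass, ← hNd]; field_simp
  have e2 : (N / 4 ^ t) * (1 / 2) ^ t = N / 8 ^ t := by
    have e : (8 : ℝ) ^ t = 4 ^ t * 2 ^ t := by rw [← mul_pow]; norm_num
    rw [e, div_pow, one_pow]; field_simp
  have h8 : 0 ≤ N / 8 ^ t := by positivity
  have ht : (0 : ℝ) ≤ t := Nat.cast_nonneg t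
  have : 3 * ((t : ℝ) + 1) * (N / 4 ^ t) * (levelMass x t + (1 / 2) ^ t)
      = 3 * (t + 1) * (levelSet x t).card + 3 * (t + 1) * (N / 8 ^ t) := by
    rw [← e1, ← e2]; ring
  rw [this, levelCost]
  nlinarith

lemma half_le_log_tilt (l s t : ℕ) : (((s + t + 1 - l : ℕ) : ℝ) + 1) / 2 ≤ Real.log (tilt l s t) := by
  rw [tilt, Real.log_mul (Real.exp_pos _).ne' (by positivity), Real.log_exp, Real.log_pow]
  have := Real.log_two_gt_d9
  have h0 : (0 : ℝ) ≤ ((s + t + 1 - l : ℕ) : ℝ) := Nat.cast_nonneg _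
  nlinarith

/-- The contribution of the cost of one of the two sets. -/
lemma cost_contribution {l s t : ℕ} (h : Balanced l s t) {N α : ℝ} (hN : 0 < N) (hα : 0 ≤ α) :
    2 ^ (s + t + 2) / N * (4 / (((s + t + 1 - l : ℕ) : ℝ) + 1) *
        (3 * (t + 1) * (N / 4 ^ t) * α))
      ≤ 48 * 2 ^ l * ((((t + l - s : ℕ) : ℝ) + 1) / 2 ^ (t + l - s)) * α := by
  obtain ⟨h1, h2, h3⟩ := h
  set m := s + t + 1 - l with hm
  set k := t + l - s with hk
  have e1 : (2 : ℝ) ^ l / 2 ^ k = 2 ^ s / 2 ^ t := by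
    rw [div_eq_div_iff (by positivity) (by positivity), ← pow_add, ← pow_add]
    congr 1; omega
  have e4 : (4 : ℝ) ^ t = 2 ^ t * 2 ^ t := by rw [← mul_pow]; norm_num
  -- Since k + m = 2t + 1, the factor t + 1 of the cost is paid for by the m + 1 gained from the
  -- logarithm of the tilt, up to k + 1, which is harmless against 2^(-k).
  have hkm : ((t : ℝ) + 1) ≤ (k + 1) * (m + 1) := by
    have : k + m = 2 * t + 1 := by omega
    have h : t + 1 ≤ (k + 1) * (m + 1) := by nlinarith
    exact_mod_cast h
  have hkm' : ((t : ℝ) + 1) / (m + 1) ≤ k + 1 := by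
    rw [div_le_iff₀ (by positivity)]; exact hkm
  calc 2 ^ (s + t + 2) / N * (4 / ((m : ℝ) + 1) * (3 * (t + 1) * (N / 4 ^ t) * α))
      = 48 * (2 ^ s / 2 ^ t) * (((t : ℝ) + 1) / (m + 1)) * α := by
        rw [e4, pow_add, pow_add]; field_simp; ring
    _ ≤ 48 * (2 ^ s / 2 ^ t) * (k + 1) * α := by gcongr
    _ = _ := by rw [← e1]; ring

/-- The tilt is proportional to the size 2^(s+t)/2^l of the entries, so the mean term becomes a
product of masses times D/2^l ≤ 2^l. Each cost term decays geometrically in the distance of (s, t)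
from the edge of the balanced range, where subtraction of natural numbers is exact. -/
lemma level_pair_le [Nonempty V] {ω : Sym2 V → Bool} {D : ℝ} {l : ℕ} (hD : 0 ≤ D)
    (hDL : D ≤ (2 ^ l) ^ 2) {T : ℕ} (hω : DiscBound D l T ω) {s t : ℕ} (hs : s < T) (ht : t < T)
    (hb : Balanced l s t) :
    2 ^ (s + t + 2) / Fintype.card V * pairCount ω (levelSet x s) (levelSet x t)
      ≤ 96 * 2 ^ l * (levelMass x s * levelMass x t)
        + 48 * 2 ^ l * ((((s + l - t : ℕ) : ℝ) + 1) / 2 ^ (s + l - t))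
            * (levelMass x s + (1 / 2) ^ s)
        + 48 * 2 ^ l * ((((t + l - s : ℕ) : ℝ) + 1) / 2 ^ (t + l - s))
            * (levelMass x t + (1 / 2) ^ t) := by
  have hN : (0 : ℝ) < Fintype.card V := by exact_mod_cast Fintype.card_pos
  set N : ℝ := (Fintype.card V : ℝ) with hNd
  have hmass : ∀ s, 0 ≤ levelMass x s := fun s => by unfold levelMass; positivity
  have hms := hmass s
  have hmt := hmass t
  rcases (levelSet x s).eq_empty_or_nonempty with hI | hI
  · rw [hI]; simp only [pairCount, Finset.sum_empty, mul_zero]; positivity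
  rcases (levelSet x t).eq_empty_or_nonempty with hJ | hJ
  · rw [hJ]; simp only [pairCount, Finset.sum_empty, Finset.sum_const_zero, mul_zero]; positivity
  have h := hω s hs t ht _ _ hI hJ
  set m := s + t + 1 - l with hm
  have hlog := half_le_log_tilt l s t
  rw [← hm] at hlog
  have hp0 : 0 ≤ pairCount ω (levelSet x s) (levelSet x t) :=
    Finset.sum_nonneg fun i _ => Finset.sum_nonneg fun j _ => adj_nonneg ω i j
  have hcs := levelCost_levelSet_le (x := x) s
  have hct := levelCost_levelSet_le (x := x) t
  rw [← hNd] at h hcs hct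
  have hm1 : (0 : ℝ) < m + 1 := by positivity
  have hcount : pairCount ω (levelSet x s) (levelSet x t)
      ≤ 4 / ((m : ℝ) + 1) * (tilt l s t * ((levelSet x s).card * (levelSet x t).card * (D / N)))
        + 4 / ((m : ℝ) + 1) * (3 * (s + 1) * (N / 4 ^ s) * (levelMass x s + (1 / 2) ^ s))
        + 4 / ((m : ℝ) + 1) * (3 * (t + 1) * (N / 4 ^ t) * (levelMass x t + (1 / 2) ^ t)) := by
    rw [← mul_add, ← mul_add, div_mul_eq_mul_div, le_div_iff₀ hm1]
    nlinarith
  have hA := cost_contribution (α := levelMass x t + (1 / 2) ^ t) hb hN (by positivity)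
  have hB := cost_contribution (α := levelMass x s + (1 / 2) ^ s) ⟨by have := hb.1; omega,
    hb.2.2, hb.2.1⟩ hN (by positivity)
  rw [show t + s + 2 = s + t + 2 by ring, show t + s + 1 - l = m by omega] at hB
  rw [← hm] at hA
  have hC : 2 ^ (s + t + 2) / N * (4 / ((m : ℝ) + 1) *
      (tilt l s t * ((levelSet x s).card * (levelSet x t).card * (D / N))))
      ≤ 96 * 2 ^ l * (levelMass x s * levelMass x t) := by
    have e1 : (2 : ℝ) ^ m = 2 ^ (s + t + 1) / 2 ^ l := by
      rw [eq_div_iff (by positivity), ← pow_add]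
      congr 1
      have := hb.1
      omega
    have e4 : ∀ t : ℕ, (4 : ℝ) ^ t = 2 ^ t * 2 ^ t := fun t => by rw [← mul_pow]; norm_num
    have e2 : 2 ^ (s + t + 2) / N * (4 / ((m : ℝ) + 1) *
      (tilt l s t * ((levelSet x s).card * (levelSet x t).card * (D / N))))
      = 32 * Real.exp 1 / (m + 1) * (D / 2 ^ l) * (levelMass x s * levelMass x t) := by
      rw [tilt, ← hm, e1, levelMass, levelMass, e4, e4, pow_add, pow_add, pow_add, pow_add,
        ← hNd]
      field_simp; ring
    rw [e2]
    have h1 : 32 * Real.exp 1 / ((m : ℝ) + 1) ≤ 96 := by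
      rw [div_le_iff₀ hm1]
      have := Real.exp_one_lt_d9
      have h0 : (0 : ℝ) ≤ m := Nat.cast_nonneg m
      nlinarith
    have h2 : D / 2 ^ l ≤ 2 ^ l := by rw [div_le_iff₀ (by positivity), ← sq]; exact hDL
    gcongr
  calc _ ≤ _ := mul_le_mul_of_nonneg_left hcount (by positivity : 0 ≤ 2 ^ (s + t + 2) / N)
    _ ≤ _ := by rw [mul_add, mul_add]; linarith

/-- For each cost term, sum over the level not occurring in its mass: the geometric factor gives 4,
and the masses with the extra 2^(-t) give 3. Altogether 96 + 2 · 48 · 12 = 1248. -/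
lemma sum_levels_le [Nonempty V] {ω : Sym2 V → Bool} {D : ℝ} {l : ℕ} (hD : 0 ≤ D)
    (hDL : D ≤ (2 ^ l) ^ 2) {T : ℕ} (hω : DiscBound D l T ω) (hx : ∑ i, x i ^ 2 ≤ 1) :
    ∑ s ∈ Finset.range T, ∑ t ∈ Finset.range T, (if Balanced l s t then
      2 ^ (s + t + 2) / Fintype.card V * pairCount ω (levelSet x s) (levelSet x t) else 0)
      ≤ 1248 * 2 ^ l := by
  have hmass : ∀ s, 0 ≤ levelMass x s := fun s => by unfold levelMass; positivity
  have hL : (0 : ℝ) < 2 ^ l := by positivity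
  set G : ℕ → ℕ → ℝ := fun s t =>
    if s ≤ t + l then (((t + l - s : ℕ) : ℝ) + 1) / 2 ^ (t + l - s) else 0 with hG
  have hG0 : ∀ s t, 0 ≤ G s t := fun s t => by simp only [hG]; split_ifs <;> positivity
  set β : ℕ → ℝ := fun t => levelMass x t + (1 / 2) ^ t with hβ
  have hβ0 : ∀ t, 0 ≤ β t := fun t => by have := hmass t; simp only [hβ]; positivity
  have hterm : ∀ s ∈ Finset.range T, ∀ t ∈ Finset.range T, (if Balanced l s t then
      2 ^ (s + t + 2) / (Fintype.card V : ℝ) * pairCount ω (levelSet x s) (levelSet x t) else 0)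
      ≤ 96 * 2 ^ l * (levelMass x s * levelMass x t) + 48 * 2 ^ l * (G t s * β s)
        + 48 * 2 ^ l * (G s t * β t) := by
    intro s hs t ht
    split_ifs with hb
    · have h := level_pair_le (x := x) hD hDL hω (Finset.mem_range.1 hs) (Finset.mem_range.1 ht) hb
      simp only [hG, hb.2.1, hb.2.2, if_true, hβ]
      linarith
    · have := hmass s
      have := hmass t
      have := mul_nonneg (hG0 s t) (hβ0 t)
      have := mul_nonneg (hG0 t s) (hβ0 s)
      positivity
  refine (Finset.sum_le_sum fun s hs => Finset.sum_le_sum fun t ht => hterm s hs t ht).trans ?_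
  simp_rw [Finset.sum_add_distrib, ← Finset.mul_sum]
  have h1 : ∑ s ∈ Finset.range T, levelMass x s * ∑ t ∈ Finset.range T, levelMass x t ≤ 1 := by
    rw [← Finset.sum_mul]
    exact mul_le_one₀ (sum_levelMass_le hx T) (Finset.sum_nonneg fun t _ => hmass t)
      (sum_levelMass_le hx T)
  have hβs : ∑ t ∈ Finset.range T, β t ≤ 3 := by
    simp only [hβ]
    rw [Finset.sum_add_distrib]
    have h2 : ∑ t ∈ Finset.range T, ((1 : ℝ) / 2) ^ t ≤ 2 :=
      (summable_geometric_two.sum_le_tsum _ fun _ _ => by positivity).trans tsum_geometric_two.le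
    linarith [sum_levelMass_le hx T]
  have hGs : ∀ t, ∑ s ∈ Finset.range T, G s t ≤ 4 := fun t => sum_reflected_le T (t + l)
  have h2 : ∑ t ∈ Finset.range T, ∑ s ∈ Finset.range T, G s t * β t ≤ 12 := by
    have : ∀ t ∈ Finset.range T, ∑ s ∈ Finset.range T, G s t * β t ≤ 4 * β t := fun t _ => by
      rw [← Finset.sum_mul]; exact mul_le_mul_of_nonneg_right (hGs t) (hβ0 t)
    refine (Finset.sum_le_sum this).trans ?_
    rw [← Finset.mul_sum]; linarith
  have h3 : ∑ s ∈ Finset.range T, ∑ t ∈ Finset.range T, G s t * β t ≤ 12 := by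
    rw [Finset.sum_comm]; exact h2
  nlinarith

/-- The heavy pairs contribute order `2 ^ l` on vectors supported on vertices of bounded degree. -/
lemma heavy_le [Nonempty V] {ω : Sym2 V → Bool} {D : ℝ} {l : ℕ} (hD : 0 ≤ D)
    (hDL : D ≤ (2 ^ l) ^ 2) (hω : DiscBound D l (Fintype.card V) ω) (hx : ∑ i, x i ^ 2 ≤ 1)
    (hdeg : ∀ i, x i ≠ 0 → ∑ j, adj ω i j ≤ 20 * D) :
    ∑ i, ∑ j, (if (2 : ℝ) ^ l / Fintype.card V < |x i * x j| then adj ω i j * |x i * x j| else 0)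
      ≤ 1288 * 2 ^ l := by
  set N : ℝ := (Fintype.card V : ℝ) with hNd
  have hL : (0 : ℝ) < 2 ^ l := by positivity
  set T := Fintype.card V with hT
  set S : V → V → ℝ := fun i j => ∑ s ∈ Finset.range T, ∑ t ∈ Finset.range T,
    if Balanced l s t then 2 ^ (s + t + 2) / N *
      (if i ∈ levelSet x s ∧ j ∈ levelSet x t then adj ω i j else 0) else 0 with hS
  have hSterm : ∀ i j s t, 0 ≤ (if Balanced l s t then 2 ^ (s + t + 2) / N *
      (if i ∈ levelSet x s ∧ j ∈ levelSet x t then adj ω i j else 0) else 0) := by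
    intro i j s t
    have := adj_nonneg ω i j
    split_ifs <;> positivity
  have hS0 : ∀ i j, 0 ≤ S i j := fun i j =>
    Finset.sum_nonneg fun s _ => Finset.sum_nonneg fun t _ => hSterm i j s t
  have hterm : ∀ i j, (if (2 : ℝ) ^ l / N < |x i * x j| then adj ω i j * |x i * x j| else 0)
      ≤ x i ^ 2 / 2 ^ l * adj ω i j + x j ^ 2 / 2 ^ l * adj ω i j + S i j := by
    intro i j
    have ha := adj_nonneg ω i j
    have hS := hS0 i j
    have p1 : 0 ≤ x i ^ 2 / 2 ^ l * adj ω i j := by positivity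
    have p2 : 0 ≤ x j ^ 2 / 2 ^ l * adj ω i j := by positivity
    split_ifs with h
    swap
    · linarith
    rcases heavy_cases h with h1 | h1 | ⟨hi, hj, hb, h1⟩
    · have : |x i * x j| ≤ x i ^ 2 / 2 ^ l := by
        rw [abs_mul, le_div_iff₀ hL, ← sq_abs (x i)]
        nlinarith [abs_nonneg (x i)]
      nlinarith
    · have : |x i * x j| ≤ x j ^ 2 / 2 ^ l := by
        rw [abs_mul, le_div_iff₀ hL, ← sq_abs (x j)]
        nlinarith [abs_nonneg (x j)]
      nlinarith
    · have hle : adj ω i j * |x i * x j| ≤ S i j := by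
        have hs : level x i ∈ Finset.range T := Finset.mem_range.2 (level_lt hx hi)
        have ht : level x j ∈ Finset.range T := Finset.mem_range.2 (level_lt hx hj)
        refine le_trans ?_ ((Finset.single_le_sum (fun t _ => hSterm i j (level x i) t) ht).trans
          (Finset.single_le_sum (f := fun s => ∑ t ∈ Finset.range T,
            if Balanced l s t then 2 ^ (s + t + 2) / N *
              (if i ∈ levelSet x s ∧ j ∈ levelSet x t then adj ω i j else 0) else 0)
            (fun s _ => Finset.sum_nonneg fun t _ => hSterm i j s t) hs))
        rw [if_pos hb, if_pos ⟨by simp [levelSet, hi], by simp [levelSet, hj]⟩, mul_comm]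
        exact mul_le_mul_of_nonneg_right h1 ha
      linarith
  refine (Finset.sum_le_sum fun i _ => Finset.sum_le_sum fun j _ => hterm i j).trans ?_
  simp_rw [Finset.sum_add_distrib]
  have hU : ∑ i, ∑ j, x i ^ 2 / 2 ^ l * adj ω i j ≤ 20 * 2 ^ l := by
    have h1 : ∀ i ∈ Finset.univ, ∑ j, x i ^ 2 / 2 ^ l * adj ω i j
        ≤ 20 * 2 ^ l * x i ^ 2 := by
      intro i _
      rw [← Finset.mul_sum]
      by_cases h : x i = 0
      · simp [h]
      · have h2 : x i ^ 2 / 2 ^ l * ∑ j, adj ω i j ≤ x i ^ 2 / 2 ^ l * (20 * (2 ^ l) ^ 2) :=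
          mul_le_mul_of_nonneg_left ((hdeg i h).trans (by linarith)) (by positivity)
        refine h2.trans_eq ?_
        field_simp
    refine (Finset.sum_le_sum h1).trans ?_
    rw [← Finset.mul_sum]
    nlinarith
  have hU' : ∑ i, ∑ j, x j ^ 2 / 2 ^ l * adj ω i j ≤ 20 * 2 ^ l := by
    rw [Finset.sum_comm]
    simp_rw [fun i j => adj_comm ω j i]
    exact hU
  have hB : ∑ i, ∑ j, S i j ≤ 1248 * 2 ^ l := by
    refine le_of_eq_of_le ?_ (sum_levels_le hD hDL hω hx)
    simp only [hS]
    calc _ = ∑ s ∈ Finset.range T, ∑ t ∈ Finset.range T, ∑ i, ∑ j,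
        (if Balanced l s t then 2 ^ (s + t + 2) / N *
          (if i ∈ levelSet x s ∧ j ∈ levelSet x t then adj ω i j else 0) else 0) := by
          simp_rw [Finset.sum_comm (s := (Finset.univ : Finset V)) (t := Finset.range T)]
      _ = _ := by
          refine Finset.sum_congr rfl fun s _ => Finset.sum_congr rfl fun t _ => ?_
          split_ifs with hb
          · simp_rw [← Finset.mul_sum]
            congr 1
            rw [pairCount_eq, ← sum_ite_mem_univ (levelSet x s)]
            refine Finset.sum_congr rfl fun i _ => ?_
            split_ifs with hi
            · rw [← sum_ite_mem_univ (levelSet x t)]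
              simp only [hi, true_and]
            · simp [hi]
          · simp
  linarith

end Heavy

/-! ### Quadratic forms and nets -/

lemma abs_sub_le_add_abs (a b : ℝ) : |a - b| ≤ |a| + |b| := by
  rw [sub_eq_add_neg, ← abs_neg b]; exact abs_add_le _ _

section Quad

variable {V : Type} [Fintype V] [DecidableEq V]

/-- The bilinear form of a matrix. -/
def bilin (B : V → V → ℝ) (x y : V → ℝ) : ℝ := ∑ i, ∑ j, x i * y j * B i j

lemma bilin_add_left (B : V → V → ℝ) (x x' y : V → ℝ) :
    bilin B (x + x') y = bilin B x y + bilin B x' y := by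
  simp only [bilin, ← Finset.sum_add_distrib, Pi.add_apply]
  exact Finset.sum_congr rfl fun i _ => Finset.sum_congr rfl fun j _ => by ring

lemma bilin_smul_left (B : V → V → ℝ) (c : ℝ) (x y : V → ℝ) :
    bilin B (c • x) y = c * bilin B x y := by
  simp only [bilin, Finset.mul_sum, Pi.smul_apply, smul_eq_mul]
  exact Finset.sum_congr rfl fun i _ => Finset.sum_congr rfl fun j _ => by ring

lemma bilin_comm {B : V → V → ℝ} (hB : ∀ i j, B i j = B j i) (x y : V → ℝ) :
    bilin B x y = bilin B y x := by
  unfold bilin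
  rw [Finset.sum_comm]
  exact Finset.sum_congr rfl fun i _ => Finset.sum_congr rfl fun j _ => by rw [hB]; ring

lemma bilin_add_right {B : V → V → ℝ} (hB : ∀ i j, B i j = B j i) (x y y' : V → ℝ) :
    bilin B x (y + y') = bilin B x y + bilin B x y' := by
  rw [bilin_comm hB, bilin_add_left, bilin_comm hB y, bilin_comm hB y']

lemma bilin_smul_right {B : V → V → ℝ} (hB : ∀ i j, B i j = B j i) (c : ℝ) (x y : V → ℝ) :
    bilin B x (c • y) = c * bilin B x y := by
  rw [bilin_comm hB, bilin_smul_left, bilin_comm hB]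

/-- A bound for a quadratic form on a net of the vectors supported on `U` extends to the unit
ball. -/
lemma abs_bilin_le_of_net {B : V → V → ℝ} (hB : ∀ i j, B i j = B j i) (U : Set V) {M : ℝ}
    (h : ∀ x : V → ℝ, (∀ i, i ∉ U → x i = 0) → ∑ i, x i ^ 2 ≤ 1 → ∃ z : V → ℝ,
      (∀ i, i ∉ U → z i = 0) ∧ ∑ i, z i ^ 2 ≤ 1 ∧ ∑ i, (x i - z i) ^ 2 ≤ 1 / 16 ∧
        |bilin B z z| ≤ M)
    {x : V → ℝ} (hxU : ∀ i, i ∉ U → x i = 0) (hx : ∑ i, x i ^ 2 ≤ 1) :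
    |bilin B x x| ≤ 3 * M := by
  set K : Set (V → ℝ) := {x | (∀ i, i ∉ U → x i = 0) ∧ ∑ i, x i ^ 2 ≤ 1} with hK
  have hKc : IsCompact K := by
    refine IsCompact.of_isClosed_subset (isCompact_Icc (a := fun _ : V => (-1 : ℝ))
      (b := fun _ => 1)) ?_ ?_
    · have : K = (⋂ i, ⋂ (_ : i ∉ U), {x | x i = 0}) ∩ {x | ∑ i, x i ^ 2 ≤ 1} := by
        ext x; simp [hK]
      rw [this]
      refine IsClosed.inter ?_ (isClosed_le (by fun_prop) continuous_const)
      exact isClosed_iInter fun i => isClosed_iInter fun _ =>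
        isClosed_eq (continuous_apply i) continuous_const
    · intro x hx
      have h1 : ∀ i, x i ^ 2 ≤ 1 := fun i =>
        (Finset.single_le_sum (f := fun i => x i ^ 2) (fun _ _ => sq_nonneg _)
          (Finset.mem_univ i)).trans hx.2
      exact ⟨fun i => (abs_le_one_iff_mul_self_le_one.2 (by nlinarith [h1 i]) |> abs_le.1).1,
        fun i => (abs_le_one_iff_mul_self_le_one.2 (by nlinarith [h1 i]) |> abs_le.1).2⟩
  have hcont : ContinuousOn (fun x => |bilin B x x|) K := by
    unfold bilin; fun_prop
  -- By compactness the form has a maximiser m in absolute value; comparing it with a net vector z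
  -- near m bounds the maximum by a fraction of itself plus M.
  obtain ⟨m, hmK, hm⟩ := hKc.exists_isMaxOn ⟨x, hxU, hx⟩ hcont
  set κ := |bilin B m m| with hκ
  have hκ0 : 0 ≤ κ := abs_nonneg _
  have hmax : ∀ y ∈ K, |bilin B y y| ≤ κ := fun y hy => hm hy
  have hhom : ∀ y : V → ℝ, (∀ i, i ∉ U → y i = 0) → |bilin B y y| ≤ κ * ∑ i, y i ^ 2 := by
    intro y hyU
    have hy0 : 0 ≤ ∑ i, y i ^ 2 := Finset.sum_nonneg fun _ _ => sq_nonneg _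
    rcases hy0.eq_or_lt with h0 | h0
    · have : y = 0 := by
        ext i
        have := (Finset.sum_eq_zero_iff_of_nonneg (fun i _ => sq_nonneg (y i))).1 h0.symm i
          (Finset.mem_univ i)
        simpa using this
      subst this
      simp [bilin]
    · set r := √(∑ i, y i ^ 2) with hr
      have hr0 : 0 < r := Real.sqrt_pos.2 h0
      have hr2 : r ^ 2 = ∑ i, y i ^ 2 := Real.sq_sqrt hy0
      have hmem : r⁻¹ • y ∈ K := by
        refine ⟨fun i hi => by simp [hyU i hi], ?_⟩
        simp only [Pi.smul_apply, smul_eq_mul, mul_pow]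
        rw [← Finset.mul_sum, ← hr2]
        field_simp
        rfl
      have h1 := hmax _ hmem
      rw [bilin_smul_left, bilin_smul_right hB, ← mul_assoc, abs_mul,
        abs_of_pos (by positivity : 0 < r⁻¹ * r⁻¹)] at h1
      rw [← hr2]
      calc |bilin B y y| = r ^ 2 * (r⁻¹ * r⁻¹ * |bilin B y y|) := by field_simp
        _ ≤ r ^ 2 * κ := by gcongr
        _ = _ := mul_comm _ _
  obtain ⟨z, hzU, hz1, hmz, hzM⟩ := h m hmK.1 hmK.2
  -- By symmetry the forms at m and z differ by the bilinear form at (m - z, m + z), rescaled here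
  -- to (u, v). Polarisation and the parallelogram law bound it by (κ/4) · 2(1/4 + 1) = 5κ/8, so κ ≤
  -- 8M/3.
  set u : V → ℝ := (2 : ℝ) • (m + (-1 : ℝ) • z) with hu
  set v : V → ℝ := (1 / 2 : ℝ) • (m + z) with hv
  have huU : ∀ i, i ∉ U → u i = 0 := fun i hi => by simp [hu, hmK.1 i hi, hzU i hi]
  have hvU : ∀ i, i ∉ U → v i = 0 := fun i hi => by simp [hv, hmK.1 i hi, hzU i hi]
  have hdiff : bilin B u v = bilin B m m - bilin B z z := by
    rw [hu, hv, bilin_smul_left, bilin_smul_right hB, bilin_add_left, bilin_smul_left,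
      bilin_add_right hB, bilin_add_right hB, bilin_comm hB z m]
    ring
  have hpol : 4 * bilin B u v
      = bilin B (u + v) (u + v) - bilin B (u + (-1 : ℝ) • v) (u + (-1 : ℝ) • v) := by
    simp only [bilin_add_left, bilin_add_right hB, bilin_smul_left, bilin_smul_right hB]
    rw [bilin_comm hB v u]
    ring
  have h1 := hhom (u + v) (fun i hi => by simp [huU i hi, hvU i hi])
  have h2 := hhom (u + (-1 : ℝ) • v) (fun i hi => by simp [huU i hi, hvU i hi])
  have hsum : ∑ i, (u + v) i ^ 2 + ∑ i, (u + (-1 : ℝ) • v) i ^ 2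
      = 2 * (∑ i, u i ^ 2 + ∑ i, v i ^ 2) := by
    rw [← Finset.sum_add_distrib, ← Finset.sum_add_distrib, Finset.mul_sum]
    refine Finset.sum_congr rfl fun i _ => ?_
    simp only [Pi.add_apply, Pi.smul_apply, smul_eq_mul]
    ring
  have hu2 : ∑ i, u i ^ 2 ≤ 1 / 4 := by
    have : ∑ i, u i ^ 2 = 4 * ∑ i, (m i - z i) ^ 2 := by
      rw [Finset.mul_sum]
      refine Finset.sum_congr rfl fun i _ => ?_
      simp only [hu, Pi.add_apply, Pi.smul_apply, smul_eq_mul]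
      ring
    linarith
  have hv2 : ∑ i, v i ^ 2 ≤ 1 := by
    have : ∑ i, v i ^ 2 ≤ 1 / 2 * (∑ i, m i ^ 2 + ∑ i, z i ^ 2) := by
      rw [← Finset.sum_add_distrib, Finset.mul_sum]
      refine Finset.sum_le_sum fun i _ => ?_
      simp only [hv, Pi.add_apply, Pi.smul_apply, smul_eq_mul]
      nlinarith [sq_nonneg (m i - z i)]
    linarith [hmK.2]
  have h3 : |bilin B u v| ≤ 5 / 8 * κ := by
    have h4 : 4 * |bilin B u v| ≤ κ * (5 / 2) := by
      calc 4 * |bilin B u v| = |4 * bilin B u v| := by rw [abs_mul]; norm_num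
        _ ≤ |bilin B (u + v) (u + v)| + |bilin B (u + (-1 : ℝ) • v) (u + (-1 : ℝ) • v)| := by
          rw [hpol]; exact abs_sub_le_add_abs _ _
        _ ≤ κ * (∑ i, (u + v) i ^ 2 + ∑ i, (u + (-1 : ℝ) • v) i ^ 2) := by
          rw [mul_add]; exact add_le_add h1 h2
        _ ≤ κ * (5 / 2) := by rw [hsum]; exact mul_le_mul_of_nonneg_left (by linarith) hκ0
    linarith
  have h5 : κ ≤ 5 / 8 * κ + M := by
    have : bilin B m m = bilin B u v + bilin B z z := by rw [hdiff]; ring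
    calc κ = |bilin B u v + bilin B z z| := by rw [hκ, this]
      _ ≤ _ := (abs_add_le _ _).trans (add_le_add h3 hzM)
  have h6 := hmax x ⟨hxU, hx⟩
  linarith

/-! ### A lattice net that respects supports -/

/-- Rounding towards zero. -/
def roundZero (y : ℝ) : ℤ := if 0 ≤ y then ⌊y⌋ else ⌈y⌉

lemma roundZero_sq_le (y : ℝ) : (roundZero y : ℝ) ^ 2 ≤ y ^ 2 := by
  unfold roundZero
  split_ifs with h
  · have h1 := Int.floor_le y
    have h2 : (0 : ℝ) ≤ ⌊y⌋ := by exact_mod_cast Int.floor_nonneg.2 h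
    nlinarith
  · push Not at h
    have h1 := Int.le_ceil y
    have h2 : (⌈y⌉ : ℝ) ≤ 0 := by exact_mod_cast Int.ceil_le.2 (by simpa using h.le)
    nlinarith

lemma sub_roundZero_sq_le (y : ℝ) : (y - roundZero y) ^ 2 ≤ 1 := by
  unfold roundZero
  split_ifs with h
  · have h1 := Int.floor_le y
    have h2 := Int.lt_floor_add_one y
    nlinarith
  · have h1 := Int.le_ceil y
    have h2 := Int.ceil_lt_add_one y
    nlinarith

/-- Rounding towards zero keeps the vector in the ball and its zero coordinates at zero. So one
fixed net serves every set of low-degree vertices, although that set is random. -/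
lemma exists_latticeVec_near [Nonempty V] {x : V → ℝ} (hx : ∑ i, x i ^ 2 ≤ 1) :
    ∃ k ∈ latticeBall V (16 * Fintype.card V), (∀ i, x i = 0 → latticeVec k i = 0) ∧
      ∑ i, (x i - latticeVec k i) ^ 2 ≤ 1 / 16 := by
  have hN : (0 : ℝ) < Fintype.card V := by exact_mod_cast Fintype.card_pos
  set N : ℝ := (Fintype.card V : ℝ) with hNd
  set r : ℝ := 4 * √N with hr
  have hr0 : 0 < r := by have := Real.sqrt_pos.2 hN; positivity
  have hr2 : r ^ 2 = 16 * N := by rw [hr, mul_pow, Real.sq_sqrt hN.le]; norm_num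
  refine ⟨fun i => roundZero (r * x i), ?_, ?_, ?_⟩
  · rw [mem_latticeBall]
    have : ((∑ i, roundZero (r * x i) ^ 2 : ℤ) : ℝ) ≤ 16 * N := by
      push_cast
      refine (Finset.sum_le_sum fun i _ => roundZero_sq_le (r * x i)).trans ?_
      simp_rw [mul_pow]
      rw [← Finset.mul_sum, hr2]
      nlinarith
    rw [hNd] at this
    exact_mod_cast this
  · intro i hi
    simp [latticeVec, hi, roundZero]
  · have : ∀ i ∈ Finset.univ, (x i - latticeVec (fun i => roundZero (r * x i)) i) ^ 2
        ≤ 1 / (16 * N) := by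
      intro i _
      have e : x i - latticeVec (fun i => roundZero (r * x i)) i
          = (r * x i - roundZero (r * x i)) / r := by
        rw [latticeVec, ← hNd, ← hr]; field_simp
      rw [e, div_pow, hr2]
      exact div_le_div_of_nonneg_right (sub_roundZero_sq_le _) (by positivity)
    refine (Finset.sum_le_sum this).trans ?_
    rw [Finset.sum_const, Finset.card_univ, nsmul_eq_mul, ← hNd]
    apply le_of_eq; field_simp

/-! ### The norm of the centred adjacency matrix -/

/-- The centred adjacency matrix. -/
def centredAdj (q : Sym2 V → ℝ) (ω : Sym2 V → Bool) (i j : V) : ℝ :=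
  if i ≠ j then bit (ω s(i, j)) - q s(i, j) else 0

variable {q : Sym2 V → ℝ}

lemma centredAdj_comm (ω : Sym2 V → Bool) (i j : V) :
    centredAdj q ω i j = centredAdj q ω j i := by
  simp only [centredAdj, ne_comm (a := i), Sym2.eq_swap (a := i)]

/-- Beyond the light deviation (40) and the heavy edges (1288) there is the mean over the heavy
pairs. There q ≤ D/N ≤ 2^l |x_i x_j|, so it is at most 2^l times the sum of (x_i x_j)², which adds
1. -/
lemma abs_bilin_net_le [Nonempty V] {ω : Sym2 V → Bool} {D : ℝ} {l : ℕ} (hD : 0 ≤ D)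
    (hDL : D ≤ (2 ^ l) ^ 2) (h0 : ∀ e, 0 ≤ q e) (hq : ∀ e, q e ≤ D / Fintype.card V)
    (hl : LightBound q (2 ^ l) ω) (hω : DiscBound D l (Fintype.card V) ω)
    {k : V → ℤ} (hk : k ∈ latticeBall V (16 * Fintype.card V))
    (hdeg : ∀ i, latticeVec k i ≠ 0 → ∑ j, adj ω i j ≤ 20 * D) :
    |bilin (centredAdj q ω) (latticeVec k) (latticeVec k)| ≤ 1329 * 2 ^ l := by
  have hN : (0 : ℝ) < Fintype.card V := by exact_mod_cast Fintype.card_pos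
  have hL : (0 : ℝ) < 2 ^ l := by positivity
  have hx := sum_latticeVec_sq_le hk
  set x := latticeVec k with hxd
  set N : ℝ := (Fintype.card V : ℝ) with hNd
  have hheavy := heavy_le hD hDL hω hx hdeg
  have hlight := hl k hk
  rw [← hNd, ← hxd] at hlight
  rw [← hNd] at hheavy
  have hsplit : |bilin (centredAdj q ω) x x - ∑ i, ∑ j, lightCoeff (2 ^ l / N) x i j *
      (bit (ω s(i, j)) - q s(i, j))| ≤ ∑ i, ∑ j,
        ((if (2 : ℝ) ^ l / N < |x i * x j| then adj ω i j * |x i * x j| else 0)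
          + 2 ^ l * (x i * x j) ^ 2) := by
    unfold bilin
    simp_rw [← Finset.sum_sub_distrib]
    refine (Finset.abs_sum_le_sum_abs _ _).trans (Finset.sum_le_sum fun i _ =>
      (Finset.abs_sum_le_sum_abs _ _).trans (Finset.sum_le_sum fun j _ => ?_))
    by_cases hij : i = j
    · have e : x i * x j * centredAdj q ω i j
          - lightCoeff (2 ^ l / N) x i j * (bit (ω s(i, j)) - q s(i, j)) = 0 := by
        simp [centredAdj, lightCoeff, hij]
      rw [e, abs_zero]
      have := adj_nonneg ω i j
      split_ifs <;> positivity
    by_cases h : (2 : ℝ) ^ l / N < |x i * x j|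
    · rw [if_pos h]
      have e : x i * x j * centredAdj q ω i j
          - lightCoeff (2 ^ l / N) x i j * (bit (ω s(i, j)) - q s(i, j))
          = x i * x j * bit (ω s(i, j)) - x i * x j * q s(i, j) := by
        rw [centredAdj, lightCoeff, if_pos hij, if_neg (fun hc => not_le.2 h hc.2)]; ring
      rw [e]
      refine (abs_sub_le_add_abs _ _).trans (add_le_add ?_ ?_)
      · rw [abs_mul, abs_of_nonneg (bit_nonneg _), mul_comm]
        simp [adj, hij]
      · rw [abs_mul, abs_of_nonneg (h0 _), ← sq_abs (x i * x j)]
        have h1 : (2 : ℝ) ^ l ≤ N * |x i * x j| := by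
          rw [div_lt_iff₀ hN] at h; linarith
        have h2 : q s(i, j) ≤ 2 ^ l * |x i * x j| := by
          refine (hq _).trans ?_
          rw [div_le_iff₀ hN]
          nlinarith
        nlinarith [abs_nonneg (x i * x j)]
    · rw [if_neg h]
      have e : x i * x j * centredAdj q ω i j
          - lightCoeff (2 ^ l / N) x i j * (bit (ω s(i, j)) - q s(i, j)) = 0 := by
        rw [centredAdj, lightCoeff, if_pos hij, if_pos ⟨hij, not_lt.1 h⟩]; ring
      rw [e, abs_zero]
      positivity
  have hsq : ∑ i, ∑ j, (2 : ℝ) ^ l * (x i * x j) ^ 2 ≤ 2 ^ l := by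
    simp_rw [← Finset.mul_sum]
    rw [sum_sq_mul_sq]
    have : (∑ i, x i ^ 2) ^ 2 ≤ 1 := pow_le_one₀ (Finset.sum_nonneg fun _ _ => sq_nonneg _) hx
    nlinarith
  simp_rw [Finset.sum_add_distrib] at hsplit
  have := abs_sub_abs_le_abs_sub (bilin (centredAdj q ω) x x)
    (∑ i, ∑ j, lightCoeff (2 ^ l / N) x i j * (bit (ω s(i, j)) - q s(i, j)))
  linarith

/-- The norm of the centred adjacency matrix on the vertices of bounded degree. -/
lemma abs_bilin_centredAdj_le [Nonempty V] {ω : Sym2 V → Bool} {D : ℝ} {l : ℕ} (hD : 0 ≤ D)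
    (hDL : D ≤ (2 ^ l) ^ 2) (h0 : ∀ e, 0 ≤ q e) (hq : ∀ e, q e ≤ D / Fintype.card V)
    (hl : LightBound q (2 ^ l) ω) (hω : DiscBound D l (Fintype.card V) ω)
    {x : V → ℝ} (hx : ∑ i, x i ^ 2 ≤ 1) (hdeg : ∀ i, x i ≠ 0 → ∑ j, adj ω i j ≤ 20 * D) :
    |bilin (centredAdj q ω) x x| ≤ 3987 * 2 ^ l := by
  have := abs_bilin_le_of_net (B := centredAdj q ω) (centredAdj_comm ω)
    {i | ∑ j, adj ω i j ≤ 20 * D} (M := 1329 * 2 ^ l) ?_ (x := x) ?_ hx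
  · linarith
  · intro y hyU hy
    obtain ⟨k, hk, hk0, hk1⟩ := exists_latticeVec_near hy
    have hU : ∀ i, i ∉ {i | ∑ j, adj ω i j ≤ 20 * D} → latticeVec k i = 0 :=
      fun i hi => hk0 i (hyU i hi)
    refine ⟨latticeVec k, hU, sum_latticeVec_sq_le hk, hk1,
      abs_bilin_net_le hD hDL h0 hq hl hω hk fun i hi => ?_⟩
    by_contra hc
    exact hi (hU i hc)
  · intro i hi
    by_contra hc
    exact hi (hdeg i hc)

end Quad

/-! ### The number of vertices of high degree -/

section HighDegree

variable {V : Type} [Fintype V] [DecidableEq V]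

lemma tilt_zero {l : ℕ} (hl : 1 ≤ l) : tilt l 0 0 = Real.exp 1 := by
  rw [tilt, show 0 + 0 + 1 - l = 0 by omega, pow_zero, mul_one]

/-- At the lowest levels the truncated exponent of the tilt is 0, so the tilt is e, its logarithm is
1, and the discrepancy bound becomes a plain edge count. -/
lemma discBound_zero [Nonempty V] {ω : Sym2 V → Bool} {D : ℝ} {l : ℕ} (hl : 1 ≤ l)
    (hω : DiscBound D l (Fintype.card V) ω) {I J : Finset V} (hI : I.Nonempty)
    (hJ : J.Nonempty) :
    pairCount ω I J ≤ 2 * Real.exp 1 * (I.card * J.card * (D / Fintype.card V))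
      + 2 * (3 * I.card + 3 * J.card + 2 * Fintype.card V) := by
  have h := hω 0 Fintype.card_pos 0 Fintype.card_pos I J hI hJ
  rw [tilt_zero hl, Real.log_exp] at h
  simp only [levelCost, Nat.cast_zero, zero_add, mul_one, pow_zero, div_one] at h
  linarith

/-- The edges from these vertices to all of V number at least 10 D each, while the edge count allows
only 2e D < 5.44 D each, plus 6 each and 10 N in total. -/
lemma card_highDegree_le [Nonempty V] {ω : Sym2 V → Bool} {D : ℝ} {l : ℕ} (hl : 1 ≤ l)
    (hD : 3 ≤ D) (hω : DiscBound D l (Fintype.card V) ω) {T : ℝ} (hT : 10 * D ≤ T) :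
    ((Finset.univ.filter fun i => T < ∑ j, adj ω i j).card : ℝ) ≤ 8 * Fintype.card V / D := by
  set S := Finset.univ.filter fun i => T < ∑ j, adj ω i j with hS
  have hN : (0 : ℝ) < Fintype.card V := by exact_mod_cast Fintype.card_pos
  rw [le_div_iff₀ (by linarith)]
  rcases S.eq_empty_or_nonempty with h | h
  · rw [h]; simp
  have h1 := discBound_zero hl hω h Finset.univ_nonempty
  have h2 : S.card * (10 * D) ≤ pairCount ω S Finset.univ := by
    rw [pairCount_eq, ← nsmul_eq_mul, ← Finset.sum_const]
    refine Finset.sum_le_sum fun i hi => ?_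
    have := (Finset.mem_filter.1 hi).2
    linarith
  rw [Finset.card_univ] at h1
  have e : (S.card : ℝ) * Fintype.card V * (D / Fintype.card V) = S.card * D := by field_simp
  rw [e] at h1
  have h3 : Real.exp 1 ≤ 2.72 := by linarith [Real.exp_one_lt_d9]
  have h4 : (0 : ℝ) ≤ S.card := Nat.cast_nonneg _
  have h5 : 2 * Real.exp 1 * (S.card * D) ≤ 2 * 2.72 * (S.card * D) := by gcongr
  nlinarith [mul_nonneg h4 (by linarith : (0 : ℝ) ≤ D - 3)]

lemma sum_adj_le [Nonempty V] {ω : Sym2 V → Bool} {D : ℝ} {l : ℕ} (hl : 1 ≤ l)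
    (hD : 0 ≤ D) (hω : DiscBound D l (Fintype.card V) ω) :
    ∑ i, ∑ j, adj ω i j ≤ (6 * D + 16) * Fintype.card V := by
  have hN : (0 : ℝ) < Fintype.card V := by exact_mod_cast Fintype.card_pos
  have h1 := discBound_zero hl hω (Finset.univ_nonempty (α := V)) Finset.univ_nonempty
  rw [pairCount_eq, Finset.card_univ] at h1
  have e : (Fintype.card V : ℝ) * Fintype.card V * (D / Fintype.card V)
      = D * Fintype.card V := by field_simp
  rw [e] at h1
  have h3 : Real.exp 1 ≤ 2.72 := by linarith [Real.exp_one_lt_d9]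
  have h5 : 2 * Real.exp 1 * (D * Fintype.card V) ≤ 2 * 2.72 * (D * Fintype.card V) := by
    gcongr
  nlinarith [mul_nonneg hD hN.le]

end HighDegree

/-! ### The top two eigenvectors -/

section Eigen

variable {V : Type} [Fintype V] [DecidableEq V]

lemma inner_toEuclideanLin (A : Matrix V V ℝ) (x : EuclideanSpace ℝ V) :
    inner ℝ x (Matrix.toEuclideanLin A x) = bilin A x x := by
  simp only [PiLp.inner_apply, Matrix.toLpLin_apply, Matrix.mulVec, dotProduct, bilin,
    RCLike.inner_apply, conj_trivial, Finset.sum_mul]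
  exact Finset.sum_congr rfl fun i _ => Finset.sum_congr rfl fun j _ => by ring

lemma quadForm_eq_sum {k : ℕ} {A : Matrix V V ℝ} {μ : Fin k → ℝ}
    {e : OrthonormalBasis (Fin k) ℝ (EuclideanSpace ℝ V)}
    (he : ∀ i, Matrix.toEuclideanLin A (e i) = μ i • e i) (x : EuclideanSpace ℝ V) :
    bilin A x x = ∑ i, μ i * inner ℝ (e i) x ^ 2 := by
  rw [← inner_toEuclideanLin]
  have h1 : Matrix.toEuclideanLin A x = ∑ i, (inner ℝ (e i) x * μ i) • e i := by
    conv_lhs => rw [← e.sum_repr' x]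
    rw [map_sum]
    refine Finset.sum_congr rfl fun i _ => ?_
    rw [map_smul, he, smul_smul]
  rw [h1, inner_sum]
  refine Finset.sum_congr rfl fun i _ => ?_
  rw [inner_smul_right, real_inner_comm]
  ring

/-- Courant–Fischer: the plane spanned by p and r contains a nonzero vector orthogonal to the top
eigenvector, where the form is at most the second eigenvalue times the squared norm. So that
eigenvalue is at least c. No gap to the third eigenvalue is needed. -/
lemma le_bilin_of_mem_topTwo {A : Matrix V V ℝ} {W : Submodule ℝ (EuclideanSpace ℝ V)}
    (hW : IsTopTwoEigenspace A W) (hV : 2 ≤ Fintype.card V) {p r : EuclideanSpace ℝ V}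
    (hpr : ∀ α β : ℝ, α • p + β • r = 0 → α = 0 ∧ β = 0) {c : ℝ}
    (hc : ∀ α β : ℝ, c * ‖α • p + β • r‖ ^ 2 ≤ bilin A (α • p + β • r) (α • p + β • r))
    {v : EuclideanSpace ℝ V} (hv : v ∈ W) : c * ‖v‖ ^ 2 ≤ bilin A v v := by
  obtain ⟨μ, e, hμ, he, rfl⟩ := hW
  have hnorm : ∀ x : EuclideanSpace ℝ V, ‖x‖ ^ 2 = ∑ i, inner ℝ (e i) x ^ 2 := fun x => by
    rw [← e.sum_sq_norm_inner_right x]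
    exact Finset.sum_congr rfl fun i _ => by rw [Real.norm_eq_abs, sq_abs]
  set i0 : Fin (Fintype.card V) := ⟨0, by omega⟩ with hi0
  set i1 : Fin (Fintype.card V) := ⟨1, by omega⟩ with hi1
  obtain ⟨α, β, hne, horth⟩ : ∃ α β : ℝ, α • p + β • r ≠ 0 ∧
      inner ℝ (e i0) (α • p + β • r) = 0 := by
    by_cases h : inner ℝ (e i0) p = 0 ∧ inner ℝ (e i0) r = 0
    · refine ⟨1, 0, fun h0 => one_ne_zero (hpr 1 0 h0).1, ?_⟩
      simp [h.1]
    · refine ⟨inner ℝ (e i0) r, -inner ℝ (e i0) p, fun h0 => h ?_, ?_⟩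
      · have := hpr _ _ h0
        exact ⟨neg_eq_zero.1 this.2, this.1⟩
      · rw [inner_add_right, inner_smul_right, inner_smul_right]; ring
  set x := α • p + β • r with hx
  have hxpos : 0 < ‖x‖ ^ 2 := by have := norm_pos_iff.2 hne; positivity
  have hcμ : c ≤ μ i1 := by
    have h1 := hc α β
    have h2 : bilin A x x ≤ μ i1 * ‖x‖ ^ 2 := by
      rw [quadForm_eq_sum he, hnorm, Finset.mul_sum]
      refine Finset.sum_le_sum fun i _ => ?_
      by_cases hi : i = i0
      · rw [hi, horth]; simp
      · refine mul_le_mul_of_nonneg_right (hμ ?_) (sq_nonneg _)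
        rw [Fin.le_def]
        have : (i : ℕ) ≠ 0 := fun h => hi (Fin.ext h)
        simp only [hi1]; omega
    exact le_of_mul_le_mul_right (h1.trans h2) hxpos
  have hzero : ∀ i : Fin (Fintype.card V), ¬ (i : ℕ) < 2 → inner ℝ (e i) v = 0 := by
    intro i hi
    refine Submodule.span_induction (p := fun y _ => inner ℝ (e i) y = 0) ?_ ?_ ?_ ?_ hv
    · rintro _ ⟨j, hj, rfl⟩
      exact e.orthonormal.2 fun h => hi (h ▸ hj)
    · simp
    · intro y z _ _ hy hz; rw [inner_add_right, hy, hz, add_zero]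
    · intro a y _ hy; rw [inner_smul_right, hy, mul_zero]
  rw [quadForm_eq_sum he, hnorm, Finset.mul_sum]
  refine Finset.sum_le_sum fun i _ => ?_
  by_cases hi : (i : ℕ) < 2
  · refine mul_le_mul_of_nonneg_right (hcμ.trans (hμ ?_)) (sq_nonneg _)
    rw [Fin.le_def]; simp only [hi1]; omega
  · rw [hzero i hi]; simp

end Eigen

/-! ### Spectral Partition on a graph with a bounded centred adjacency matrix -/

lemma graphOf_adj {V : Type} (ω : Sym2 V → Bool) (i j : V) :
    (graphOf ω).Adj i j ↔ ω s(i, j) = true ∧ i ≠ j := by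
  simp [graphOf]

section Graph

variable {V : Type} [Fintype V] [DecidableEq V]

open Classical in
lemma adjMatrix_graphOf (ω : Sym2 V → Bool) (i j : V) :
    (graphOf ω).adjMatrix ℝ i j = adj ω i j := by
  rw [SimpleGraph.adjMatrix_apply, graphOf_adj, adj]
  cases ω s(i, j) <;> by_cases h : i = j <;> simp [h]

open Classical in
lemma degree_graphOf (ω : Sym2 V → Bool) (i : V) :
    ((graphOf ω).degree i : ℝ) = ∑ j, adj ω i j := by
  have h : ∑ j, adj ω i j = ∑ j, (graphOf ω).adjMatrix ℝ i j :=
    Finset.sum_congr rfl fun j _ => (adjMatrix_graphOf ω i j).symm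
  rw [h, ← SimpleGraph.card_neighborFinset_eq_degree, SimpleGraph.neighborFinset_eq_filter]
  simp [SimpleGraph.adjMatrix_apply]

/-- The restriction of a vector to the vertices of degree at most `T`. -/
def prune (ω : Sym2 V → Bool) (T : ℝ) (x : V → ℝ) (i : V) : ℝ :=
  if T < ∑ j, adj ω i j then 0 else x i

/-- Zeroing rows and columns can be moved to the vector, which brings the form within reach of the
norm bound on low-degree supports. -/
lemma bilin_prunedAdj (ω : Sym2 V → Bool) (T : ℝ) (x : V → ℝ) :
    bilin (prunedAdj (graphOf ω) T) x x = bilin (adj ω) (prune ω T x) (prune ω T x) := by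
  unfold bilin
  refine Finset.sum_congr rfl fun i _ => Finset.sum_congr rfl fun j _ => ?_
  rw [prunedAdj, degree_graphOf, degree_graphOf, adjMatrix_graphOf, prune, prune]
  by_cases h1 : T < ∑ j, adj ω i j <;> by_cases h2 : T < ∑ i, adj ω j i <;> simp [h1, h2]

/-- The vertices of degree greater than `T`. -/
def highDegree (ω : Sym2 V → Bool) (T : ℝ) : Finset V :=
  Finset.univ.filter fun i => T < ∑ j, adj ω i j

lemma sum_mul_prune (ω : Sym2 V → Bool) (T : ℝ) (y x : V → ℝ) :
    ∑ i, y i * prune ω T x i = ∑ i, y i * x i - ∑ i ∈ highDegree ω T, y i * x i := by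
  rw [eq_sub_iff_add_eq, highDegree, Finset.sum_filter, ← Finset.sum_add_distrib]
  refine Finset.sum_congr rfl fun i _ => ?_
  unfold prune
  split_ifs <;> ring

lemma sum_prune_sq_le (ω : Sym2 V → Bool) (T : ℝ) (x : V → ℝ) :
    ∑ i, prune ω T x i ^ 2 ≤ ∑ i, x i ^ 2 := by
  refine Finset.sum_le_sum fun i _ => ?_
  unfold prune
  split_ifs
  · rw [zero_pow two_ne_zero]; exact sq_nonneg _
  · exact le_rfl

lemma sum_adj_le_of_prune_ne_zero {ω : Sym2 V → Bool} {T : ℝ} {x : V → ℝ} {i : V}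
    (h : prune ω T x i ≠ 0) : ∑ j, adj ω i j ≤ T := by
  unfold prune at h
  split_ifs at h with h1
  · exact absurd rfl h
  · exact not_lt.1 h1

end Graph

/-! ### Block signs and the mean of the red matrix -/

/-- The sign of the block of a vertex. -/
def blockSign {n : ℕ} (u : Vtx n) : ℝ := if u.isLeft then 1 else -1

lemma blockSign_sq {n : ℕ} (u : Vtx n) : blockSign u ^ 2 = 1 := by
  unfold blockSign; split_ifs <;> norm_num

lemma abs_blockSign {n : ℕ} (u : Vtx n) : |blockSign u| = 1 := by
  unfold blockSign; split_ifs <;> simp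

lemma sum_blockSign (n : ℕ) : ∑ u : Vtx n, blockSign u = 0 := by
  simp [blockSign, Fintype.sum_sum_type]

lemma card_vtx (n : ℕ) : (Fintype.card (Vtx n) : ℝ) = 2 * n := by
  simp only [Fintype.card_sum, Fintype.card_fin]; push_cast; ring

/-- The probability that a pair is a red edge. -/
def redProb (a b : ℝ) (n : ℕ) (e : Sym2 (Vtx n)) : ℝ := edgeProb a b n e / 2

lemma edgeProb_mk (a b : ℝ) {n : ℕ} (i j : Vtx n) :
    edgeProb a b n s(i, j) = (a + b) / (2 * n) + (a - b) / (2 * n) * (blockSign i * blockSign j) := by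
  have h : edgeProb a b n s(i, j) = if i.isLeft = j.isLeft then a / n else b / n := rfl
  rw [h]
  rcases i with i | i <;> rcases j with j | j <;> simp [blockSign] <;> ring

/-- The quadratic form of the expected red adjacency matrix. -/
def meanForm (a b : ℝ) {n : ℕ} (x : Vtx n → ℝ) : ℝ :=
  (a + b) / (4 * n) * (∑ i, x i) ^ 2 + (a - b) / (4 * n) * (∑ i, blockSign i * x i) ^ 2

/-- The mean form includes the diagonal, which makes it exactly of rank two; the graph has no loops,
whence the last term. -/
lemma bilin_adj_eq (a b : ℝ) {n : ℕ} (ω : Sym2 (Vtx n) → Bool) (x : Vtx n → ℝ) :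
    bilin (adj ω) x x = bilin (centredAdj (redProb a b n) ω) x x + meanForm a b x
      - a / (2 * n) * ∑ i, x i ^ 2 := by
  have h1 : meanForm a b x = ∑ i, ∑ j, x i * x j * redProb a b n s(i, j) := by
    rw [meanForm, sq, sq, Finset.sum_mul_sum, Finset.sum_mul_sum, Finset.mul_sum, Finset.mul_sum,
      ← Finset.sum_add_distrib]
    refine Finset.sum_congr rfl fun i _ => ?_
    rw [Finset.mul_sum, Finset.mul_sum, ← Finset.sum_add_distrib]
    refine Finset.sum_congr rfl fun j _ => ?_
    rw [redProb, edgeProb_mk]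
    ring
  have h2 : a / (2 * n) * ∑ i, x i ^ 2
      = ∑ i, ∑ j, if i = j then x i * x j * redProb a b n s(i, j) else 0 := by
    rw [Finset.mul_sum]
    refine Finset.sum_congr rfl fun i _ => ?_
    rw [Finset.sum_ite_eq, if_pos (Finset.mem_univ _), redProb, edgeProb_mk, ← sq (blockSign i),
      blockSign_sq]
    ring
  rw [h1, h2, bilin, bilin, ← Finset.sum_add_distrib, ← Finset.sum_sub_distrib]
  refine Finset.sum_congr rfl fun i _ => ?_
  rw [← Finset.sum_add_distrib, ← Finset.sum_sub_distrib]
  refine Finset.sum_congr rfl fun j _ => ?_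
  unfold adj centredAdj
  by_cases h : i = j <;> simp [h]
  ring

lemma mem_block₁ {n : ℕ} (u : Vtx n) : u ∈ block₁ n ↔ u.isLeft = true := by
  cases u <;> simp [block₁]

lemma mem_block₂ {n : ℕ} (u : Vtx n) : u ∈ block₂ n ↔ u.isLeft = false := by
  cases u <;> simp [block₂]

lemma card_block₁ (n : ℕ) : (block₁ n).card = n := by simp [block₁]

lemma card_block₂ (n : ℕ) : (block₂ n).card = n := by simp [block₂]

lemma block₂_eq (n : ℕ) : block₂ n = (block₁ n)ᶜ := by
  ext u; rw [Finset.mem_compl, mem_block₁, mem_block₂]; simp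

/-- The sizes of the intersections of a balanced partition with the blocks. -/
lemma card_inter_blocks {n : ℕ} {P : Finset (Vtx n) × Finset (Vtx n)} (h1 : P.1.card = n)
    (h2 : P.2 = P.1ᶜ) :
    (block₁ n ∩ P.1).card + (block₁ n ∩ P.2).card = n ∧
      (block₂ n ∩ P.1).card = (block₁ n ∩ P.2).card ∧
      (block₂ n ∩ P.2).card = (block₁ n ∩ P.1).card := by
  have e1 := Finset.card_inter_add_card_sdiff (block₁ n) P.1
  have e2 := Finset.card_inter_add_card_sdiff (block₂ n) P.1
  have e3 := Finset.card_inter_add_card_sdiff P.1 (block₁ n)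
  rw [card_block₁, Finset.sdiff_eq_inter_compl, ← h2] at e1
  rw [card_block₂, Finset.sdiff_eq_inter_compl, ← h2] at e2
  rw [h1, Finset.sdiff_eq_inter_compl, ← block₂_eq, Finset.inter_comm,
    Finset.inter_comm P.1 (block₂ n)] at e3
  omega

/-- The unit vector v is within squared distance 2 - 39/20 = 1/20 of σ/√(2n), and every vertex where
v has the wrong sign contributes at least 1/(2n). So it suffices that all misplaced vertices of one
block have the wrong sign. -/
lemma isCorrectLabelled_of_correlated {n : ℕ} (hn : 0 < n)
    {P : Finset (Vtx n) × Finset (Vtx n)} (h1 : P.1.card = n) (h2 : P.2 = P.1ᶜ)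
    {v : Vtx n → ℝ} (hv : ∑ i, v i ^ 2 = 1)
    (hw : √(2 * n) * (39 / 40) ≤ ∑ i, blockSign i * v i)
    (hord : ∀ i ∈ P.1, ∀ j ∈ P.2, v j ≤ v i) : IsCorrectLabelled (1 / 10) P := by
  have hn0 : (0 : ℝ) < n := by exact_mod_cast hn
  set r := √(2 * (n : ℝ)) with hr
  have hr0 : 0 < r := Real.sqrt_pos.2 (by positivity)
  have hr2 : r ^ 2 = 2 * n := Real.sq_sqrt (by positivity)
  obtain ⟨c1, c2, c3⟩ := card_inter_blocks h1 h2
  have hsum : ∑ i, (v i - blockSign i / r) ^ 2 ≤ 1 / 20 := by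
    have e : ∑ i, (v i - blockSign i / r) ^ 2
        = ∑ i, v i ^ 2 - 2 / r * ∑ i, blockSign i * v i + ∑ _i : Vtx n, 1 / r ^ 2 := by
      rw [Finset.mul_sum, ← Finset.sum_sub_distrib, ← Finset.sum_add_distrib]
      refine Finset.sum_congr rfl fun i _ => ?_
      have : 1 / r ^ 2 = blockSign i ^ 2 / r ^ 2 := by rw [blockSign_sq]
      rw [this]; field_simp; ring
    rw [e, hv, Finset.sum_const, Finset.card_univ, nsmul_eq_mul, card_vtx, hr2]
    have h3 : 2 / r * (r * (39 / 40)) ≤ 2 / r * ∑ i, blockSign i * v i := by gcongr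
    have h4 : 2 / r * (r * (39 / 40)) = 39 / 20 := by field_simp; norm_num
    have h5 : 2 * (n : ℝ) * (1 / (2 * n)) = 1 := by field_simp
    linarith
  have hk : ((block₁ n ∩ P.2).card : ℝ) ≤ n / 10 := by
    have hgen : ∀ S : Finset (Vtx n), (∀ i ∈ S, 1 / (2 * (n : ℝ)) ≤ (v i - blockSign i / r) ^ 2) →
        (S.card : ℝ) ≤ n / 10 := by
      intro S hS
      have h3 : S.card * (1 / (2 * (n : ℝ))) ≤ 1 / 20 := by
        rw [← nsmul_eq_mul, ← Finset.sum_const]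
        exact (Finset.sum_le_sum hS).trans ((Finset.sum_le_sum_of_subset_of_nonneg
          (Finset.subset_univ S) fun _ _ _ => sq_nonneg _).trans hsum)
      rw [mul_one_div, div_le_iff₀ (by positivity)] at h3
      linarith
    have hinv : 1 / (2 * (n : ℝ)) = (1 / r) ^ 2 := by rw [div_pow, hr2, one_pow]
    have hir : 0 < 1 / r := by positivity
    -- If a misplaced vertex of the first block has a positive value, then by the ordering so has
    -- every vertex of V₁', in particular every misplaced vertex of the second block. The two blocks
    -- have equally many misplaced vertices.
    by_cases hpos : ∀ i ∈ block₁ n ∩ P.2, v i ≤ 0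
    · refine hgen _ fun i hi => ?_
      have hs : blockSign i = 1 := by
        have := (mem_block₁ i).1 (Finset.mem_inter.1 hi).1
        simp [blockSign, this]
      rw [hs, hinv]
      nlinarith [hpos i hi]
    · push Not at hpos
      obtain ⟨i, hi, hvi⟩ := hpos
      rw [← c2]
      refine hgen _ fun j hj => ?_
      have hs : blockSign j = -1 := by
        have := (mem_block₂ j).1 (Finset.mem_inter.1 hj).1
        simp [blockSign, this]
      have hvj := hord j (Finset.mem_inter.1 hj).2 i (Finset.mem_inter.1 hi).2
      rw [hs, hinv, neg_div]
      nlinarith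
  have hc : ((block₁ n ∩ P.1).card : ℝ) + (block₁ n ∩ P.2).card = n := by exact_mod_cast c1
  refine ⟨by linarith, ?_⟩
  rw [c3]; linarith

/-! ### Comparison of the pruned form with its mean -/

/-- The pruned form is close to the mean form. -/
lemma abs_bilin_prunedAdj_sub_le {a b κ T : ℝ} {n : ℕ} (hn : 0 < n) (ha : 0 ≤ a)
    (han : a ≤ 2 * n) {ω : Sym2 (Vtx n) → Bool}
    (hnorm : ∀ x : Vtx n → ℝ, ∑ i, x i ^ 2 ≤ 1 → (∀ i, x i ≠ 0 → ∑ j, adj ω i j ≤ T) →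
      |bilin (centredAdj (redProb a b n) ω) x x| ≤ κ) {x : Vtx n → ℝ} (hx : ∑ i, x i ^ 2 ≤ 1) :
    |bilin (prunedAdj (graphOf ω) T) x x - meanForm a b (prune ω T x)| ≤ κ + 1 := by
  have hn0 : (0 : ℝ) < n := by exact_mod_cast hn
  have hx' := (sum_prune_sq_le ω T x).trans hx
  have h1 := hnorm _ hx' fun i hi => sum_adj_le_of_prune_ne_zero hi
  rw [bilin_prunedAdj, bilin_adj_eq a b]
  have h0 : 0 ≤ ∑ i, prune ω T x i ^ 2 := Finset.sum_nonneg fun _ _ => sq_nonneg _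
  have h2 : 0 ≤ a / (2 * n) * ∑ i, prune ω T x i ^ 2 := by positivity
  have h3 : a / (2 * n) * ∑ i, prune ω T x i ^ 2 ≤ 1 := by
    refine mul_le_one₀ ?_ h0 hx'
    rw [div_le_one (by positivity)]; exact han
  rw [abs_le] at h1 ⊢
  constructor <;> linarith [h1.1, h1.2]

lemma sum_const_add_blockSign {n : ℕ} (α β : ℝ) :
    ∑ i : Vtx n, (α + β * blockSign i) = 2 * n * α := by
  rw [Finset.sum_add_distrib, ← Finset.mul_sum, sum_blockSign, Finset.sum_const,
    Finset.card_univ, nsmul_eq_mul, card_vtx]; ring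

lemma sum_blockSign_mul {n : ℕ} (α β : ℝ) :
    ∑ i : Vtx n, blockSign i * (α + β * blockSign i) = 2 * n * β := by
  have : ∀ i : Vtx n, blockSign i * (α + β * blockSign i) = β + α * blockSign i := fun i => by
    linear_combination β * blockSign_sq i
  simp_rw [this, sum_const_add_blockSign]

lemma sum_sq_const_add_blockSign {n : ℕ} (α β : ℝ) :
    ∑ i : Vtx n, (α + β * blockSign i) ^ 2 = 2 * n * (α ^ 2 + β ^ 2) := by
  have : ∀ i : Vtx n, (α + β * blockSign i) ^ 2
      = (α ^ 2 + β ^ 2) + (2 * α * β) * blockSign i := fun i => by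
    linear_combination β ^ 2 * blockSign_sq i
  simp_rw [this, sum_const_add_blockSign]

lemma sq_sub_ge {n k m γ s : ℝ} (hn : 0 ≤ n) (hs : |s| ≤ k * m) :
    4 * n ^ 2 * γ ^ 2 - 4 * n * (k * m) * |γ| ≤ (2 * n * γ - s) ^ 2 := by
  have h3 : γ * s ≤ |γ| * (k * m) := by
    refine (le_abs_self _).trans ?_
    rw [abs_mul]
    exact mul_le_mul_of_nonneg_left hs (abs_nonneg _)
  nlinarith [sq_nonneg s, mul_le_mul_of_nonneg_left h3 (by positivity : (0 : ℝ) ≤ 4 * n)]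

/-- The mean form on the pruned vectors of the expected top eigenspace. -/
lemma le_meanForm_prune {a b T : ℝ} {n : ℕ} (hn : 0 < n) (hb : 0 < b) (hab : b < a)
    {ω : Sym2 (Vtx n) → Bool} (hS : (a + b) / n * (highDegree ω T).card ≤ 16) {α β : ℝ}
    (h1 : 2 * n * (α ^ 2 + β ^ 2) = 1) :
    (a - b) / 2 - 16 ≤ meanForm a b (prune ω T fun i => α + β * blockSign i) := by
  have hn0 : (0 : ℝ) < n := by exact_mod_cast hn
  set D := a + b with hDd
  set g := a - b with hgd
  have hg0 : 0 < g := by rw [hgd]; linarith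
  have hD0 : 0 < D := by linarith
  set S := highDegree ω T with hSd
  set x : Vtx n → ℝ := fun i => α + β * blockSign i with hx
  set m := |α| + |β| with hm
  have hm0 : 0 ≤ m := by positivity
  have hxm : ∀ i, |x i| ≤ m := fun i => by
    refine (abs_add_le _ _).trans ?_
    rw [abs_mul, abs_blockSign, mul_one]
  set s1 := ∑ i ∈ S, (1 : ℝ) * x i with hs1
  set s2 := ∑ i ∈ S, blockSign i * x i with hs2
  have hs1m : |s1| ≤ S.card * m := by
    refine (Finset.abs_sum_le_sum_abs _ _).trans ?_
    rw [← nsmul_eq_mul, ← Finset.sum_const]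
    exact Finset.sum_le_sum fun i _ => by rw [one_mul]; exact hxm i
  have hs2m : |s2| ≤ S.card * m := by
    refine (Finset.abs_sum_le_sum_abs _ _).trans ?_
    rw [← nsmul_eq_mul, ← Finset.sum_const]
    exact Finset.sum_le_sum fun i _ => by rw [abs_mul, abs_blockSign, one_mul]; exact hxm i
  have e1 : ∑ i, prune ω T x i = 2 * n * α - s1 := by
    have h := sum_mul_prune ω T (fun _ => 1) x
    simp only [one_mul] at h
    rw [h, hs1]
    simp only [one_mul]
    rw [← sum_const_add_blockSign α β]
  have e2 : ∑ i, blockSign i * prune ω T x i = 2 * n * β - s2 := by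
    rw [sum_mul_prune, hs2, ← sum_blockSign_mul α β]
  have h3 := sq_sub_ge (γ := α) hn0.le hs1m
  have h4 := sq_sub_ge (γ := β) hn0.le hs2m
  rw [meanForm, e1, e2, ← hDd, ← hgd]
  have hgD : g ≤ D := by rw [hgd, hDd]; linarith
  have h5 := mul_le_mul_of_nonneg_left h3 (by positivity : 0 ≤ D / (4 * n))
  have h6 := mul_le_mul_of_nonneg_left h4 (by positivity : 0 ≤ g / (4 * n))
  have e5 : D / (4 * n) * (4 * n ^ 2 * α ^ 2 - 4 * n * (S.card * m) * |α|)
      = D * (n * α ^ 2) - D * S.card * m * |α| := by field_simp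
  have e6 : g / (4 * n) * (4 * n ^ 2 * β ^ 2 - 4 * n * (S.card * m) * |β|)
      = g * (n * β ^ 2) - g * S.card * m * |β| := by field_simp
  have h7 : D * S.card * m * |α| + D * S.card * m * |β| ≤ 16 := by
    -- The vector is spread evenly, with entries of order 1/√n. Removing O(n/D) coordinates
    -- therefore changes a form of norm D/2 only by a constant.
    have : m ^ 2 ≤ 2 * (α ^ 2 + β ^ 2) := by
      rw [hm, ← sq_abs α, ← sq_abs β]; nlinarith [sq_nonneg (|α| - |β|)]
    calc _ = D * S.card * m ^ 2 := by rw [hm]; ring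
      _ ≤ D * S.card * (2 * (α ^ 2 + β ^ 2)) := mul_le_mul_of_nonneg_left this (by positivity)
      _ = D / n * S.card * (2 * n * (α ^ 2 + β ^ 2)) := by field_simp
      _ ≤ 16 := by rw [h1, mul_one]; exact hS
  have h8 : g * (S.card * m * |β|) ≤ D * (S.card * m * |β|) :=
    mul_le_mul_of_nonneg_right hgD (by positivity)
  have h9 : g * (n * α ^ 2) ≤ D * (n * α ^ 2) :=
    mul_le_mul_of_nonneg_right hgD (by positivity)
  have h10 : g * (n * α ^ 2) + g * (n * β ^ 2) = g / 2 := by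
    linear_combination g / 2 * h1
  linarith

/-- The mean form on a pruned unit vector that is orthogonal to the all-ones vector. -/
lemma meanForm_prune_le {a b T ρ : ℝ} {n : ℕ} (hn : 0 < n) (hb : 0 < b) (hab : b < a)
    {ω : Sym2 (Vtx n) → Bool} (hS : (a + b) / n * (highDegree ω T).card ≤ 16) (hρ : 0 ≤ ρ)
    (hSρ : ((highDegree ω T).card : ℝ) ≤ ρ ^ 2) {v : Vtx n → ℝ} (hv : ∑ i, v i ^ 2 = 1)
    (hv0 : ∑ i, v i = 0) :
    meanForm a b (prune ω T v)
      ≤ 4 + (a - b) / (4 * n) * (|∑ i, blockSign i * v i| + ρ) ^ 2 := by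
  have hn0 : (0 : ℝ) < n := by exact_mod_cast hn
  set S := highDegree ω T with hSd
  have hcs : ∀ y : Vtx n → ℝ, (∀ i, |y i| ≤ 1) → (∑ i ∈ S, y i * v i) ^ 2 ≤ S.card := by
    intro y hy
    have h1 : (∑ i ∈ S, y i * v i) ^ 2 ≤ (∑ i ∈ S, y i ^ 2) * ∑ i ∈ S, v i ^ 2 :=
      Finset.sum_mul_sq_le_sq_mul_sq _ _ _
    have h2 : ∑ i ∈ S, y i ^ 2 ≤ S.card := by
      rw [Finset.card_eq_sum_ones, Nat.cast_sum]
      exact Finset.sum_le_sum fun i _ => by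
        rw [← sq_abs]; push_cast; exact pow_le_one₀ (abs_nonneg _) (hy i)
    have h3 : ∑ i ∈ S, v i ^ 2 ≤ 1 := by
      rw [← hv]
      exact Finset.sum_le_sum_of_subset_of_nonneg (Finset.subset_univ _) fun _ _ _ => sq_nonneg _
    have h4 : 0 ≤ ∑ i ∈ S, v i ^ 2 := Finset.sum_nonneg fun _ _ => sq_nonneg _
    have h5 : (0 : ℝ) ≤ S.card := Nat.cast_nonneg _
    nlinarith
  set w := ∑ i, blockSign i * v i with hw
  set s2 := ∑ i ∈ S, blockSign i * v i with hs2
  have hs2ρ : |s2| ≤ ρ :=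
    abs_le_of_sq_le_sq ((hcs blockSign fun i => (abs_blockSign i).le).trans hSρ) hρ
  have e1 : ∑ i, prune ω T v i = -∑ i ∈ S, (1 : ℝ) * v i := by
    have h := sum_mul_prune ω T (fun _ => 1) v
    simp only [one_mul] at h
    rw [h, hv0]; simp [hSd]
  rw [meanForm, e1, sum_mul_prune, ← hw, ← hSd, ← hs2, neg_sq]
  refine add_le_add ?_ ?_
  · have h1 := hcs (fun _ => 1) (fun _ => by simp)
    have hD : 0 ≤ (a + b) / (4 * n) := by
      have : 0 < a + b := by linarith
      positivity
    calc (a + b) / (4 * n) * (∑ i ∈ S, (1 : ℝ) * v i) ^ 2 ≤ (a + b) / (4 * n) * S.card :=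
          mul_le_mul_of_nonneg_left h1 hD
      _ = ((a + b) / n * S.card) / 4 := by ring
      _ ≤ 4 := by linarith
  · have hg : 0 ≤ (a - b) / (4 * n) := div_nonneg (by linarith) (by positivity)
    refine mul_le_mul_of_nonneg_left ?_ hg
    rw [← sq_abs (w - s2)]
    refine pow_le_pow_left₀ (abs_nonneg _) ((abs_sub_le_add_abs _ _).trans ?_) 2
    linarith

lemma bilin_smul_smul {V : Type} [Fintype V] (B : V → V → ℝ) (c : ℝ) (x : V → ℝ) :
    bilin B (fun i => c * x i) (fun i => c * x i) = c ^ 2 * bilin B x x := by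
  simp only [bilin, Finset.mul_sum]
  exact Finset.sum_congr rfl fun i _ => Finset.sum_congr rfl fun j _ => by ring

lemma le_bilin_of_unit {n : ℕ} (hn : 0 < n) (B : Vtx n → Vtx n → ℝ) {c : ℝ}
    (h : ∀ α β : ℝ, 2 * n * (α ^ 2 + β ^ 2) = 1 →
      c ≤ bilin B (fun i => α + β * blockSign i) (fun i => α + β * blockSign i)) (α β : ℝ) :
    c * (2 * n * (α ^ 2 + β ^ 2))
      ≤ bilin B (fun i => α + β * blockSign i) (fun i => α + β * blockSign i) := by
  have hn0 : (0 : ℝ) < n := by exact_mod_cast hn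
  have h0 : 0 ≤ 2 * n * (α ^ 2 + β ^ 2) := by positivity
  rcases h0.eq_or_lt with h1 | h1
  · have hα : α = 0 ∧ β = 0 := by
      have h2 : α ^ 2 + β ^ 2 = 0 := by
        rcases mul_eq_zero.1 h1.symm with h | h
        · exact absurd h (by positivity)
        · exact h
      constructor <;> nlinarith [sq_nonneg α, sq_nonneg β]
    rw [hα.1, hα.2]
    simp [bilin]
  · set ν := √(2 * n * (α ^ 2 + β ^ 2)) with hν
    have hν0 : 0 < ν := Real.sqrt_pos.2 h1
    have hν2 : ν ^ 2 = 2 * n * (α ^ 2 + β ^ 2) := Real.sq_sqrt h0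
    have h2 := h (ν⁻¹ * α) (ν⁻¹ * β) (by
      rw [mul_pow, mul_pow, ← mul_add, mul_left_comm, ← hν2]
      field_simp)
    have h3 : (fun i : Vtx n => ν⁻¹ * α + ν⁻¹ * β * blockSign i)
        = fun i => ν⁻¹ * (α + β * blockSign i) := by
      funext i; ring
    rw [h3, bilin_smul_smul, inv_pow, inv_mul_eq_div, le_div_iff₀ (by positivity), hν2] at h2
    exact h2

/-- Spectral Partition recovers most of the blocks, if the centred adjacency matrix is small on the
vertices of bounded degree and these are most of the vertices. -/
lemma isCorrect_of_isSpectralOutput {a b d κ : ℝ} {n : ℕ} (hn : 0 < n) (hb : 0 < b) (hab : b < a)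
    (han : a ≤ 2 * n) (hD : 51200 ≤ a + b) (hκ : 80 * (44 + 4 * κ) ≤ a - b)
    {ω : Sym2 (Vtx n) → Bool}
    (hS : ((highDegree ω (20 * d)).card : ℝ) ≤ 16 * n / (a + b))
    (hnorm : ∀ x : Vtx n → ℝ, ∑ i, x i ^ 2 ≤ 1 →
      (∀ i, x i ≠ 0 → ∑ j, adj ω i j ≤ 20 * d) →
        |bilin (centredAdj (redProb a b n) ω) x x| ≤ κ)
    {P : Finset (Vtx n) × Finset (Vtx n)} (hP : IsSpectralOutput d (graphOf ω) P) :
    P.1.card = n ∧ P.2 = P.1ᶜ ∧ IsCorrect (1 / 10) P := by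
  obtain ⟨W, v₁, v₂, hW, hv₁, hv₂W, hv₂, horth, hP1, hP2, hord⟩ := hP
  refine ⟨hP1, hP2, ?_⟩
  have hn0 : (0 : ℝ) < n := by exact_mod_cast hn
  have hg0 : 0 < a - b := by linarith
  have hD0 : 0 < a + b := by linarith
  have hSD : (a + b) / n * (highDegree ω (20 * d)).card ≤ 16 := by
    refine (mul_le_mul_of_nonneg_left hS (by positivity)).trans_eq ?_
    field_simp
  have hform := fun (x : Vtx n → ℝ) (hx : ∑ i, x i ^ 2 ≤ 1) =>
    abs_le.1 (abs_bilin_prunedAdj_sub_le hn (hb.trans hab).le han hnorm hx)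
  set p : EuclideanSpace ℝ (Vtx n) := WithLp.toLp 2 fun _ => 1 with hp
  set r : EuclideanSpace ℝ (Vtx n) := WithLp.toLp 2 fun u => blockSign u with hr
  have hsq : ∀ x : EuclideanSpace ℝ (Vtx n), ‖x‖ ^ 2 = ∑ i, x i ^ 2 := fun x => by
    rw [EuclideanSpace.norm_sq_eq]
    exact Finset.sum_congr rfl fun i _ => by rw [Real.norm_eq_abs, sq_abs]
  have happ : ∀ α β : ℝ, (α • p + β • r).ofLp = fun i => α + β * blockSign i := by
    intro α β; funext i; simp [hp, hr]
  have hpr2 : ∀ α β : ℝ, ‖α • p + β • r‖ ^ 2 = 2 * n * (α ^ 2 + β ^ 2) := by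
    intro α β
    rw [hsq, happ]
    exact sum_sq_const_add_blockSign α β
  have hpr : ∀ α β : ℝ, α • p + β • r = 0 → α = 0 ∧ β = 0 := by
    intro α β h0
    have h1 := hpr2 α β
    rw [h0, norm_zero] at h1
    have h2 : α ^ 2 + β ^ 2 = 0 := by
      have : 2 * (n : ℝ) * (α ^ 2 + β ^ 2) = 0 := by rw [← h1]; norm_num
      rcases mul_eq_zero.1 this with h | h
      · exact absurd h (by positivity)
      · exact h
    constructor <;> nlinarith [sq_nonneg α, sq_nonneg β]
  have hlow : ∀ α β : ℝ, ((a - b) / 2 - 16 - (κ + 1)) * ‖α • p + β • r‖ ^ 2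
      ≤ bilin (prunedAdj (graphOf ω) (20 * d)) (α • p + β • r) (α • p + β • r) := by
    intro α β
    rw [hpr2, show α • p.ofLp + β • r.ofLp = fun i => α + β * blockSign i from happ α β]
    refine le_bilin_of_unit hn _ (fun α β h => ?_) α β
    have h1 := (hform (fun i => α + β * blockSign i)
      (by rw [sum_sq_const_add_blockSign, h])).1
    have h2 := le_meanForm_prune hn hb hab hSD h
    linarith
  have hv2 := le_bilin_of_mem_topTwo hW (by simp only [Fintype.card_sum, Fintype.card_fin]; omega)
    hpr hlow hv₂W
  rw [hv₂, one_pow, mul_one] at hv2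
  have hvsq : ∑ i, v₂ i ^ 2 = 1 := by rw [← hsq, hv₂, one_pow]
  have hsum0 : ∑ i, v₂ i = 0 := by
    have h1 : inner ℝ p v₂ = 0 := by
      -- As v₂ lies in W, its inner product with the all-ones vector equals that with the projection
      -- v₁.
      rw [← horth, hv₁, Submodule.inner_starProjection_left_eq_right,
        Submodule.starProjection_eq_self_iff.2 hv₂W]
    simpa [PiLp.inner_apply, hp] using h1
  have hup := (hform v₂ hvsq.le).2
  set R := √(2 * (n : ℝ)) with hR
  have hR0 : 0 < R := Real.sqrt_pos.2 (by positivity)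
  have hR2 : R ^ 2 = 2 * n := Real.sq_sqrt (by positivity)
  -- This is where a + b ≥ 51200 enters: 16 n/(a+b) ≤ 2n/6400.
  have hSR : ((highDegree ω (20 * d)).card : ℝ) ≤ (R / 80) ^ 2 := by
    rw [div_pow, hR2]
    refine hS.trans ?_
    rw [div_le_div_iff₀ hD0 (by norm_num)]
    nlinarith
  have hmean := meanForm_prune_le hn hb hab hSD (by positivity) hSR hvsq hsum0
  set w := ∑ i, blockSign i * v₂ i with hw
  -- The lower and the upper bound for the form at v₂ leave a loss of 22 + 2κ, at most (a-b)/160 by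
  -- assumption. Then |w| + R/80 ≥ (79/80) R, as 79/80 exceeds its own square.
  have hmain : R ^ 2 * (79 / 80) ≤ (|w| + R / 80) ^ 2 := by
    have h2 : (a - b) * (79 / 80) / 2 ≤ (a - b) / (4 * n) * (|w| + R / 80) ^ 2 := by linarith
    have h3 : (a - b) / (4 * n) * (R ^ 2 * (79 / 80)) = (a - b) * (79 / 80) / 2 := by
      rw [hR2]; field_simp; norm_num
    rw [← h3] at h2
    exact le_of_mul_le_mul_left h2 (by positivity)
  have hwR : R * (39 / 40) ≤ |w| := by
    by_contra hcon
    push Not at hcon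
    have h1 : |w| + R / 80 < R * (79 / 80) := by linarith
    have h2 : (|w| + R / 80) ^ 2 < (R * (79 / 80)) ^ 2 :=
      pow_lt_pow_left₀ h1 (by positivity) two_ne_zero
    nlinarith
  rcases le_total 0 w with h | h
  · left
    rw [abs_of_nonneg h] at hwR
    exact isCorrectLabelled_of_correlated hn hP1 hP2 hvsq hwR hord
  · right
    rw [abs_of_nonpos h] at hwR
    refine isCorrectLabelled_of_correlated hn (v := fun i => -v₂ i) ?_ ?_ ?_ ?_ ?_
    · simp only [Prod.fst_swap, hP2, Finset.card_compl, hP1, Fintype.card_sum, Fintype.card_fin]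
      omega
    · simp [hP2]
    · simpa using hvsq
    · simp only [mul_neg, Finset.sum_neg_distrib]
      exact hwR
    · intro i hi j hj
      exact neg_le_neg (hord j hj i hi)

/-! ### Tails and anticoncentration of sums of coins -/

section SetTails

variable {E : Type} [Fintype E] [DecidableEq E] {q : E → ℝ}

lemma exp_sub_one_le {x : ℝ} (hx : |x| ≤ 1) : Real.exp x - 1 ≤ x + x ^ 2 := by
  have := (le_abs_self _).trans (Real.abs_exp_sub_one_sub_id_le hx)
  linarith

lemma coins_finset_tail (h0 : ∀ e, 0 ≤ q e) (h1 : ∀ e, q e ≤ 1) (A : Finset E) {θ : ℝ}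
    (hθ : |θ| ≤ 1) {s : ℝ} :
    (coins q).real {ω | s ≤ θ * ∑ e ∈ A, bit (ω e)}
      ≤ Real.exp ((θ + θ ^ 2) * ∑ e ∈ A, q e - s) := by
  have h := coins_tail h0 h1 (fun e => if e ∈ A then θ else 0) s
  have e1 : ∀ ω : E → Bool, ∑ e, (if e ∈ A then θ else 0) * bit (ω e)
      = θ * ∑ e ∈ A, bit (ω e) := by
    intro ω
    rw [Finset.mul_sum, ← sum_ite_mem_univ A]
    exact Finset.sum_congr rfl fun e _ => by split_ifs <;> simp
  refine (le_of_eq (congrArg _ (Set.ext fun ω => ?_))).trans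
    (h.trans (Real.exp_le_exp.2 (sub_le_sub_right ?_ _)))
  · rw [Set.mem_ofPred_eq, Set.mem_ofPred_eq, e1]
  · rw [Finset.mul_sum, ← sum_ite_mem_univ A]
    refine Finset.sum_le_sum fun e _ => ?_
    split_ifs
    · rw [mul_comm]; exact mul_le_mul_of_nonneg_right (exp_sub_one_le hθ) (h0 e)
    · simp

lemma coins_upper_tail (h0 : ∀ e, 0 ≤ q e) (h1 : ∀ e, q e ≤ 1) (A : Finset E) {θ m t : ℝ}
    (hθ0 : 0 ≤ θ) (hθ : θ ≤ 1) (hm : ∑ e ∈ A, q e ≤ m) :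
    (coins q).real {ω | t ≤ ∑ e ∈ A, bit (ω e)} ≤ Real.exp ((θ + θ ^ 2) * m - θ * t) := by
  refine (measureReal_mono (fun ω hω => ?_) (measure_ne_top _ _)).trans
    ((coins_finset_tail h0 h1 A (s := θ * t) (abs_le.2 ⟨by linarith, hθ⟩)).trans ?_)
  · exact mul_le_mul_of_nonneg_left hω hθ0
  · exact Real.exp_le_exp.2 (sub_le_sub_right (mul_le_mul_of_nonneg_left hm (by positivity)) _)

lemma coins_lower_tail (h0 : ∀ e, 0 ≤ q e) (h1 : ∀ e, q e ≤ 1) (A : Finset E) {θ m t : ℝ}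
    (hθ0 : 0 ≤ θ) (hθ : θ ≤ 1) (hm : m ≤ ∑ e ∈ A, q e) :
    (coins q).real {ω | ∑ e ∈ A, bit (ω e) ≤ t} ≤ Real.exp (θ * t - (θ - θ ^ 2) * m) := by
  refine (measureReal_mono (fun ω hω => ?_) (measure_ne_top _ _)).trans
    ((coins_finset_tail h0 h1 A (θ := -θ) (s := -θ * t) (by
      rw [abs_neg]; exact abs_le.2 ⟨by linarith, hθ⟩)).trans ?_)
  · rw [Set.mem_ofPred_eq] at hω ⊢
    nlinarith
  · refine Real.exp_le_exp.2 ?_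
    have : (θ - θ ^ 2) * m ≤ (θ - θ ^ 2) * ∑ e ∈ A, q e :=
      mul_le_mul_of_nonneg_left hm (by nlinarith)
    nlinarith

/-! ### Anticoncentration below the mean -/

/-- The centred sum of the coins of a set. -/
def centredSum (q : E → ℝ) (A : Finset E) (ω : E → Bool) : ℝ := ∑ e ∈ A, (bit (ω e) - q e)

lemma integral_bit_sub (h0 : ∀ e, 0 ≤ q e) (h1 : ∀ e, q e ≤ 1) (e : E) :
    ∫ ω, (bit (ω e) - q e) ∂coins q = 0 := by
  unfold coins
  rw [integral_comp_eval (μ := fun e => coin (q e)) (f := fun c => bit c - q e)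
    AEStronglyMeasurable.of_discrete, integral_coin (h0 e) (h1 e)]
  simp only [bit_true, bit_false]
  ring

lemma integral_centredSum (h0 : ∀ e, 0 ≤ q e) (h1 : ∀ e, q e ≤ 1) (A : Finset E) :
    ∫ ω, centredSum q A ω ∂coins q = 0 := by
  unfold centredSum
  rw [integral_finsetSum _ fun _ _ => integrable_coins _]
  exact Finset.sum_eq_zero fun e _ => integral_bit_sub h0 h1 e

lemma integral_centredSum_sq (h0 : ∀ e, 0 ≤ q e) (h1 : ∀ e, q e ≤ 1) (A : Finset E) :
    ∫ ω, centredSum q A ω ^ 2 ∂coins q = ∑ e ∈ A, q e * (1 - q e) := by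
  set X : E → Bool → ℝ := fun e c => if e ∈ A then bit c - q e else 0 with hX
  have hmean : ∀ e, ∫ c, X e c ∂coin (q e) = 0 := by
    intro e
    rw [integral_coin (h0 e) (h1 e)]
    simp only [hX, bit_true, bit_false]
    split_ifs <;> ring
  have h := ProbabilityTheory.variance_sum_pi (μ := fun e => coin (q e)) (X := X)
    fun _ => MemLp.of_discrete
  have e1 : (∑ e, fun ω : E → Bool => X e (ω e)) = centredSum q A := by
    funext ω
    rw [Finset.sum_apply, centredSum, ← sum_ite_mem_univ A]
  rw [e1, show (Measure.pi fun e => coin (q e)) = coins q from rfl,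
    ProbabilityTheory.variance_of_integral_eq_zero (integrable_coins _).aemeasurable
    (integral_centredSum h0 h1 A)] at h
  refine h.trans ?_
  rw [← sum_ite_mem_univ A]
  refine Finset.sum_congr rfl fun e _ => ?_
  rw [ProbabilityTheory.variance_of_integral_eq_zero AEMeasurable.of_discrete (hmean e),
    integral_coin (h0 e) (h1 e)]
  simp only [hX, bit_true, bit_false]
  split_ifs <;> ring

lemma pow_four_le (y : ℝ) : y ^ 4 ≤ 24 * (Real.exp y + Real.exp (-y)) := by
  have h := Real.pow_div_factorial_le_exp |y| (abs_nonneg y) 4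
  have h2 : |y| ^ 4 = y ^ 4 := (even_iff_two_dvd.2 (by norm_num)).pow_abs y
  rw [h2] at h
  norm_num [Nat.factorial] at h
  rcases abs_cases y with ⟨h3, _⟩ | ⟨h3, _⟩ <;> rw [h3] at h <;>
    linarith [Real.exp_pos y, Real.exp_pos (-y)]

lemma integral_exp_centredSum_le (h0 : ∀ e, 0 ≤ q e) (h1 : ∀ e, q e ≤ 1) (A : Finset E) {θ : ℝ}
    (hθ : |θ| ≤ 1) :
    ∫ ω, Real.exp (θ * centredSum q A ω) ∂coins q ≤ Real.exp (θ ^ 2 * ∑ e ∈ A, q e) := by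
  have h := integral_exp_coins h0 h1 (fun e => if e ∈ A then θ else 0)
  have e1 : ∀ ω : E → Bool, θ * centredSum q A ω
      = ∑ e, (if e ∈ A then θ else 0) * (bit (ω e) - q e) := by
    intro ω
    rw [centredSum, Finset.mul_sum, ← sum_ite_mem_univ A]
    exact Finset.sum_congr rfl fun e _ => by split_ifs <;> simp
  simp_rw [e1]
  refine h.trans (Real.exp_le_exp.2 ?_)
  rw [Finset.mul_sum, ← sum_ite_mem_univ A]
  refine Finset.sum_le_sum fun e _ => ?_
  split_ifs
  · rw [mul_comm]
    refine mul_le_mul_of_nonneg_right ?_ (h0 e)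
    have := exp_sub_one_le hθ
    linarith
  · simp

/-- At the scale 1/√m both exponential moments are at most e, and y⁴ ≤ 4!(exp y + exp(-y)) converts
them into a fourth moment. -/
lemma integral_centredSum_pow_four_le (h0 : ∀ e, 0 ≤ q e) (h1 : ∀ e, q e ≤ 1) (A : Finset E)
    (hm : 1 ≤ ∑ e ∈ A, q e) :
    ∫ ω, centredSum q A ω ^ 4 ∂coins q ≤ 144 * (∑ e ∈ A, q e) ^ 2 := by
  set m := ∑ e ∈ A, q e with hmd
  set r := √m with hr
  have hr2 : r ^ 2 = m := Real.sq_sqrt (by linarith)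
  have hr1 : 1 ≤ r := by rw [hr, Real.one_le_sqrt]; exact hm
  have hθ : |r⁻¹| ≤ 1 := by
    rw [abs_of_pos (by positivity)]; exact inv_le_one_of_one_le₀ hr1
  have hθ' : |-r⁻¹| ≤ 1 := by rw [abs_neg]; exact hθ
  have i1 := integral_exp_centredSum_le h0 h1 A hθ
  have i2 := integral_exp_centredSum_le h0 h1 A hθ'
  have e2 : r⁻¹ ^ 2 * m = 1 := by rw [← hr2]; field_simp
  rw [← hmd, e2] at i1
  rw [← hmd, neg_sq, e2] at i2
  have h2 : ∫ ω, centredSum q A ω ^ 4 ∂coins q ≤ ∫ ω, 24 * m ^ 2 *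
      (Real.exp (r⁻¹ * centredSum q A ω) + Real.exp (-r⁻¹ * centredSum q A ω)) ∂coins q := by
    refine integral_mono (integrable_coins _) (integrable_coins _) fun ω => ?_
    have h3 := pow_four_le (r⁻¹ * centredSum q A ω)
    have e3 : centredSum q A ω ^ 4 = m ^ 2 * (r⁻¹ * centredSum q A ω) ^ 4 := by
      rw [← hr2]; field_simp
    simp only
    rw [e3, neg_mul]
    nlinarith [sq_nonneg m]
  refine h2.trans ?_
  rw [integral_const_mul, integral_add (integrable_coins _) (integrable_coins _)]
  have h3 : Real.exp 1 ≤ 3 := by linarith [Real.exp_one_lt_d9]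
  nlinarith [sq_nonneg m]

/-- The negative part is (|y| - y)/2, and |y| is bounded below by a combination of y² and y⁴. For a
centred variable, a large second and a bounded fourth moment thus force a large mean negative part.
-/
lemma negative_part_bound {s : ℝ} (hs : 0 < s) (y : ℝ) :
    (y ^ 2 / s - y ^ 4 / (4 * s ^ 3) - y) / 2 ≤ max (-y) 0 := by
  have h : y ^ 2 / s - y ^ 4 / (4 * s ^ 3) ≤ |y| := by
    set u := |y| / s with hu
    have hu0 : 0 ≤ u := by positivity
    have e1 : y ^ 2 / s = s * u ^ 2 := by rw [hu, div_pow, sq_abs]; field_simp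
    have e2 : y ^ 4 / (4 * s ^ 3) = s * u ^ 4 / 4 := by
      have : |y| ^ 4 = y ^ 4 := (even_iff_two_dvd.2 (by norm_num)).pow_abs y
      rw [hu, div_pow, this]; field_simp
    have e3 : |y| = s * u := by rw [hu]; field_simp
    rw [e1, e2, e3]
    have h4 : 0 ≤ u * (1 - u + u ^ 3 / 4) := by
      refine mul_nonneg hu0 ?_
      nlinarith [mul_nonneg hu0 (sq_nonneg (u - 6 / 5)), sq_nonneg (u - 6 / 5)]
    nlinarith
  rcases abs_cases y with ⟨h3, h4⟩ | ⟨h3, h4⟩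
  · rw [max_eq_right (by linarith)]; linarith
  · rw [max_eq_left (by linarith)]; linarith

/-- A sum of independent coins is below its mean with at least a constant probability. -/
lemma coins_anticoncentration (h0 : ∀ e, 0 ≤ q e) (h1 : ∀ e, q e ≤ 1 / 2) (A : Finset E)
    {δ : ℝ} (hδ : 0 ≤ δ) (hm : 1 ≤ ∑ e ∈ A, q e) (hmδ : (768 * δ) ^ 2 ≤ ∑ e ∈ A, q e) :
    1 / 14400 ≤ (coins q).real {ω | ∑ e ∈ A, bit (ω e) < ∑ e ∈ A, q e - δ} := by
  have h1' : ∀ e, q e ≤ 1 := fun e => (h1 e).trans (by norm_num)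
  set m := ∑ e ∈ A, q e with hmd
  set r := √m with hr
  have hr2 : r ^ 2 = m := Real.sq_sqrt (by linarith)
  have hr1 : 1 ≤ r := by rw [hr, Real.one_le_sqrt]; exact hm
  have hδr : 768 * δ ≤ r := (Real.le_sqrt (by positivity) (by linarith)).2 hmδ
  set B : Set (E → Bool) := {ω | ∑ e ∈ A, bit (ω e) < m - δ} with hB
  -- The negative part has mean of order r, but it is unbounded; subtracting a small multiple of
  -- y²/r caps it at 96 r, by completing a square. Values below δ cost only δ.
  have hpoint : ∀ ω, (centredSum q A ω ^ 2 / (12 * r)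
        - centredSum q A ω ^ 4 / (4 * (12 * r) ^ 3) - centredSum q A ω) / 2 - δ
        - centredSum q A ω ^ 2 / (2 * (192 * r)) ≤ B.indicator (fun _ => 96 * r) ω := by
    intro ω
    set y := centredSum q A ω with hy
    have h2 := negative_part_bound (s := 12 * r) (by positivity) y
    have h3 : 0 ≤ y ^ 2 / (2 * (192 * r)) := by positivity
    have hmem : ω ∈ B ↔ y < -δ := by
      rw [hy, centredSum, Finset.sum_sub_distrib, ← hmd]
      simp only [hB, Set.mem_ofPred_eq]
      constructor <;> intro h <;> linarith
    by_cases hω : ω ∈ B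
    · rw [Set.indicator_of_mem hω]
      have hyneg := hmem.1 hω
      rw [max_eq_left (by linarith)] at h2
      have h4 : -y - y ^ 2 / (2 * (192 * r)) ≤ 96 * r := by
        have e : 96 * r - (-y - y ^ 2 / (2 * (192 * r)))
            = (y + 192 * r) ^ 2 / (2 * (192 * r)) := by field_simp; ring
        have : 0 ≤ (y + 192 * r) ^ 2 / (2 * (192 * r)) := by positivity
        linarith
      linarith
    · rw [Set.indicator_of_notMem hω]
      rw [hmem, not_lt] at hω
      have h4 : max (-y) 0 ≤ δ := max_le (by linarith) hδ
      linarith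
  have hint := integral_mono (μ := coins q) (integrable_coins _) (integrable_coins _) hpoint
  rw [integral_indicator_const _ (Set.toFinite _).measurableSet] at hint
  have hsq := integral_centredSum_sq h0 h1' A
  have h4 := integral_centredSum_pow_four_le h0 h1' A hm
  rw [← hmd] at h4
  have hvar : m / 2 ≤ ∑ e ∈ A, q e * (1 - q e) := by
    rw [hmd, Finset.sum_div]
    exact Finset.sum_le_sum fun e _ => by nlinarith [h0 e, h1 e]
  have e1 : ∫ ω, ((centredSum q A ω ^ 2 / (12 * r)
        - centredSum q A ω ^ 4 / (4 * (12 * r) ^ 3) - centredSum q A ω) / 2 - δ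
        - centredSum q A ω ^ 2 / (2 * (192 * r))) ∂coins q
      = ((∫ ω, centredSum q A ω ^ 2 ∂coins q) / (12 * r)
        - (∫ ω, centredSum q A ω ^ 4 ∂coins q) / (4 * (12 * r) ^ 3)) / 2 - δ
        - (∫ ω, centredSum q A ω ^ 2 ∂coins q) / (2 * (192 * r)) := by
    rw [integral_sub (integrable_coins _) (integrable_coins _),
      integral_sub (integrable_coins _) (integrable_coins _), integral_div,
      integral_sub (integrable_coins _) (integrable_coins _),
      integral_sub (integrable_coins _) (integrable_coins _), integral_div, integral_div,
      integral_div, integral_centredSum h0 h1']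
    simp
  rw [e1, hsq] at hint
  set σ := ∑ e ∈ A, q e * (1 - q e) with hσ
  set F := ∫ ω, centredSum q A ω ^ 4 ∂coins q with hF
  have hF' : F / (4 * (12 * r) ^ 3) ≤ r / 48 := by
    rw [div_le_iff₀ (by positivity)]
    refine h4.trans (le_of_eq ?_)
    rw [← hr2]; ring
  have hσ' : r * (15 / 768) ≤ σ / (12 * r) / 2 - σ / (2 * (192 * r)) := by
    have e2 : σ / (12 * r) / 2 - σ / (2 * (192 * r)) = σ * (15 / (384 * r)) := by
      field_simp; ring
    rw [e2, ← hr2] at *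
    calc r * (15 / 768) = r ^ 2 / 2 * (15 / (384 * r)) := by field_simp; norm_num
      _ ≤ σ * (15 / (384 * r)) := by gcongr
  rw [smul_eq_mul] at hint
  -- In units of r/768: 15 from the variance, less 8 from the fourth moment and 1 from δ.
  have hfin : r * (6 / 768) ≤ (coins q).real B * (96 * r) := by linarith
  have : 6 / 768 ≤ (coins q).real B * 96 := by
    by_contra hc
    push Not at hc
    nlinarith
  linarith

end SetTails

/-! ### Concentration of sums of functions of the stars of a graph -/

section Independence

variable {E : Type} [Fintype E] [DecidableEq E] {q : E → ℝ}

/-- Functions of disjoint sets of coins are uncorrelated. -/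
lemma integral_mul_of_disjoint {A B : Finset E} (hAB : Disjoint A B) {F G : (E → Bool) → ℝ}
    (hF : ∀ ω ω', (∀ e ∈ A, ω e = ω' e) → F ω = F ω')
    (hG : ∀ ω ω', (∀ e ∈ B, ω e = ω' e) → G ω = G ω') :
    ∫ ω, F ω * G ω ∂coins q = (∫ ω, F ω ∂coins q) * ∫ ω, G ω ∂coins q := by
  have hind : ProbabilityTheory.iIndepFun (fun (e : E) (ω : E → Bool) => ω e) (coins q) :=
    ProbabilityTheory.iIndepFun_pi (μ := fun e => coin (q e)) (X := fun _ c => c)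
      fun _ => aemeasurable_id
  have h2 := hind.indepFun_finset A B hAB fun e => measurable_pi_apply e
  set φ : (A → Bool) → ℝ := fun x => F fun e => if h : e ∈ A then x ⟨e, h⟩ else false with hφ
  set ψ : (B → Bool) → ℝ := fun x => G fun e => if h : e ∈ B then x ⟨e, h⟩ else false with hψ
  have h3 := h2.comp (φ := φ) (ψ := ψ) (Measurable.of_discrete) (Measurable.of_discrete)
  have e1 : φ ∘ (fun (ω : E → Bool) (i : A) => ω i) = F := by
    funext ω
    exact hF _ _ fun e he => by simp [he]
  have e2 : ψ ∘ (fun (ω : E → Bool) (i : B) => ω i) = G := by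
    funext ω
    exact hG _ _ fun e he => by simp [he]
  rw [e1, e2] at h3
  exact h3.integral_fun_mul_eq_mul_integral (integrable_coins _).aestronglyMeasurable
    (integrable_coins _).aestronglyMeasurable

end Independence

section Star

variable {V : Type} [Fintype V] [DecidableEq V] {q : Sym2 V → ℝ}

/-- The function only depends on the pairs that contain `u`. -/
def DependsOnStar (u : V) (F : (Sym2 V → Bool) → ℝ) : Prop :=
  ∀ ω ω', (∀ w, ω s(u, w) = ω' s(u, w)) → F ω = F ω'

lemma measure_coin_true (h0 : ∀ e, 0 ≤ q e) (h1 : ∀ e, q e ≤ 1) (e : Sym2 V) :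
    ∫ ω, bit (ω e) ∂coins q = q e := by
  have h := integral_bit_sub h0 h1 e
  rw [integral_sub (integrable_coins _) (integrable_coins _)] at h
  simp only [integral_const, probReal_univ, one_smul] at h
  linarith

lemma integral_mem_Icc {F : (Sym2 V → Bool) → ℝ} (h0 : ∀ ω, 0 ≤ F ω) (h1 : ∀ ω, F ω ≤ 1) :
    0 ≤ ∫ ω, F ω ∂coins q ∧ ∫ ω, F ω ∂coins q ≤ 1 := by
  refine ⟨integral_nonneg h0, ?_⟩
  have := integral_mono (μ := coins q) (integrable_coins F) (integrable_coins fun _ => (1 : ℝ)) h1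
  simpa using this

/-- The stars of u and v share only the pair {u, v}. Fixing that coin to `false` makes F and G
independent and shifts each of the three expectations by at most its probability. -/
lemma covariance_star_le (h0 : ∀ e, 0 ≤ q e) (h1 : ∀ e, q e ≤ 1) {u v : V} (huv : u ≠ v)
    {F G : (Sym2 V → Bool) → ℝ} (hF : DependsOnStar u F) (hG : DependsOnStar v G)
    (hF0 : ∀ ω, 0 ≤ F ω) (hF1 : ∀ ω, F ω ≤ 1) (hG0 : ∀ ω, 0 ≤ G ω) (hG1 : ∀ ω, G ω ≤ 1) :
    ∫ ω, F ω * G ω ∂coins q - (∫ ω, F ω ∂coins q) * ∫ ω, G ω ∂coins q ≤ 3 * q s(u, v) := by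
  set cut : (Sym2 V → Bool) → Sym2 V → Bool := fun ω => Function.update ω s(u, v) false with hcut
  have hcutid : ∀ ω : Sym2 V → Bool, ω s(u, v) = false → cut ω = ω := by
    intro ω h; rw [hcut]; simp only; rw [← h]; exact Function.update_eq_self _ _
  set F' := fun ω => F (cut ω) with hF'
  set G' := fun ω => G (cut ω) with hG'
  have key : ∀ H : (Sym2 V → Bool) → ℝ, (∀ ω, 0 ≤ H ω) → (∀ ω, H ω ≤ 1) →
      ∀ ω, H ω ≤ H (cut ω) + bit (ω s(u, v)) ∧ H (cut ω) ≤ H ω + bit (ω s(u, v)) := by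
    intro H hH0 hH1 ω
    cases h : ω s(u, v)
    · rw [hcutid ω h]; simp
    · simp only [bit_true]
      constructor <;> linarith [hH0 ω, hH1 ω, hH0 (cut ω), hH1 (cut ω)]
  have hb := measure_coin_true h0 h1 s(u, v)
  have hle : ∀ H : (Sym2 V → Bool) → ℝ, (∀ ω, 0 ≤ H ω) → (∀ ω, H ω ≤ 1) →
      ∫ ω, H ω ∂coins q ≤ ∫ ω, H (cut ω) ∂coins q + q s(u, v) ∧
        ∫ ω, H (cut ω) ∂coins q ≤ ∫ ω, H ω ∂coins q + q s(u, v) := by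
    intro H hH0 hH1
    rw [← hb, ← integral_add (integrable_coins _) (integrable_coins _),
      ← integral_add (integrable_coins _) (integrable_coins _)]
    exact ⟨integral_mono (integrable_coins _) (integrable_coins _) fun ω => (key H hH0 hH1 ω).1,
      integral_mono (integrable_coins _) (integrable_coins _) fun ω => (key H hH0 hH1 ω).2⟩
  set A : V → Finset (Sym2 V) := fun x =>
    (Finset.univ.filter fun e => x ∈ e ∧ e ≠ s(u, v)) with hA
  have hdep : ∀ x H, DependsOnStar x H →
      ∀ ω ω' : Sym2 V → Bool, (∀ e ∈ A x, ω e = ω' e) → H (cut ω) = H (cut ω') := by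
    intro x H hH ω ω' h
    refine hH _ _ fun w => ?_
    by_cases he : s(x, w) = s(u, v)
    · simp [hcut, he]
    · simp only [hcut, Function.update_of_ne he]
      exact h _ (by simp only [hA, Finset.mem_filter, Finset.mem_univ, true_and]
                    exact ⟨Sym2.mem_mk_left _ _, he⟩)
  have hdisj : Disjoint (A u) (A v) := by
    rw [Finset.disjoint_left]
    intro e hu hv
    simp only [hA, Finset.mem_filter, Finset.mem_univ, true_and] at hu hv
    exact hu.2 ((Sym2.mem_and_mem_iff huv).1 ⟨hu.1, hv.1⟩)
  have hprod := integral_mul_of_disjoint (q := q) hdisj (hdep u F hF) (hdep v G hG)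
  have hFG := (hle (fun ω => F ω * G ω) (fun ω => mul_nonneg (hF0 ω) (hG0 ω))
    (fun ω => mul_le_one₀ (hF1 ω) (hG0 ω) (hG1 ω))).1
  have hFle := (hle F hF0 hF1).2
  have hGle := (hle G hG0 hG1).2
  obtain ⟨f0, f1⟩ := integral_mem_Icc (q := q) hF0 hF1
  obtain ⟨g0, g1⟩ := integral_mem_Icc (q := q) hG0 hG1
  obtain ⟨f0', f1'⟩ := integral_mem_Icc (q := q) (F := fun ω => F (cut ω))
    (fun ω => hF0 _) (fun ω => hF1 _)
  obtain ⟨g0', g1'⟩ := integral_mem_Icc (q := q) (F := fun ω => G (cut ω))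
    (fun ω => hG0 _) (fun ω => hG1 _)
  rw [hprod] at hFG
  have hq := h0 s(u, v)
  nlinarith

/-- Chebyshev's inequality: the diagonal of the covariance matrix contributes at most |U|, the rest
at most 3η|U|². With η = a/n the variance is only linear in n. -/
lemma star_concentration (h0 : ∀ e, 0 ≤ q e) (h1 : ∀ e, q e ≤ 1) {η : ℝ} (hη : ∀ e, q e ≤ η)
    (U : Finset V) {F : V → (Sym2 V → Bool) → ℝ} (hF : ∀ u ∈ U, DependsOnStar u (F u))
    (hF0 : ∀ u ω, 0 ≤ F u ω) (hF1 : ∀ u ω, F u ω ≤ 1) {s : ℝ} (hs : 0 < s) :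
    (coins q).real {ω | s ≤ |∑ u ∈ U, F u ω - ∑ u ∈ U, ∫ ω, F u ω ∂coins q|}
      ≤ (U.card + U.card ^ 2 * (3 * η)) / s ^ 2 := by
  have hmem : ∀ G : (Sym2 V → Bool) → ℝ, MemLp G 2 (coins q) := fun _ => MemLp.of_discrete
  have h := ProbabilityTheory.meas_ge_le_variance_div_sq (μ := coins q)
    (hmem fun ω => ∑ u ∈ U, F u ω) hs
  rw [integral_finsetSum _ fun _ _ => integrable_coins _] at h
  have hvar : ProbabilityTheory.variance (fun ω => ∑ u ∈ U, F u ω) (coins q)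
      ≤ U.card + U.card ^ 2 * (3 * η) := by
    rw [ProbabilityTheory.variance_fun_sum' fun u _ => hmem _]
    have hcov : ∀ u ∈ U, ∀ v ∈ U, ProbabilityTheory.covariance (F u) (F v) (coins q)
        ≤ (if u = v then 1 else 0) + 3 * η := by
      intro u hu v hv
      rw [ProbabilityTheory.covariance_eq_sub (hmem _) (hmem _)]
      have hη0 : 0 ≤ η := (h0 s(u, v)).trans (hη _)
      split_ifs with huv
      · obtain ⟨f0, f1⟩ := integral_mem_Icc (q := q) (hF0 u) (hF1 u)
        obtain ⟨g0, g1⟩ := integral_mem_Icc (q := q) (hF0 v) (hF1 v)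
        have := (integral_mem_Icc (q := q) (F := F u * F v)
          (fun ω => mul_nonneg (hF0 u ω) (hF0 v ω))
          (fun ω => mul_le_one₀ (hF1 u ω) (hF0 v ω) (hF1 v ω))).2
        nlinarith [mul_nonneg f0 g0]
      · have := covariance_star_le h0 h1 huv (hF u hu) (hF v hv) (hF0 u) (hF1 u) (hF0 v) (hF1 v)
        have h3 := hη s(u, v)
        simp only [Pi.mul_apply]
        linarith
    refine (Finset.sum_le_sum fun u hu => Finset.sum_le_sum fun v hv => hcov u hu v hv).trans ?_
    simp only [Finset.sum_add_distrib, Finset.sum_ite_eq, Finset.sum_const, nsmul_eq_mul,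
      Finset.sum_ite_mem, Finset.inter_self, mul_one]
    apply le_of_eq; ring
  rw [measureReal_def]
  refine (ENNReal.toReal_mono ENNReal.ofReal_ne_top h).trans ?_
  rw [ENNReal.toReal_ofReal (div_nonneg (ProbabilityTheory.variance_nonneg _ _) (sq_nonneg _))]
  exact div_le_div_of_nonneg_right hvar (sq_nonneg _)

end Star

/-! ### The blue neighbours of a vertex -/

section BlueStar

variable {V : Type} [Fintype V] [DecidableEq V]

/-- The blue pairs, given the red pairs `ρ` and fresh coins `ζ`. -/
def blueOf (ρ ζ : Sym2 V → Bool) (e : Sym2 V) : Bool := ζ e && !ρ e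

/-- The pairs of distinct vertices formed by `u` and a vertex of `S`. -/
def star (u : V) (S : Finset V) : Finset (Sym2 V) := (S.erase u).image fun w => s(u, w)

lemma sum_star (u : V) (S : Finset V) (f : Sym2 V → ℝ) :
    ∑ e ∈ star u S, f e = ∑ w ∈ S.erase u, f s(u, w) := by
  refine Finset.sum_image fun w _ w' _ h => ?_
  rcases (by simpa using h : w = w' ∨ u = w' ∧ w = u) with h | ⟨h1, h2⟩
  · exact h
  · exact h2.trans h1

/-- The pairs formed by `u` and `S` that are not red. -/
def blueStar (ρ : Sym2 V → Bool) (u : V) (S : Finset V) : Finset (Sym2 V) :=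
  (star u S).filter fun e => ρ e = false

lemma sum_blueStar (ρ : Sym2 V → Bool) (u : V) (S : Finset V) (f : Sym2 V → ℝ) :
    ∑ e ∈ blueStar ρ u S, f e
      = ∑ w ∈ S.erase u, if ρ s(u, w) = false then f s(u, w) else 0 := by
  rw [blueStar, Finset.sum_filter, sum_star]

lemma nbrCount_blueOf (ρ ζ : Sym2 V → Bool) (u : V) (S : Finset V) :
    (nbrCount (graphOf (blueOf ρ ζ)) u S : ℝ) = ∑ e ∈ blueStar ρ u S, bit (ζ e) := by
  classical
  rw [sum_blueStar, nbrCount, Finset.card_eq_sum_ones, Nat.cast_sum]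
  have h : S.filter (fun w => (graphOf (blueOf ρ ζ)).Adj u w)
      = (S.erase u).filter fun w => blueOf ρ ζ s(u, w) = true := by
    ext w
    simp only [Finset.mem_filter, graphOf_adj, Finset.mem_erase]
    constructor
    · rintro ⟨h1, h2, h3⟩; exact ⟨⟨h3.symm, h1⟩, h2⟩
    · rintro ⟨⟨h1, h2⟩, h3⟩; exact ⟨h2, h3, h1.symm⟩
  rw [Finset.sum_congr (by convert h) fun _ _ => rfl, Finset.sum_filter]
  refine Finset.sum_congr rfl fun w _ => ?_
  unfold blueOf
  cases ζ s(u, w) <;> cases ρ s(u, w) <;> simp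

lemma dependsOnStar_indicator {u : V} {A : Finset (Sym2 V)} (hA : ∀ e ∈ A, u ∈ e)
    (p : ℝ → Prop) :
    DependsOnStar u ({ω : Sym2 V → Bool | p (∑ e ∈ A, bit (ω e))}.indicator fun _ => 1) := by
  intro ω ω' h
  have h1 : ∑ e ∈ A, bit (ω e) = ∑ e ∈ A, bit (ω' e) := by
    refine Finset.sum_congr rfl fun e he => ?_
    obtain ⟨w, rfl⟩ := hA e he
    rw [h w]
  classical
  simp only [Set.indicator_apply, Set.mem_ofPred_eq, h1]

lemma mem_of_mem_star {u : V} {S : Finset V} {e : Sym2 V} (h : e ∈ star u S) : u ∈ e := by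
  obtain ⟨w, _, rfl⟩ := Finset.mem_image.1 h
  exact Sym2.mem_mk_left _ _

lemma mem_of_mem_blueStar {ρ : Sym2 V → Bool} {u : V} {S : Finset V} {e : Sym2 V}
    (h : e ∈ blueStar ρ u S) : u ∈ e :=
  mem_of_mem_star (Finset.mem_filter.1 h).1

end BlueStar

/-! ### The probabilities of the blue edges -/

/-- The conditional probability that a pair is a blue edge, given that it is not a red edge. -/
def blueProb (a b : ℝ) (n : ℕ) (e : Sym2 (Vtx n)) : ℝ :=
  edgeProb a b n e / 2 / (1 - edgeProb a b n e / 2)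

section BlueProb

variable {a b : ℝ} {n : ℕ}

lemma edgeProb_bounds (hn : 0 < n) (hb : 0 < b) (hab : b < a) (e : Sym2 (Vtx n)) :
    0 ≤ edgeProb a b n e ∧ edgeProb a b n e ≤ a / n := by
  have hn0 : (0 : ℝ) < n := by exact_mod_cast hn
  induction e with
  | _ i j =>
    have h : edgeProb a b n s(i, j) = if i.isLeft = j.isLeft then a / n else b / n := rfl
    rw [h]
    have ha : 0 < a := hb.trans hab
    split_ifs
    · exact ⟨by positivity, le_rfl⟩
    · exact ⟨by positivity, div_le_div_of_nonneg_right hab.le hn0.le⟩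

lemma blueProb_bounds (hn : 0 < n) (hb : 0 < b) (hab : b < a) (han : 4 * a ≤ n)
    (e : Sym2 (Vtx n)) :
    edgeProb a b n e / 2 ≤ blueProb a b n e ∧
      blueProb a b n e ≤ edgeProb a b n e / 2 * (1 + a / n) ∧ 0 ≤ blueProb a b n e ∧
      blueProb a b n e ≤ a / n ∧ blueProb a b n e ≤ 1 / 2 := by
  have hn0 : (0 : ℝ) < n := by exact_mod_cast hn
  obtain ⟨h0, h1⟩ := edgeProb_bounds hn hb hab e
  have h2 : a / n ≤ 1 / 4 := by rw [div_le_iff₀ hn0]; linarith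
  unfold blueProb
  set p := edgeProb a b n e
  have hd : 0 < 1 - p / 2 := by linarith
  have hz : p / 2 / (1 - p / 2) ≤ p / 2 * (1 + a / n) := by
    rw [div_le_iff₀ hd]
    have : 1 ≤ (1 + a / n) * (1 - p / 2) := by nlinarith
    nlinarith
  have hz2 : p / 2 * (1 + a / n) ≤ a / n := by nlinarith
  refine ⟨?_, hz, by positivity, hz.trans hz2, by linarith⟩
  rw [le_div_iff₀ hd]
  nlinarith

end BlueProb

/-! ### One block and a nearly matching part -/

section Side

variable {a b : ℝ} {n : ℕ} {U Q₁ Q₂ : Finset (Vtx n)}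

lemma edgeProb_of_mem (hU : U = block₁ n ∨ U = block₂ n) {u : Vtx n} (hu : u ∈ U) (w : Vtx n) :
    edgeProb a b n s(u, w) = if w ∈ U then a / n else b / n := by
  have h : edgeProb a b n s(u, w) = if u.isLeft = w.isLeft then a / n else b / n := rfl
  rw [h]
  rcases hU with rfl | rfl
  · rw [mem_block₁] at hu
    simp only [mem_block₁, hu, eq_comm]
  · rw [mem_block₂] at hu
    simp only [mem_block₂, hu, eq_comm]

lemma card_block (hU : U = block₁ n ∨ U = block₂ n) : U.card = n := by
  rcases hU with rfl | rfl
  exacts [card_block₁ n, card_block₂ n]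

lemma sum_edgeProb (hU : U = block₁ n ∨ U = block₂ n) {u : Vtx n} (hu : u ∈ U)
    (S : Finset (Vtx n)) :
    ∑ w ∈ S, edgeProb a b n s(u, w) = (S ∩ U).card * (a / n) + (S \ U).card * (b / n) := by
  simp_rw [edgeProb_of_mem hU hu]
  rw [Finset.sum_ite, Finset.sum_const, Finset.sum_const, nsmul_eq_mul, nsmul_eq_mul,
    Finset.filter_mem_eq_inter, Finset.filter_notMem_eq_sdiff]

lemma card_side (hU : U = block₁ n ∨ U = block₂ n) (h1 : Q₁.card = n) (h2 : Q₂ = Q₁ᶜ) :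
    (Q₁ ∩ U).card + (Q₂ ∩ U).card = n ∧ (Q₂ \ U).card = (Q₁ ∩ U).card ∧
      (Q₁ \ U).card = (Q₂ ∩ U).card := by
  have hUc := card_block hU
  have e1 := Finset.card_inter_add_card_sdiff U Q₁
  have e2 := Finset.card_inter_add_card_sdiff Q₁ U
  have e3 := Finset.card_inter_add_card_sdiff Q₂ U
  have hQ : Q₂.card = n := by
    rw [h2, Finset.card_compl, h1]; simp only [Fintype.card_sum, Fintype.card_fin]; omega
  rw [Finset.sdiff_eq_inter_compl, ← h2, Finset.inter_comm U Q₂, Finset.inter_comm U Q₁] at e1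
  omega

/-- The mean number of pairs marked `true` between a vertex of `U` and the other part. -/
lemma sum_blueProb_le (hn : 0 < n) (hb : 0 < b) (hab : b < a) (han : 4 * a ≤ n)
    (hU : U = block₁ n ∨ U = block₂ n) (h1 : Q₁.card = n) (h2 : Q₂ = Q₁ᶜ) {x : ℝ}
    (hk : ((Q₂ ∩ U).card : ℝ) ≤ x * n) {u : Vtx n} (hu : u ∈ U) :
    ∑ e ∈ star u Q₂, blueProb a b n e ≤ (1 + a / n) * ((b + x * (a - b)) / 2) := by
  have hn0 : (0 : ℝ) < n := by exact_mod_cast hn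
  have ha : 0 < a := hb.trans hab
  obtain ⟨c1, c2, c3⟩ := card_side hU h1 h2
  have hc : ((Q₁ ∩ U).card : ℝ) + (Q₂ ∩ U).card = n := by exact_mod_cast c1
  have h3 : ∑ e ∈ star u Q₂, blueProb a b n e
      ≤ (1 + a / n) / 2 * ∑ w ∈ Q₂, edgeProb a b n s(u, w) := by
    rw [sum_star, Finset.mul_sum]
    refine (Finset.sum_le_sum fun w _ =>
      (blueProb_bounds hn hb hab han s(u, w)).2.1).trans ?_
    refine (le_of_eq (Finset.sum_congr rfl fun w _ => by ring)).trans
      (Finset.sum_le_sum_of_subset_of_nonneg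
        (f := fun w => (1 + a / n) / 2 * edgeProb a b n s(u, w)) (Finset.erase_subset u Q₂) ?_)
    intro w _ _
    have := (edgeProb_bounds hn hb hab s(u, w)).1
    positivity
  refine h3.trans ?_
  rw [sum_edgeProb hU hu, c2]
  have h4 : ((Q₂ ∩ U).card : ℝ) * (a / n) + (Q₁ ∩ U).card * (b / n) ≤ b + x * (a - b) := by
    have e : ((Q₂ ∩ U).card : ℝ) * (a / n) + (Q₁ ∩ U).card * (b / n)
        = ((Q₁ ∩ U).card + (Q₂ ∩ U).card) / n * b + (Q₂ ∩ U).card / n * (a - b) := by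
      field_simp; ring
    rw [e, hc, div_self hn0.ne', one_mul]
    have : ((Q₂ ∩ U).card : ℝ) / n ≤ x := by rw [div_le_iff₀ hn0]; exact hk
    have := mul_le_mul_of_nonneg_right this (by linarith : 0 ≤ a - b)
    linarith
  calc _ ≤ (1 + a / n) / 2 * (b + x * (a - b)) := by gcongr
    _ = _ := by ring

lemma half_le_sum_blueProb (hn : 0 < n) (hb : 0 < b) (hab : b < a) (han : 4 * a ≤ n)
    (hU : U = block₁ n ∨ U = block₂ n) (h1 : Q₁.card = n) (h2 : Q₂ = Q₁ᶜ)
    {u : Vtx n} (hu : u ∈ U) (hu1 : u ∉ Q₂) :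
    (b + (Q₂ ∩ U).card / n * (a - b)) / 2 ≤ ∑ e ∈ star u Q₂, blueProb a b n e := by
  have hn0 : (0 : ℝ) < n := by exact_mod_cast hn
  obtain ⟨c1, c2, c3⟩ := card_side hU h1 h2
  have hc : ((Q₁ ∩ U).card : ℝ) + (Q₂ ∩ U).card = n := by exact_mod_cast c1
  rw [sum_star, Finset.erase_eq_of_notMem hu1]
  have h3 : (1 / 2) * ∑ w ∈ Q₂, edgeProb a b n s(u, w) ≤ ∑ w ∈ Q₂, blueProb a b n s(u, w) := by
    rw [Finset.mul_sum]
    refine Finset.sum_le_sum fun w _ => ?_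
    have := (blueProb_bounds hn hb hab han s(u, w)).1
    linarith
  refine le_trans (le_of_eq ?_) h3
  rw [sum_edgeProb hU hu, c2]
  have e : ((Q₂ ∩ U).card : ℝ) * (a / n) + (Q₁ ∩ U).card * (b / n)
      = ((Q₁ ∩ U).card + (Q₂ ∩ U).card) / n * b + (Q₂ ∩ U).card / n * (a - b) := by
    field_simp; ring
  rw [e, hc, div_self hn0.ne', one_mul]
  ring

/-- A red neighbour removes one possible blue pair, of probability at most a/n, so only a red degree
of order n can matter. -/
lemma sum_blueStar_ge (hn : 0 < n) (hb : 0 < b) (hab : b < a) (han : 4 * a ≤ n)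
    (ρ : Sym2 (Vtx n) → Bool) (u : Vtx n) (S : Finset (Vtx n)) {r : ℝ}
    (hr : ∑ j, adj ρ u j ≤ r) :
    ∑ e ∈ star u S, blueProb a b n e - r * (a / n) ≤ ∑ e ∈ blueStar ρ u S, blueProb a b n e := by
  have hn0 : (0 : ℝ) < n := by exact_mod_cast hn
  have ha : 0 < a := hb.trans hab
  have h1 : ∑ e ∈ star u S, blueProb a b n e - ∑ e ∈ blueStar ρ u S, blueProb a b n e
      ≤ ∑ j, adj ρ u j * (a / n) := by
    rw [sum_star, sum_blueStar, ← Finset.sum_sub_distrib]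
    refine (Finset.sum_le_sum (g := fun j => adj ρ u j * (a / n)) fun w hw => ?_).trans
      (Finset.sum_le_sum_of_subset_of_nonneg (Finset.subset_univ _) fun j _ _ =>
        mul_nonneg (adj_nonneg _ _ _) (by positivity))
    have hne : u ≠ w := (Finset.ne_of_mem_erase hw).symm
    have hz := (blueProb_bounds hn hb hab han s(u, w)).2.2.2.1
    rw [adj, if_pos hne]
    cases ρ s(u, w) <;> simp [hz]
  rw [← Finset.sum_mul] at h1
  have h2 : (∑ j, adj ρ u j) * (a / n) ≤ r * (a / n) :=
    mul_le_mul_of_nonneg_right hr (by positivity)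
  linarith

lemma integral_indicator_one_coins {E : Type} [Fintype E] {q : E → ℝ} (W : Set (E → Bool)) :
    ∫ ω, W.indicator (fun _ => (1 : ℝ)) ω ∂coins q = (coins q).real W := by
  rw [integral_indicator_const _ (Set.toFinite _).measurableSet, smul_eq_mul, mul_one]

lemma indicator_one_mem {α : Type} (W : Set α) (x : α) :
    0 ≤ W.indicator (fun _ => (1 : ℝ)) x ∧ W.indicator (fun _ => (1 : ℝ)) x ≤ 1 := by
  by_cases h : x ∈ W <;> simp [h]

lemma concentration_bound (hn : 0 < n) (hb : 0 < b) (hab : b < a) (han : 4 * a ≤ n)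
    {U' : Finset (Vtx n)} (hU' : U'.card ≤ n) {F : Vtx n → (Sym2 (Vtx n) → Bool) → ℝ}
    (hF : ∀ u ∈ U', DependsOnStar u (F u)) (hF0 : ∀ u ω, 0 ≤ F u ω) (hF1 : ∀ u ω, F u ω ≤ 1)
    {x : ℝ} (hx : 0 < x) :
    (coins (blueProb a b n)).real
        {ω | x * n ≤ |∑ u ∈ U', F u ω - ∑ u ∈ U', ∫ ω, F u ω ∂coins (blueProb a b n)|}
      ≤ (1 + 3 * a) / x ^ 2 / n := by
  have hn0 : (0 : ℝ) < n := by exact_mod_cast hn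
  have ha : 0 < a := hb.trans hab
  have hz := blueProb_bounds hn hb hab han
  refine (star_concentration (fun e => (hz e).2.2.1) (fun e => (hz e).2.2.2.2.trans (by norm_num))
    (fun e => (hz e).2.2.2.1) U' hF hF0 hF1 (by positivity)).trans ?_
  have hc : (U'.card : ℝ) ≤ n := by exact_mod_cast hU'
  calc ((U'.card : ℝ) + U'.card ^ 2 * (3 * (a / n))) / (x * n) ^ 2
      ≤ (n + n ^ 2 * (3 * (a / n))) / (x * n) ^ 2 := by gcongr
    _ = (1 + 3 * a) / x ^ 2 / n := by field_simp

/-- Correction keeps a positive fraction of the correctly placed vertices, whatever the balanced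
partition is. -/
lemma correction_keeps_fraction (hn : 0 < n) (hb : 25600 ≤ b) (hab : b < a) (han : 4 * a ≤ n)
    (han2 : 100 * (a * (a + b)) ≤ n) (hU : U = block₁ n ∨ U = block₂ n) (h1 : Q₁.card = n)
    (h2 : Q₂ = Q₁ᶜ) (hk : ((Q₂ ∩ U).card : ℝ) ≤ 1 / 2 * n) {γ : ℝ} (hγ : 1 - γ ≤ 1 / 57600)
    (ρ : Sym2 (Vtx n) → Bool) :
    (coins (blueProb a b n)).real {ζ | ¬ (1 - γ) * n ≤
        ((U ∩ (correction ((a + b) / 4) (graphOf (blueOf ρ ζ)) (Q₁, Q₂)).1).card : ℝ)}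
      ≤ (1 + 3 * a) / (1 / 57600) ^ 2 / n := by
  have hn0 : (0 : ℝ) < n := by exact_mod_cast hn
  have hb0 : 0 < b := by linarith
  have ha : 0 < a := hb0.trans hab
  set t := (a + b) / 4 with ht
  set W : Vtx n → Set (Sym2 (Vtx n) → Bool) := fun u =>
    {ω | ∑ e ∈ star u Q₂, bit (ω e) < t} with hW
  set F : Vtx n → (Sym2 (Vtx n) → Bool) → ℝ := fun u => (W u).indicator fun _ => 1 with hF
  obtain ⟨c1, c2, c3⟩ := card_side hU h1 h2
  have hc : ((Q₁ ∩ U).card : ℝ) + (Q₂ ∩ U).card = n := by exact_mod_cast c1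
  have hz := blueProb_bounds hn hb0 hab han
  have hmean : ∀ u ∈ Q₁ ∩ U, 1 / 14400 ≤ ∫ ω, F u ω ∂coins (blueProb a b n) := by
    intro u hu
    obtain ⟨hu1, huU⟩ := Finset.mem_inter.1 hu
    have hu2 : u ∉ Q₂ := by rw [h2]; simpa using hu1
    rw [hF, integral_indicator_one_coins]
    have hm := half_le_sum_blueProb hn hb0 hab han hU h1 h2 huU hu2
    have hm' := sum_blueProb_le hn hb0 hab han hU h1 h2 hk huU
    have h3 : 0 ≤ ((Q₂ ∩ U).card : ℝ) / n * (a - b) :=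
      mul_nonneg (by positivity) (by linarith)
    have h4 : 12800 ≤ ∑ e ∈ star u Q₂, blueProb a b n e := by linarith
    -- When half the block is misplaced, the mean is at most the threshold (a+b)/4 up to O(1/n),
    -- which δ = 1/100 absorbs. Counting red pairs too only raises the count, so the red graph is
    -- irrelevant here.
    refine (coins_anticoncentration (fun e => (hz e).2.2.1) (fun e => (hz e).2.2.2.2)
      (star u Q₂) (δ := 1 / 100) (by norm_num) (by linarith)
      (le_trans (by norm_num) h4)).trans (measureReal_mono (fun ω hω => ?_) (measure_ne_top _ _))
    rw [Set.mem_ofPred_eq] at hω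
    refine hω.trans_le ?_
    have h5 : a / n * (a + b) ≤ 1 / 100 := by
      rw [div_mul_eq_mul_div, div_le_iff₀ hn0]; linarith
    have h6 : (1 + a / n) * ((b + 1 / 2 * (a - b)) / 2) = t + a / n * (a + b) / 4 := by
      rw [ht]; ring
    have h7 : 0 ≤ a / n * (a + b) := by positivity
    linarith
  have hcard : (Q₁ ∩ U).card ≤ n := by omega
  refine (measureReal_mono (fun ζ hζ => ?_) (measure_ne_top _ _)).trans
    (concentration_bound hn hb0 hab han hcard (F := F)
      (fun u _ => dependsOnStar_indicator (fun e he => mem_of_mem_star he) (· < t))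
      (fun u ω => (indicator_one_mem _ _).1) (fun u ω => (indicator_one_mem _ _).2)
      (x := 1 / 57600) (by norm_num))
  rw [Set.mem_ofPred_eq] at hζ ⊢
  by_contra hcon
  push Not at hcon
  apply hζ
  -- At least n/2 vertices are kept with probability 1/14400 each; a fluctuation of n/57600 leaves
  -- n/57600.
  have h8 : (1 : ℝ) / 28800 * n ≤ ∑ u ∈ Q₁ ∩ U, ∫ ω, F u ω ∂coins (blueProb a b n) := by
    refine le_trans ?_ (Finset.sum_le_sum hmean)
    rw [Finset.sum_const, nsmul_eq_mul]
    linarith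
  have h9 := (abs_lt.1 hcon).1
  have h10 : ∑ u ∈ Q₁ ∩ U, F u ζ
      ≤ ((U ∩ (correction t (graphOf (blueOf ρ ζ)) (Q₁, Q₂)).1).card : ℝ) := by
    classical
    have e : ∑ u ∈ Q₁ ∩ U, F u ζ = ((Q₁ ∩ U).filter fun u => ζ ∈ W u).card := by
      rw [Finset.card_eq_sum_ones, Nat.cast_sum, Finset.sum_filter]
      refine Finset.sum_congr rfl fun u _ => ?_
      simp [hF, Set.indicator_apply]
    rw [e]
    refine Nat.cast_le.2 (Finset.card_le_card fun u hu => ?_)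
    simp only [Finset.mem_filter, Finset.mem_inter] at hu
    obtain ⟨⟨hu1, huU⟩, huW⟩ := hu
    simp only [correction, Finset.mem_inter, Finset.mem_union, Finset.mem_filter]
    refine ⟨huU, Or.inl ⟨hu1, ?_⟩⟩
    rw [not_le, nbrCount_blueOf]
    refine lt_of_le_of_lt ?_ huW
    exact Finset.sum_le_sum_of_subset_of_nonneg (Finset.filter_subset _ _)
      fun e _ _ => bit_nonneg _
  have h11 : (1 - γ) * n ≤ 1 / 57600 * n := mul_le_mul_of_nonneg_right hγ hn0.le
  linarith

/-- Correction places all but a `γ` fraction of a block correctly, if most of the block is placed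
correctly at the start. -/
lemma correction_improves (hn : 0 < n) (hb : 0 < b) (hab : b < a) (han : 4 * a ≤ n)
    (han2 : 30 * (a * a) ≤ (a - b) * n) (hU : U = block₁ n ∨ U = block₂ n) (h1 : Q₁.card = n)
    (h2 : Q₂ = Q₁ᶜ) (hk : ((Q₂ ∩ U).card : ℝ) ≤ 1 / 10 * n) {γ r : ℝ} (hγ : 0 < γ)
    (hγΔ : Real.exp (-((a - b) ^ 2 / (a + b) / 72)) ≤ γ / 4)
    (ρ : Sym2 (Vtx n) → Bool) (hr : r * (a / n) ≤ (a - b) / 60)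
    (hdeg : ((highDegree ρ r).card : ℝ) ≤ γ / 4 * n) :
    (coins (blueProb a b n)).real {ζ | ¬ (1 - γ) * n ≤
        ((U ∩ (correction ((a + b) / 4) (graphOf (blueOf ρ ζ)) (Q₁, Q₂)).1).card : ℝ)}
      ≤ (1 + 3 * a) / (γ / 4) ^ 2 / n := by
  have hn0 : (0 : ℝ) < n := by exact_mod_cast hn
  have ha : 0 < a := hb.trans hab
  set t := (a + b) / 4 with ht
  set D := a + b with hD
  set g := a - b with hg
  have hg0 : 0 < g := by rw [hg]; linarith
  have hD0 : 0 < D := by rw [hD]; linarith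
  have hgD : g ≤ D := by rw [hg, hD]; linarith
  -- The margin g/6 gives the exponent -θ g/6 + θ² D/2, whose minimum in θ is here: -g²/(72 D).
  set θ := g / (6 * D) with hθ
  have hθ0 : 0 ≤ θ := by positivity
  have hθ1 : θ ≤ 1 := by rw [hθ, div_le_one (by positivity)]; linarith
  have hz := blueProb_bounds hn hb hab han
  have hz0 := fun e => (hz e).2.2.1
  have hz1 : ∀ e, blueProb a b n e ≤ 1 := fun e => (hz e).2.2.2.2.trans (by norm_num)
  -- The event that u ends up in the wrong part: it is moved away from Q₁, or fails to be moved out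
  -- of Q₂.
  set W : Vtx n → Set (Sym2 (Vtx n) → Bool) := fun u =>
    if u ∈ Q₁ then {ω | t ≤ ∑ e ∈ blueStar ρ u Q₂, bit (ω e)}
    else {ω | ∑ e ∈ blueStar ρ u Q₁, bit (ω e) < t} with hW
  set F : Vtx n → (Sym2 (Vtx n) → Bool) → ℝ := fun u => (W u).indicator fun _ => 1 with hF
  set U' := U \ highDegree ρ r with hU'
  obtain ⟨c1, c2, c3⟩ := card_side hU h1 h2
  have hc : ((Q₁ ∩ U).card : ℝ) + (Q₂ ∩ U).card = n := by exact_mod_cast c1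
  have hUc := card_block hU
  have hmean : ∀ u ∈ U', ∫ ω, F u ω ∂coins (blueProb a b n) ≤ γ / 4 := by
    intro u hu
    obtain ⟨huU, hur⟩ := Finset.mem_sdiff.1 hu
    rw [hF, integral_indicator_one_coins]
    refine le_trans ?_ hγΔ
    simp only [hW]
    split_ifs with hu1
    · have hm' := sum_blueProb_le hn hb hab han hU h1 h2 hk huU
      have hm2 : ∑ e ∈ blueStar ρ u Q₂, blueProb a b n e ≤ t - g / 6 := by
        refine (Finset.sum_le_sum_of_subset_of_nonneg (Finset.filter_subset _ _)
          fun e _ _ => hz0 e).trans (hm'.trans ?_)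
        have h5 : a / n * a ≤ g / 30 := by
          rw [div_mul_eq_mul_div, div_le_iff₀ hn0]; linarith
        have h6 : a / n * ((b + 1 / 10 * g) / 2) ≤ a / n * (a / 2) := by
          refine mul_le_mul_of_nonneg_left ?_ (by positivity)
          rw [hg]; linarith
        have h7 : t = b / 2 + g / 4 := by rw [ht, hD, hg]; ring
        rw [h7]
        linarith
      refine (coins_upper_tail hz0 hz1 _ hθ0 hθ1 hm2).trans (Real.exp_le_exp.2 ?_)
      have e1 : (θ + θ ^ 2) * (t - g / 6) - θ * t = -(g ^ 2 / D / 36) + θ ^ 2 * (t - g / 6) := by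
        rw [hθ]; field_simp; ring
      have e2 : θ ^ 2 * (t - g / 6) ≤ θ ^ 2 * (D / 2) :=
        mul_le_mul_of_nonneg_left (by rw [ht]; linarith) (by positivity)
      have e3 : θ ^ 2 * (D / 2) = g ^ 2 / D / 72 := by rw [hθ]; field_simp; norm_num
      rw [e1]
      linarith
    · have hu2 : u ∈ Q₂ := by rw [h2]; simpa using hu1
      have hQ1 : Q₁ = Q₂ᶜ := by rw [h2, compl_compl]
      have hQ2c : Q₂.card = n := by
        rw [h2, Finset.card_compl, h1]; simp only [Fintype.card_sum, Fintype.card_fin]; omega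
      have hm := half_le_sum_blueProb hn hb hab han hU hQ2c hQ1 huU hu1
      have hdegu : ∑ j, adj ρ u j ≤ r := by
        by_contra hcon
        exact hur (Finset.mem_filter.2 ⟨Finset.mem_univ _, not_le.1 hcon⟩)
      have hm2 : t + g / 6 ≤ ∑ e ∈ blueStar ρ u Q₁, blueProb a b n e := by
        refine le_trans ?_ (sum_blueStar_ge hn hb hab han ρ u Q₁ hdegu)
        have h5 : 9 / 10 ≤ ((Q₁ ∩ U).card : ℝ) / n := by
          rw [le_div_iff₀ hn0]; linarith
        have h6 := mul_le_mul_of_nonneg_right h5 hg0.le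
        have h7 : t = b / 2 + g / 4 := by rw [ht, hD, hg]; ring
        rw [h7]
        linarith
      refine (measureReal_mono (fun ω (hω : _ < t) => hω.le) (measure_ne_top _ _)).trans
        ((coins_lower_tail hz0 hz1 _ (t := t) hθ0 hθ1 hm2).trans (Real.exp_le_exp.2 ?_))
      have e1 : θ * t - (θ - θ ^ 2) * (t + g / 6) = -(g ^ 2 / D / 36) + θ ^ 2 * (t + g / 6) := by
        rw [hθ]; field_simp; ring
      have e2 : θ ^ 2 * (t + g / 6) ≤ θ ^ 2 * (D / 2) :=
        mul_le_mul_of_nonneg_left (by rw [ht]; linarith) (by positivity)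
      have e3 : θ ^ 2 * (D / 2) = g ^ 2 / D / 72 := by rw [hθ]; field_simp; norm_num
      rw [e1]
      linarith
  have hcard : U'.card ≤ n := (Finset.card_le_card Finset.sdiff_subset).trans hUc.le
  have hdep : ∀ u ∈ U', DependsOnStar u (F u) := by
    intro u _
    simp only [hF, hW]
    split_ifs
    · exact dependsOnStar_indicator (fun e he => mem_of_mem_blueStar he) (t ≤ ·)
    · exact dependsOnStar_indicator (fun e he => mem_of_mem_blueStar he) (· < t)
  refine (measureReal_mono (fun ζ hζ => ?_) (measure_ne_top _ _)).trans
    (concentration_bound hn hb hab han hcard (F := F) hdep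
      (fun u ω => (indicator_one_mem _ _).1) (fun u ω => (indicator_one_mem _ _).2)
      (x := γ / 4) (by positivity))
  rw [Set.mem_ofPred_eq] at hζ ⊢
  by_contra hcon
  push Not at hcon
  apply hζ
  have h8 : ∑ u ∈ U', ∫ ω, F u ω ∂coins (blueProb a b n) ≤ γ / 4 * n := by
    refine (Finset.sum_le_sum hmean).trans ?_
    rw [Finset.sum_const, nsmul_eq_mul, mul_comm]
    exact mul_le_mul_of_nonneg_left (by exact_mod_cast hcard) (by positivity)
  have h9 := (abs_lt.1 hcon).2
  classical
  set X := (correction t (graphOf (blueOf ρ ζ)) (Q₁, Q₂)).1 with hX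
  have h10 : ((U \ X).card : ℝ) ≤ ∑ u ∈ U', F u ζ + (highDegree ρ r).card := by
    have e : ∑ u ∈ U', F u ζ = (U'.filter fun u => ζ ∈ W u).card := by
      rw [Finset.card_eq_sum_ones, Nat.cast_sum, Finset.sum_filter]
      refine Finset.sum_congr rfl fun u _ => ?_
      simp [hF, Set.indicator_apply]
    rw [e, ← Nat.cast_add]
    refine Nat.cast_le.2 ((Finset.card_le_card fun u hu => ?_).trans (Finset.card_union_le _ _))
    obtain ⟨huU, huX⟩ := Finset.mem_sdiff.1 hu
    rw [Finset.mem_union]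
    by_cases hr' : u ∈ highDegree ρ r
    · exact Or.inr hr'
    refine Or.inl (Finset.mem_filter.2 ⟨Finset.mem_sdiff.2 ⟨huU, hr'⟩, ?_⟩)
    simp only [hX, correction, Finset.mem_union, Finset.mem_filter, not_or, not_and, not_not,
      nbrCount_blueOf] at huX
    simp only [hW]
    split_ifs with hu1
    · exact huX.1 hu1
    · have hu2 : u ∈ Q₂ := by rw [h2]; simpa using hu1
      exact not_le.1 (huX.2 hu2)
  have h11 := Finset.card_inter_add_card_sdiff U X
  rw [hUc] at h11
  have h12 : ((U ∩ X).card : ℝ) + (U \ X).card = n := by exact_mod_cast h11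
  -- The misplaced vertices number less than 3γn/4: a share γn/4 each for the expected errors, their
  -- fluctuation and the vertices of large red degree.
  nlinarith

end Side

/-! ### Correction of a balanced partition -/

section Correction

variable {n : ℕ}

lemma correction_swap {V : Type} [DecidableEq V] (t : ℝ) (B : SimpleGraph V)
    (P : Finset V × Finset V) :
    correction t B P.swap = (correction t B P).swap := rfl

lemma isCorrect_swap {γ : ℝ} {P : Finset (Vtx n) × Finset (Vtx n)} :
    IsCorrect γ P.swap ↔ IsCorrect γ P := by
  unfold IsCorrect
  rw [Prod.swap_swap, or_comm]

lemma isCorrect_half {P : Finset (Vtx n) × Finset (Vtx n)} (h1 : P.1.card = n)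
    (h2 : P.2 = P.1ᶜ) : IsCorrect (1 / 2) P := by
  obtain ⟨c1, c2, c3⟩ := card_inter_blocks h1 h2
  have e : ((block₁ n ∩ P.1).card : ℝ) + (block₁ n ∩ P.2).card = n := by exact_mod_cast c1
  rcases le_total (block₁ n ∩ P.1).card (block₁ n ∩ P.2).card with h | h
  · have h' : ((block₁ n ∩ P.1).card : ℝ) ≤ (block₁ n ∩ P.2).card := by exact_mod_cast h
    refine Or.inr ⟨?_, ?_⟩
    · rw [Prod.fst_swap]; linarith
    · rw [Prod.snd_swap, c2]; linarith
  · have h' : ((block₁ n ∩ P.2).card : ℝ) ≤ (block₁ n ∩ P.1).card := by exact_mod_cast h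
    refine Or.inl ⟨?_, ?_⟩
    · linarith
    · rw [c3]; linarith

/-- A bound for the failure probability of Correction on one block gives one for both blocks. -/
lemma measure_not_isCorrect_correction_le {Ω : Type} [MeasurableSpace Ω] {μ : Measure Ω}
    [IsFiniteMeasure μ] {B : Ω → SimpleGraph (Vtx n)} {t γ x ε : ℝ}
    (side : ∀ U Q₁ Q₂ : Finset (Vtx n), U = block₁ n ∨ U = block₂ n → Q₁.card = n → Q₂ = Q₁ᶜ →
      ((Q₂ ∩ U).card : ℝ) ≤ x * n →
      μ.real {ζ | ¬ (1 - γ) * n ≤ ((U ∩ (correction t (B ζ) (Q₁, Q₂)).1).card : ℝ)} ≤ ε)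
    {P : Finset (Vtx n) × Finset (Vtx n)} (h1 : P.1.card = n) (h2 : P.2 = P.1ᶜ)
    (hP : IsCorrect x P) :
    μ.real {ζ | ¬ IsCorrect γ (correction t (B ζ) P)} ≤ 2 * ε := by
  have labelled : ∀ Q : Finset (Vtx n) × Finset (Vtx n), Q.1.card = n → Q.2 = Q.1ᶜ →
      IsCorrectLabelled x Q → μ.real {ζ | ¬ IsCorrect γ (correction t (B ζ) Q)} ≤ 2 * ε := by
    rintro ⟨Q₁, Q₂⟩ h1 h2 hQ
    obtain ⟨c1, c2, c3⟩ := card_inter_blocks h1 h2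
    have e : ((block₁ n ∩ Q₁).card : ℝ) + (block₁ n ∩ Q₂).card = n := by exact_mod_cast c1
    have c2' : ((block₂ n ∩ Q₁).card : ℝ) = (block₁ n ∩ Q₂).card := by exact_mod_cast c2
    have hq : ((block₁ n ∩ Q₂).card : ℝ) ≤ x * n := by
      have := hQ.1
      simp only at this
      linarith
    have s1 := side _ Q₁ Q₂ (Or.inl rfl) h1 h2 (by rwa [Finset.inter_comm])
    have hQ2 : Q₂.card = n := by
      simp only at h1 h2
      rw [h2, Finset.card_compl, h1]; simp only [Fintype.card_sum, Fintype.card_fin]; omega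
    -- The second block is the first one with the parts exchanged; balance makes its number of
    -- misplaced vertices the same.
    have s2 := side _ Q₂ Q₁ (Or.inr rfl) hQ2 (by simp only at h2; rw [h2, compl_compl])
      (by rw [Finset.inter_comm, c2']; exact hq)
    have s := (measureReal_union_le _ _).trans (add_le_add s1 s2)
    refine (measureReal_mono (fun ζ hζ => ?_) (measure_ne_top _ _)).trans (s.trans (by linarith))
    rw [Set.mem_union, Set.mem_ofPred_eq, Set.mem_ofPred_eq]
    by_contra hcon
    rw [not_or, not_not, not_not] at hcon
    exact hζ (Or.inl hcon)
  rcases hP with h | h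
  · exact labelled P h1 h2 h
  · have hP2 : P.2.card = n := by
      rw [h2, Finset.card_compl, h1]; simp only [Fintype.card_sum, Fintype.card_fin]; omega
    have := labelled P.swap hP2 (by rw [Prod.snd_swap, Prod.fst_swap, h2, compl_compl]) h
    simpa only [correction_swap, isCorrect_swap] using this

end Correction

/-! ### The red graph and the blue graph -/

section Coupling

variable {E : Type} [Fintype E]

lemma coin_real_singleton {x : ℝ} (h0 : 0 ≤ x) (h1 : x ≤ 1) (c : Bool) :
    (coin x).real {c} = if c then x else 1 - x := by
  have h := integral_coin h0 h1 (({c} : Set Bool).indicator fun _ => (1 : ℝ))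
  rw [integral_indicator_const _ (Set.toFinite _).measurableSet, smul_eq_mul, mul_one] at h
  rw [h]
  cases c <;> simp

/-- A pair is red with probability p/2, blue with p/2, and otherwise no edge. Given that it is not
red, it is blue with probability (p/2)/(1 - p/2), which a fresh coin supplies. -/
lemma map_coin_prod_half {p : ℝ} (h0 : 0 ≤ p) (h1 : p ≤ 1) :
    ((coin p).prod (coin (1 / 2))).map (fun c => (c.1 && c.2, c.1 && !c.2))
      = ((coin (p / 2)).prod (coin (p / 2 / (1 - p / 2)))).map (fun c => (c.1, c.2 && !c.1)) := by
  have h2 : 0 < 1 - p / 2 := by linarith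
  have hz0 : 0 ≤ p / 2 / (1 - p / 2) := by positivity
  have hz1 : p / 2 / (1 - p / 2) ≤ 1 := by rw [div_le_one h2]; linarith
  refine Measure.ext_of_singleton fun c => ?_
  rw [← measureReal_eq_measureReal_iff]
  have key : ∀ (μ : Measure (Bool × Bool)) [IsFiniteMeasure μ] (s : Set (Bool × Bool)),
      μ.real s = ∑ c, s.indicator (fun c => μ.real {c}) c := by
    intro μ _ s
    have h : ∫ c, s.indicator (fun _ => (1 : ℝ)) c ∂μ = μ.real s := by
      rw [integral_indicator_const _ (Set.toFinite _).measurableSet, smul_eq_mul, mul_one]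
    rw [← h, integral_fintype Integrable.of_finite]
    refine Finset.sum_congr rfl fun c _ => ?_
    by_cases hc : c ∈ s <;> simp [hc]
  rw [map_measureReal_apply Measurable.of_discrete (Set.toFinite _).measurableSet,
    map_measureReal_apply Measurable.of_discrete (Set.toFinite _).measurableSet, key, key]
  have hs : ∀ (x y : ℝ), 0 ≤ x → x ≤ 1 → 0 ≤ y → y ≤ 1 → ∀ c : Bool × Bool,
      ((coin x).prod (coin y)).real {c} = (if c.1 then x else 1 - x) * if c.2 then y else 1 - y := by
    rintro x y hx0 hx1 hy0 hy1 ⟨c, c'⟩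
    rw [← Set.singleton_prod_singleton, measureReal_prod_prod, coin_real_singleton hx0 hx1,
      coin_real_singleton hy0 hy1]
  simp only [hs p (1 / 2) h0 h1 (by norm_num) (by norm_num),
    hs (p / 2) _ (by linarith) (by linarith) hz0 hz1, Fintype.sum_prod_type]
  have hz : p / 2 / (1 - p / 2) * (1 - p / 2) = p / 2 := div_mul_cancel₀ _ h2.ne'
  generalize p / 2 / (1 - p / 2) = z at hz
  rcases c with ⟨_ | _, _ | _⟩ <;> simp
  · linear_combination hz
  · linear_combination -hz
  all_goals ring

lemma map_coins_prod {p : E → ℝ} (h0 : ∀ e, 0 ≤ p e) (h1 : ∀ e, p e ≤ 1) :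
    ((coins p).prod (coins fun _ => 1 / 2)).map
        (fun ω => (fun e => (ω.1 e && ω.2 e, ω.1 e && !ω.2 e) : E → Bool × Bool))
      = ((coins fun e => p e / 2).prod (coins fun e => p e / 2 / (1 - p e / 2))).map
        (fun ω => (fun e => (ω.1 e, ω.2 e && !ω.1 e) : E → Bool × Bool)) := by
  have key : ∀ (x y : E → ℝ) (f : Bool × Bool → Bool × Bool),
      ((coins x).prod (coins y)).map (fun ω e => f (ω.1 e, ω.2 e))
        = Measure.pi fun e => ((coin (x e)).prod (coin (y e))).map f := by
    intro x y f
    have hm := (measurePreserving_arrowProdEquivProdArrow Bool Bool E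
      (fun e => coin (x e)) fun e => coin (y e)).symm
    rw [← Measure.pi_map_pi (fun e => Measurable.of_discrete.aemeasurable), ← hm.map_eq,
      Measure.map_map Measurable.of_discrete hm.measurable]
    rfl
  have e1 := key p (fun _ => 1 / 2) fun c => (c.1 && c.2, c.1 && !c.2)
  have e2 := key (fun e => p e / 2) (fun e => p e / 2 / (1 - p e / 2)) fun c => (c.1, c.2 && !c.1)
  simp only at e1 e2
  rw [e1, e2]
  congr 1
  funext e
  exact map_coin_prod_half (h0 e) (h1 e)

end Coupling

/-! ### The law of the red graph and the blue graph -/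

section Law

variable {n : ℕ}

instance : MeasurableSingletonClass (SimpleGraph (Vtx n)) where
  measurableSet_singleton G :=
    ⟨{G.Adj}, (Set.toFinite _).measurableSet, by ext H; simp⟩

lemma colourClass_true (ω χ : Sym2 (Vtx n) → Bool) :
    colourClass (graphOf ω) χ true = graphOf fun e => ω e && χ e := by
  ext u v
  simp only [colourClass, SimpleGraph.fromEdgeSet_adj, Set.mem_ofPred_eq,
    SimpleGraph.mem_edgeSet, graphOf_adj, Bool.and_eq_true]
  tauto

lemma colourClass_false (ω χ : Sym2 (Vtx n) → Bool) :
    colourClass (graphOf ω) χ false = graphOf fun e => ω e && !χ e := by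
  ext u v
  simp only [colourClass, SimpleGraph.fromEdgeSet_adj, Set.mem_ofPred_eq,
    SimpleGraph.mem_edgeSet, graphOf_adj, Bool.and_eq_true, Bool.not_eq_true']
  tauto

/-- The red and the blue graph can be sampled one after the other. -/
lemma measureReal_colourClasses {a b : ℝ} (hn : 0 < n) (hb : 0 < b) (hab : b < a)
    (han : 4 * a ≤ n) (Q : SimpleGraph (Vtx n) → SimpleGraph (Vtx n) → Prop) :
    ((sbm a b n).prod (colouringLaw n)).real
        {ω | Q (colourClass ω.1 ω.2 true) (colourClass ω.1 ω.2 false)}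
      = ((coins (redProb a b n)).prod (coins (blueProb a b n))).real
        {ω | Q (graphOf ω.1) (graphOf (blueOf ω.1 ω.2))} := by
  have hn0 : (0 : ℝ) < n := by exact_mod_cast hn
  have ha : 0 < a := hb.trans hab
  have hp := edgeProb_bounds (n := n) hn hb hab
  have hp1 : ∀ e, edgeProb a b n e ≤ 1 := fun e => (hp e).2.trans <| by
    rw [div_le_one hn0]; linarith
  have hmap : (sbm a b n).prod (colouringLaw n)
      = ((coins (edgeProb a b n)).prod (coins fun _ => 1 / 2)).map (Prod.map graphOf id) := by
    rw [← Measure.map_prod_map _ _ Measurable.of_discrete measurable_id, Measure.map_id]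
    rfl
  have hc := map_coins_prod (fun e => (hp e).1) hp1
  have h := congrArg (fun μ : Measure (Sym2 (Vtx n) → Bool × Bool) => μ.real
    {c | Q (graphOf fun e => (c e).1) (graphOf fun e => (c e).2)}) hc
  simp only [map_measureReal_apply Measurable.of_discrete (Set.toFinite _).measurableSet] at h
  rw [hmap, map_measureReal_apply Measurable.of_discrete (Set.toFinite _).measurableSet]
  refine Eq.trans (congrArg _ ?_) h
  ext ω
  simp only [Set.mem_preimage, Set.mem_ofPred_eq, Prod.map_fst, Prod.map_snd, id,
    colourClass_true, colourClass_false]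

lemma measureReal_prod_le {Ω Ω' : Type} [MeasurableSpace Ω] [MeasurableSpace Ω'] [Finite Ω]
    [Finite Ω'] [MeasurableSingletonClass Ω] [MeasurableSingletonClass Ω'] {μ : Measure Ω}
    {ν : Measure Ω'} [IsProbabilityMeasure μ] [IsProbabilityMeasure ν] {A : Set Ω}
    {s : Set (Ω × Ω')} {ε : ℝ} (hε : 0 ≤ ε)
    (h : ∀ x, x ∉ A → ν.real {y | (x, y) ∈ s} ≤ ε) :
    (μ.prod ν).real s ≤ μ.real A + ε := by
  have e1 : (μ.prod ν).real s = ∫ x, ν.real {y | (x, y) ∈ s} ∂μ := by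
    have h1 : ∫ z, s.indicator (fun _ => (1 : ℝ)) z ∂μ.prod ν = (μ.prod ν).real s := by
      rw [integral_indicator_const _ (Set.toFinite _).measurableSet, smul_eq_mul, mul_one]
    rw [← h1, integral_prod _ Integrable.of_finite]
    refine integral_congr_ae (Eventually.of_forall fun x => ?_)
    have h2 : ∫ y, {y | (x, y) ∈ s}.indicator (fun _ => (1 : ℝ)) y ∂ν = ν.real {y | (x, y) ∈ s} := by
      rw [integral_indicator_const _ (Set.toFinite _).measurableSet, smul_eq_mul, mul_one]
    exact h2
  have e2 : ∫ x, (A.indicator (fun _ => (1 : ℝ)) x + ε) ∂μ = μ.real A + ε := by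
    rw [integral_add Integrable.of_finite Integrable.of_finite,
      integral_indicator_const _ (Set.toFinite _).measurableSet]
    simp
  rw [e1, ← e2]
  refine integral_mono Integrable.of_finite Integrable.of_finite fun x => ?_
  by_cases hx : x ∈ A
  · simp only [Set.indicator_of_mem hx]
    linarith [measureReal_le_one (μ := ν) (s := {y | (x, y) ∈ s})]
  · simp only [Set.indicator_of_notMem hx, zero_add]
    exact h x hx

end Law

/-! ### The red graph is typical with high probability -/

section Red

lemma exists_two_pow_sq {D : ℝ} (hD : 1 ≤ D) :
    ∃ l : ℕ, 1 ≤ l ∧ D ≤ ((2 : ℝ) ^ l) ^ 2 ∧ ((2 : ℝ) ^ l) ^ 2 ≤ 4 * D := by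
  obtain ⟨m, h1, h2⟩ := exists_nat_pow_near (Real.one_le_sqrt.2 hD) (one_lt_two (α := ℝ))
  have hs := Real.sq_sqrt (zero_le_one.trans hD)
  have hs0 := Real.sqrt_nonneg D
  refine ⟨m + 1, by omega, ?_, ?_⟩
  · rw [← hs]
    exact pow_le_pow_left₀ hs0 h2.le 2
  · rw [← hs, pow_succ (2 : ℝ) m, mul_pow]
    have := pow_le_pow_left₀ (by positivity) h1 2
    linarith

/-- The event that the red graph `ρ` has the discrepancy properties of a random graph. -/
def IsTypical (a b : ℝ) (n l : ℕ) (ρ : Sym2 (Vtx n) → Bool) : Prop :=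
  LightBound (redProb a b n) (2 ^ l) ρ ∧ DiscBound (a + b) l (Fintype.card (Vtx n)) ρ

lemma redProb_bounds {a b : ℝ} {n : ℕ} (hn : 0 < n) (hb : 0 < b) (hab : b < a) (han : 4 * a ≤ n)
    (e : Sym2 (Vtx n)) :
    0 ≤ redProb a b n e ∧ redProb a b n e ≤ 1 ∧
      redProb a b n e ≤ (a + b) / Fintype.card (Vtx n) := by
  have hn0 : (0 : ℝ) < n := by exact_mod_cast hn
  obtain ⟨h0, h1⟩ := edgeProb_bounds hn hb hab e
  have h2 : a / n ≤ 1 / 4 := by rw [div_le_iff₀ hn0]; linarith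
  have h3 : (a + b) / (2 * n) = a / n / 2 + b / n / 2 := by field_simp
  have h4 : 0 ≤ b / n := by positivity
  unfold redProb
  rw [card_vtx]
  exact ⟨by positivity, by linarith, by linarith⟩

lemma tendsto_measure_not_isTypical {a b : ℝ} (hb : 0 < b) (hab : b < a) {l : ℕ}
    (hl : a + b ≤ ((2 : ℝ) ^ l) ^ 2) :
    Tendsto (fun n : ℕ => (coins (redProb a b n)).real {ρ | ¬ IsTypical a b n l ρ}) atTop
      (𝓝 0) := by
  have h2n : Tendsto (fun n : ℕ => 2 * n) atTop atTop :=
    tendsto_id.const_mul_atTop' two_pos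
  have t1 : Tendsto (fun n : ℕ => 2 * Real.exp (-((2 * n : ℕ) : ℝ))) atTop (𝓝 (2 * 0)) :=
    (Real.tendsto_exp_neg_atTop_nhds_zero.comp
      (tendsto_natCast_atTop_atTop.comp h2n)).const_mul 2
  have t2 : Tendsto (fun n : ℕ => (∑' t, unionTerm ((2 * n : ℕ) : ℝ) t) ^ 2) atTop (𝓝 (0 ^ 2)) :=
    (tendsto_tsum_unionTerm.comp h2n).pow 2
  have t := t1.add t2
  rw [mul_zero, zero_pow two_ne_zero, add_zero] at t
  refine squeeze_zero' (Eventually.of_forall fun n => measureReal_nonneg) ?_ t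
  filter_upwards [eventually_gt_atTop 0,
    tendsto_natCast_atTop_atTop.eventually_ge_atTop (4 * a)] with n hn han
  have : Nonempty (Vtx n) := ⟨Sum.inl ⟨0, hn⟩⟩
  have hq := redProb_bounds hn hb hab han
  have hcard : (Fintype.card (Vtx n) : ℝ) = ((2 * n : ℕ) : ℝ) := by rw [card_vtx]; push_cast; rfl
  have m1 := measure_not_lightBound_le (fun e => (hq e).1) (fun e => (hq e).2.1)
    (by positivity : (0 : ℝ) < 2 ^ l) hl fun e => (hq e).2.2
  have m2 := measure_not_discBound_le (fun e => (hq e).1) (fun e => (hq e).2.1)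
    (fun e => (hq e).2.2) l (Fintype.card (Vtx n))
  rw [hcard] at m1 m2
  refine (measureReal_mono (fun ρ hρ => ?_) (measure_ne_top _ _)).trans
    ((measureReal_union_le _ _).trans (add_le_add m1 m2))
  exact not_and_or.1 hρ

end Red

/-! ### Partition is correct with high probability -/

section Final

variable {a b γ d : ℝ}
  {S : (n : ℕ) → SimpleGraph (Vtx n) → Finset (Vtx n) × Finset (Vtx n)}

/-- The probability that Partition fails. -/
def failure (a b γ : ℝ) (S : (n : ℕ) → SimpleGraph (Vtx n) → Finset (Vtx n) × Finset (Vtx n))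
    (n : ℕ) : ℝ :=
  ((sbm a b n).prod (colouringLaw n)).real {ω | ¬ IsCorrect γ (partitionAlg a b S n ω.1 ω.2)}

lemma failure_le {n : ℕ} (hn : 0 < n) (hb : 0 < b) (hab : b < a) (han : 4 * a ≤ n)
    {A : Set (Sym2 (Vtx n) → Bool)} {ε : ℝ} (hε : 0 ≤ ε)
    (h : ∀ ρ, ρ ∉ A → (coins (blueProb a b n)).real {ζ | ¬ IsCorrect γ
      (correction ((a + b) / 4) (graphOf (blueOf ρ ζ)) (S n (graphOf ρ)))} ≤ ε) :
    failure a b γ S n ≤ (coins (redProb a b n)).real A + ε :=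
  (measureReal_colourClasses hn hb hab han fun R B =>
    ¬ IsCorrect γ (correction ((a + b) / 4) B (S n R))).trans_le (measureReal_prod_le hε h)

lemma tendsto_const_div (c : ℝ) : Tendsto (fun n : ℕ => 2 * (c / n)) atTop (𝓝 0) := by
  simpa using (tendsto_const_div_atTop_nhds_zero_nat c).const_mul 2

/-- The regime of large γ. Only the balance of the output of Spectral Partition is used, and no
property of the red graph. -/
lemma tendsto_failure_of_one_sub_le (hb : 25600 ≤ b) (hab : b < a) (hγ : 1 - γ ≤ 1 / 57600)
    (hS : IsSpectralPartition d S) : Tendsto (failure a b γ S) atTop (𝓝 0) := by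
  have hb0 : 0 < b := by linarith
  have ha : 0 < a := hb0.trans hab
  refine squeeze_zero' (Eventually.of_forall fun n => measureReal_nonneg) ?_
    (tendsto_const_div ((1 + 3 * a) / (1 / 57600) ^ 2))
  filter_upwards [eventually_gt_atTop 0,
    tendsto_natCast_atTop_atTop.eventually_ge_atTop (4 * a),
    tendsto_natCast_atTop_atTop.eventually_ge_atTop (100 * (a * (a + b)))] with n hn han han2
  refine (failure_le hn hb0 hab han (A := ∅)
    (ε := 2 * ((1 + 3 * a) / (1 / 57600) ^ 2 / n)) (by positivity) fun ρ _ => ?_).trans_eq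
    (by rw [measureReal_empty, zero_add])
  obtain ⟨W, v₁, v₂, -, -, -, -, -, h1, h2, -⟩ := hS n hn (graphOf ρ)
  exact measure_not_isCorrect_correction_le (x := 1 / 2)
    (fun U Q₁ Q₂ hU h1 h2 hk => correction_keeps_fraction hn hb hab han han2 hU h1 h2 hk hγ ρ)
    h1 h2 (isCorrect_half h1 h2)

lemma card_highDegree_mul_le {V : Type} [Fintype V] [DecidableEq V] (ρ : Sym2 V → Bool) (r : ℝ) :
    (highDegree ρ r).card * r ≤ ∑ i, ∑ j, adj ρ i j := by
  have h : ∑ i ∈ highDegree ρ r, r ≤ ∑ i ∈ highDegree ρ r, ∑ j, adj ρ i j :=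
    Finset.sum_le_sum fun i hi => (Finset.mem_filter.1 hi).2.le
  rw [Finset.sum_const, nsmul_eq_mul] at h
  exact h.trans (Finset.sum_le_sum_of_subset_of_nonneg (Finset.subset_univ _)
    fun i _ _ => Finset.sum_nonneg fun j _ => adj_nonneg _ _ _)

/-- On a typical red graph, Spectral Partition recovers nine tenths of the blocks. -/
lemma IsTypical.isCorrect {n l : ℕ} {ρ : Sym2 (Vtx n) → Bool} (hρ : IsTypical a b n l ρ)
    (hn : 0 < n) (hb : 25600 ≤ b) (hab : b < a) (han : 4 * a ≤ n) (hl : 1 ≤ l)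
    (hl1 : a + b ≤ ((2 : ℝ) ^ l) ^ 2) (hl2 : ((2 : ℝ) ^ l) ^ 2 ≤ 4 * (a + b))
    (hΔ : 10 ^ 13 * (a + b) ≤ (a - b) ^ 2) (hd : d = a + b ∨ d = (a + b) / 2)
    {P : Finset (Vtx n) × Finset (Vtx n)} (hP : IsSpectralOutput d (graphOf ρ) P) :
    P.1.card = n ∧ P.2 = P.1ᶜ ∧ IsCorrect (1 / 10) P := by
  have hb0 : 0 < b := by linarith
  have hD : 51200 ≤ a + b := by linarith
  -- Both choices of d put the cutoff 20 d between 10(a+b), above which few vertices lie, and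
  -- 20(a+b), the degree bound of the norm estimate.
  have hd1 : (a + b) / 2 ≤ d ∧ d ≤ a + b := by rcases hd with rfl | rfl <;> constructor <;> linarith
  have : Nonempty (Vtx n) := ⟨Sum.inl ⟨0, hn⟩⟩
  have hq := redProb_bounds hn hb0 hab han
  refine isCorrect_of_isSpectralOutput (κ := 3987 * 2 ^ l) hn hb0 hab (by linarith) hD ?_ ?_ ?_ hP
  · set L : ℝ := 2 ^ l
    have hL0 : 0 < L := by positivity
    have hL : 16 ≤ L := by nlinarith
    -- The origin of 10^13: 80(44 + 4 · 3987 L) is below 1500000 L, and the square of that is at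
    -- most 9 · 10^12 (a+b), as L² ≤ 4(a+b).
    have h1 : (1500000 * L) ^ 2 ≤ (a - b) ^ 2 := by nlinarith
    have h2 := (sq_le_sq₀ (by positivity) (by linarith)).1 h1
    linarith
  · have h := card_highDegree_le hl (by linarith : 3 ≤ a + b) hρ.2 (T := 20 * d) (by linarith)
    refine h.trans_eq ?_
    rw [card_vtx]; ring
  · intro x hx hdeg
    exact abs_bilin_centredAdj_le (by linarith : 0 ≤ a + b) hl1 (fun e => (hq e).1)
      (fun e => (hq e).2.2) hρ.1 hρ.2 hx fun i hi => (hdeg i hi).trans (by linarith)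

/-- The main regime. Failure needs an atypical red graph or, given a typical one, a failure of
Correction from a partition that is nine tenths right, which has probability O(1/n). -/
lemma tendsto_failure_of_le (hb : 25600 ≤ b) (hab : b < a) (hγ : 0 < γ)
    (hΔ : 10 ^ 13 * (a + b) ≤ (a - b) ^ 2)
    (hγΔ : Real.exp (-((a - b) ^ 2 / (a + b) / 72)) ≤ γ / 4)
    (hd : d = a + b ∨ d = (a + b) / 2)
    (hS : IsSpectralPartition d S) : Tendsto (failure a b γ S) atTop (𝓝 0) := by
  have hb0 : 0 < b := by linarith
  have ha : 0 < a := hb0.trans hab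
  have hg : 0 < a - b := by linarith
  obtain ⟨l, hl, hl1, hl2⟩ := exists_two_pow_sq (by linarith : 1 ≤ a + b)
  have t := (tendsto_measure_not_isTypical hb0 hab hl1).add
    (tendsto_const_div ((1 + 3 * a) / (γ / 4) ^ 2))
  rw [add_zero] at t
  refine squeeze_zero' (Eventually.of_forall fun n => measureReal_nonneg) ?_ t
  filter_upwards [eventually_gt_atTop 0,
    tendsto_natCast_atTop_atTop.eventually_ge_atTop (4 * a),
    tendsto_natCast_atTop_atTop.eventually_ge_atTop (30 * (a * a) / (a - b)),
    tendsto_natCast_atTop_atTop.eventually_ge_atTop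
      ((6 * (a + b) + 16) * 2 * (60 * a) / (a - b) / (γ / 4))] with n hn han han2 han3
  have hn0 : (0 : ℝ) < n := by exact_mod_cast hn
  have : Nonempty (Vtx n) := ⟨Sum.inl ⟨0, hn⟩⟩
  rw [div_le_iff₀ hg] at han2
  rw [div_le_iff₀ (by positivity)] at han3
  refine failure_le hn hb0 hab han (by positivity) fun ρ hρ => ?_
  have hρ : IsTypical a b n l ρ := not_not.1 hρ
  obtain ⟨h1, h2, h3⟩ := hρ.isCorrect hn hb hab han hl hl1 hl2 hΔ hd (hS n hn (graphOf ρ))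
  -- This cutoff is linear in n and the sum of the red degrees is O(n), so only O(1) vertices exceed
  -- it, while a red degree below it shifts a mean by at most (a-b)/60.
  have hr0 : 0 < (a - b) * n / (60 * a) := by positivity
  have hdeg : ((highDegree ρ ((a - b) * n / (60 * a))).card : ℝ) ≤ γ / 4 * n := by
    have e := (card_highDegree_mul_le ρ ((a - b) * n / (60 * a))).trans
      (sum_adj_le hl (by linarith : 0 ≤ a + b) hρ.2)
    rw [card_vtx, ← le_div_iff₀ hr0] at e
    refine e.trans (le_trans (le_of_eq ?_) (han3.trans_eq (mul_comm _ _)))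
    field_simp
  exact measure_not_isCorrect_correction_le (x := 1 / 10)
    (fun U Q₁ Q₂ hU h1 h2 hk => correction_improves hn hb0 hab han (by linarith) hU h1 h2 hk hγ hγΔ
      ρ (r := (a - b) * n / (60 * a)) (le_of_eq (by field_simp)) hdeg)
    h1 h2 h3

lemma tendsto_correct_of_tendsto_failure (h : Tendsto (failure a b γ S) atTop (𝓝 0)) :
    Tendsto (fun n : ℕ => ((sbm a b n).prod (colouringLaw n)).real
      {ω | IsCorrect γ (partitionAlg a b S n ω.1 ω.2)}) atTop (𝓝 1) := by
  have h1 := h.const_sub 1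
  rw [sub_zero] at h1
  refine h1.congr fun n => ?_
  rw [failure, ← probReal_compl_eq_one_sub (Set.toFinite _).measurableSet]
  congr 1
  ext ω
  simp

end Final

end BlockModel

end

theorem theorem1p2 :
    ∃ C₀ C₁ : ℝ, 0 < C₀ ∧ 0 < C₁ ∧
      ∀ a b γ : ℝ, C₀ < b → b < a → 0 < γ →
        C₁ * Real.log (1 / γ) ≤ (a - b) ^ 2 / (a + b) →
        ∀ d : ℝ, d = a + b ∨ d = (a + b) / 2 →
        ∀ S : (n : ℕ) → SimpleGraph (BlockModel.Vtx n) →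
            Finset (BlockModel.Vtx n) × Finset (BlockModel.Vtx n),
          BlockModel.IsSpectralPartition d S →
          Tendsto
            (fun n : ℕ =>
              ((BlockModel.sbm a b n).prod (BlockModel.colouringLaw n)).real
                {ω | BlockModel.IsCorrect γ (BlockModel.partitionAlg a b S n ω.1 ω.2)})
            atTop (𝓝 1) := by
  refine ⟨25600, 57600 * 10 ^ 13, by norm_num, by norm_num, ?_⟩
  intro a b γ hb hab hγ hΔ d hd S hS
  apply BlockModel.tendsto_correct_of_tendsto_failure
  -- In the second case log(1/γ) ≥ 1 - γ > 1/57600, so the choice of C₁ gives (a-b)² ≥ 10^13 (a+b)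
  -- and also absorbs the 72 and the log 4.
  rcases le_or_gt (1 - γ) (1 / 57600) with h | h
  · exact BlockModel.tendsto_failure_of_one_sub_le hb.le hab h hS
  · have hD : 0 < a + b := by linarith
    have hlog : Real.log (1 / γ) = -Real.log γ := by rw [one_div, Real.log_inv]
    have h1 := Real.log_le_sub_one_of_pos hγ
    rw [hlog] at hΔ
    have h4 := Real.log_le_sub_one_of_pos (by norm_num : (0 : ℝ) < 4)
    refine BlockModel.tendsto_failure_of_le hb.le hab hγ ?_ ?_ hd hS
    · rw [← le_div_iff₀ hD]
      linarith
    · rw [← Real.le_log_iff_exp_le (by positivity), Real.log_div hγ.ne' (by norm_num)]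
      linarith
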